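/- Notation. For $f\in\ell^1(\mathbb Z)$ put $\widehat f(\xi)=\sum_{n\in\mathbb Z}f(n)e^{-2\pi i n\xi}$, and for a bounded $1$-periodic measurable $h$ put $\check h(n)=\int_{(-1/2,1/2]}h(\xi)e^{2\pi i n\xi}\,d\xi$. A bounded measurable $m:\mathbb R\to\mathbb C$ is an $L^p(\mathbb R)$ multiplier of norm (at most) $B$ if the operator $Tf=\mathscr F^{-1}(m\cdot\mathscr F f)$ satisfies $\|Tf\|_{L^p}\le B\|f\|_{L^p}$ (for Schwartz $f$, hence, for $p<\infty$, on $L^p(\mathbb R)$ by density), where $\mathscr F$ is the Fourier transform on $\mathbb R$. For a finite set $Z$ of positive integers let $$\mathcal R(Z)=\{a/q: q\in Z,\ 1\le a\le q,\ \gcd(a,q)=1\},\qquad \Omega(Z)=\max\{\omega(q):q\in Z\},$$ where $\omega(q)$ is the number of distinct primes dividing $q$ (and $\Omega(\emptyset)=0$). Given $m$ and $\varepsilon>0$, for $f\in\ell^1(\mathbb Z)$ and $u\in\mathcal R(Z)$ let $$f_u=\Big(\xi\mapsto\sum_{\ell\in\mathbb Z}m\big(\varepsilon^{-1}(\xi-\ell-u)\big)\,\widehat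 f(\xi)\Big)^{\check{}}.$$ Theorem. Let $r\ge1$ be an integer and $B\ge0$. There is a constant $C_{2r}$, depending only on $r$ and $B$, such that the following holds. Let $m$ be an $L^{2r}(\mathbb R)$ multiplier of norm at most $B$ that vanishes outside $(-1/2,1/2]$; let $Z$ be a set of pairwise coprime integers contained in $(1,q(Z)]$, where $q(Z)$ is a positive integer (for example $q(Z)=\max Z$); and let $0<\varepsilon<r^{-1}q(Z)^{-2r}$. Then for every $u\in\mathcal R(Z)$ the map $f\mapsto f_u$, defined on $\ell^1(\mathbb Z)$, has a unique extension to a bounded linear operator on $\ell^{2r}(\mathbb Z)$, again written $f\mapsto f_u$, and for all $f\in\ell^{2r}(\mathbb Z)$ $$\Big\|\sum_{a/q\in\mathcal R(Z)}f_{a/q}\Big\|_{\ell^{2r}(\mathbb Z)}\le C_{2r}\,\big(2^{\Omega(Z)}\big)^{1-1/r}\,\|f\|_{\ell^{2r}(\mathbb Z)}.$$ In particular $C_{2r}$ is independent of $Z$, $\varepsilon$ and $f$. -/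

import Mathlib

open scoped NNReal ENNReal FourierTransform SchwartzMap

namespace IonescuWainger

noncomputable section

/-- The Fourier series `∑ₙ f(n) e^{-2πinξ}` of a function `f ∈ ℓ¹(ℤ)`; it is `1`-periodic in `ξ`. -/
def fourierZ (f : ℤ → ℂ) (ξ : ℝ) : ℂ :=
  ∑' n : ℤ, f n * Complex.exp (-(2 * Real.pi * Complex.I * n * ξ))

/-- The Fourier inverse on `ℤ` of a `1`-periodic function `h`:
`n ↦ ∫_{(-1/2,1/2]} h(ξ) e^{2πinξ} dξ`. -/
def invFourierZ (h : ℝ → ℂ) (n : ℤ) : ℂ :=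
  ∫ ξ in Set.Ioc (-(1 / 2) : ℝ) (1 / 2), h ξ * Complex.exp (2 * Real.pi * Complex.I * n * ξ)

/-- `m` is an `L^p(ℝ)` multiplier of norm (at most) `B`: it is bounded and measurable, and
`‖𝓕⁻¹(m · 𝓕 f)‖_p ≤ B ‖f‖_p`. The operator is tested on Schwartz functions, where the formula
makes literal sense; for `p < ∞` these are dense in `L^p(ℝ)` and the operator extends uniquely. -/
structure IsLpMultiplier (m : ℝ → ℂ) (p : ℝ≥0∞) (B : ℝ≥0) : Prop where
  measurable : Measurable m
  bounded : ∃ M : ℝ, ∀ ξ, ‖m ξ‖ ≤ M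
  bound : ∀ f : 𝓢(ℝ, ℂ),
    MeasureTheory.eLpNorm (𝓕⁻ (fun ξ : ℝ => m ξ * 𝓕 (f : ℝ → ℂ) ξ)) p MeasureTheory.volume
      ≤ B * MeasureTheory.eLpNorm (f : ℝ → ℂ) p MeasureTheory.volume

/-- The `1`-periodic multiplier `ξ ↦ ∑_{ℓ ∈ ℤ} m(ε⁻¹(ξ - ℓ - u))`. -/
def shiftedMultiplier (m : ℝ → ℂ) (ε : ℝ) (u : ℚ) (ξ : ℝ) : ℂ :=
  ∑' l : ℤ, m (ε⁻¹ * (ξ - l - u))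

/-- For `f ∈ ℓ¹(ℤ)`, the function `f_u` whose Fourier transform is
`∑_{ℓ ∈ ℤ} m(ε⁻¹(ξ - ℓ - u)) · f̂(ξ)`. -/
def piece (m : ℝ → ℂ) (ε : ℝ) (u : ℚ) (f : ℤ → ℂ) : ℤ → ℂ :=
  invFourierZ (fun ξ => shiftedMultiplier m ε u ξ * fourierZ f ξ)

/-- The complex sequence space `ℓ^p(ℤ)`. -/
abbrev Ell (p : ℝ≥0∞) := lp (fun _ : ℤ => ℂ) p

/-- `T` is a bounded linear operator on `ℓ^p(ℤ)` which agrees on `ℓ¹(ℤ) ∩ ℓ^p(ℤ)` with the map `S`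
(so for `1 ≤ p < ∞`, where `ℓ¹(ℤ)` is a dense subspace of `ℓ^p(ℤ)`, there is at most one). -/
def IsBoundedExtension (p : ℝ≥0∞) (S : (ℤ → ℂ) → (ℤ → ℂ)) (T : Ell p →ₗ[ℂ] Ell p) : Prop :=
  (∃ A : ℝ, ∀ f : Ell p, ‖T f‖ ≤ A * ‖f‖) ∧
    ∀ f : Ell p, (Summable fun n : ℤ => ‖f n‖) → ∀ n : ℤ, T f n = S (⇑f) n

end

/-- The set `R(Z) = {a/q : q ∈ Z, 1 ≤ a ≤ q, (a,q) = 1}`. -/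
def fractions (Z : Finset ℕ) : Finset ℚ :=
  Z.biUnion fun q => ((Finset.Icc 1 q).filter fun a => Nat.Coprime a q).image fun a : ℕ => (a : ℚ) / q

/-- `Ω(Z) = max {ω(q) : q ∈ Z}`, with `ω(q)` the number of distinct primes dividing `q`. -/
def maxOmega (Z : Finset ℕ) : ℕ :=
  Z.sup fun q => ArithmeticFunction.cardDistinctFactors q

end IonescuWainger

open IonescuWainger

/-!
The theorem is a form of the Ionescu-Wainger multiplier theorem. Write `R = r - 1`, so that the
exponent is `2R + 2`, and `e(t) = exp(2πit)`. On `ℓ¹(ℤ)` the map `f ↦ f_u` is a convolution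
(`hasSum_piece`). Hence everything reduces to finitely supported `f`, for which `f_u` is
`modPiece`: the operator with symbol `m` on the line, applied to point masses at the points of `εℤ`
and sampled there. Extension and uniqueness in `ℓ^{2R+2}(ℤ)` follow from the density of the
finitely supported sequences.

For the bound, put `F_q = ∑_{(a,q)=1} f_{a/q}`, so that the sum to be estimated is `∑_q F_q`. The
frequencies of `f_{a/q}` lie within `ε/2` of `a/q`. A product of `2R + 2` pieces, some of them
conjugated, has frequencies within `(R + 1)ε` of a signed sum of the fractions; if this sum is not
an integer, its distance from `ℤ` is at least the reciprocal of a common denominator, which the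
hypothesis on `ε` makes larger than `(R + 1)ε`, so the product sums to `0` over `ℤ`
(`Spectral.tsum_eq_zero_of_mixedFreq`). Since the denominators are pairwise coprime, this happens
whenever the fractions with one of the denominators have a nonintegral signed sum. There are two
consequences.

* The mixed moments in which some `F_q` occurs exactly once vanish
  (`integral_block_mul_eq_zero`), so `∑ F_q` is dominated in `ℓ^{2R+2}` by the square function
  `(∑ |F_q|²)^{1/2}` (`exists_superorthogonality_const`).
* In a moment of `∑ |F_q|²`, a factor `|F_q|²` whose denominator occurs only once may be replaced
  by `∑_a |f_{a/q}|²` (`integral_sub_mul_eq_zero`), so this square function is dominated by that of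
  all the pieces together with the diagonal term `∑_q ‖F_q‖^{2R+2}` (`exists_decoupling_const`).

The square function of all the pieces is bounded independently of `Z`
(`exists_squareFunction_const`): random signs and transference from the line replace `m` by a smooth
bump, for which a large sieve inequality localized at the scale `1/ε` gives a pointwise bound.

The diagonal term is the only one which costs powers of `2^Ω` (`exists_block_const`). In a residue
class modulo `q`, `F_q` is a single operator with symbol `m` applied to `f` multiplied by a
Ramanujan sum, and transference again replaces `m` by the bump. For the bump, the large sieve gives
an `ℓ²` bound summed over `q`, and the divisor formula for Ramanujan sums gives an `ℓ^∞` bound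
`O(2^Ω)`. Real interpolation between the two gives the factor `(2^Ω)^{2R}` for the
`(2R+2)`-nd powers, which is `(2^Ω)^{1 - 1/r}` for the norms.
-/

namespace IonescuWainger

open MeasureTheory Filter Topology

/-! ### Characters, a bump function and its kernel -/

/-- The additive character `e(t) = exp(2πit)`. -/
noncomputable def e (t : ℝ) : ℂ := Complex.exp (2 * Real.pi * Complex.I * t)

lemma e_add (s t : ℝ) : e (s + t) = e s * e t := by
  simp only [e, ← Complex.exp_add]; push_cast; ring_nf

@[simp] lemma e_zero : e 0 = 1 := by simp [e]

@[simp] lemma norm_e (t : ℝ) : ‖e t‖ = 1 := by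
  rw [e, show 2 * (Real.pi : ℂ) * Complex.I * t = ((2 * Real.pi * t : ℝ) : ℂ) * Complex.I by
    push_cast; ring]
  exact Complex.norm_exp_ofReal_mul_I _

lemma conj_e (t : ℝ) : (starRingEnd ℂ) (e t) = e (-t) := by
  rw [e, e, ← Complex.exp_conj]; simp [Complex.conj_ofNat]

lemma e_int (n : ℤ) : e n = 1 := by
  rw [e, Complex.exp_eq_one_iff]; exact ⟨n, by push_cast; ring⟩

lemma e_eq_one_iff (t : ℝ) : e t = 1 ↔ ∃ n : ℤ, t = n := by
  constructor
  · intro h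
    rw [e, Complex.exp_eq_one_iff] at h
    obtain ⟨n, hn⟩ := h
    refine ⟨n, ?_⟩
    have h2 : (2 * (Real.pi : ℂ) * Complex.I) ≠ 0 := by simp [Real.pi_ne_zero]
    have : (t : ℂ) = n := by
      apply mul_left_cancel₀ h2; rw [hn]; ring
    exact_mod_cast this
  · rintro ⟨n, rfl⟩; exact e_int n

lemma continuous_e : Continuous e := by unfold e; fun_prop

@[fun_prop] lemma _root_.Continuous.e_comp {X : Type*} [TopologicalSpace X] {g : X → ℝ}
    (hg : Continuous g) : Continuous fun x => e (g x) := continuous_e.comp hg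

/-- The inverse Fourier transform of `h` on the line, written as an explicit integral. -/
noncomputable def kernel (h : ℝ → ℂ) (z : ℝ) : ℂ := ∫ ξ, h ξ * e (z * ξ)

lemma kernel_eq_fourierInv (h : ℝ → ℂ) : kernel h = 𝓕⁻ h := by
  ext z
  rw [kernel, Real.fourierInv_eq']
  refine integral_congr_ae (Eventually.of_forall fun ξ => ?_)
  simp only [e, smul_eq_mul, RCLike.inner_apply, conj_trivial]
  rw [mul_comm]; congr 2; push_cast; ring

lemma integrable_mul_e {h : ℝ → ℂ} (hh : Integrable h) (z : ℝ) :
    Integrable fun ξ => h ξ * e (z * ξ) :=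
  hh.mul_bdd (c := 1) (by fun_prop) (Eventually.of_forall fun ξ => by simp)

lemma continuous_kernel {h : ℝ → ℂ} (hh : Integrable h) : Continuous (kernel h) := by
  refine continuous_of_dominated (bound := fun ξ => ‖h ξ‖)
    (fun z => (integrable_mul_e hh z).aestronglyMeasurable) (fun z => ?_) hh.norm ?_
  · exact Eventually.of_forall fun ξ => by simp
  · exact Eventually.of_forall fun ξ => by fun_prop

/-- A smooth bump equal to `1` on `[-1/2, 1/2]` and supported in `[-1, 1]`. -/
noncomputable def realBump : ContDiffBump (0 : ℝ) := ⟨1 / 2, 1, by norm_num, by norm_num⟩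

/-- `realBump` as a complex-valued function. -/
noncomputable def bump (ξ : ℝ) : ℂ := (realBump ξ : ℂ)

lemma bump_eq_one {ξ : ℝ} (h : |ξ| ≤ 1 / 2) : bump ξ = 1 := by
  rw [bump, realBump.one_of_mem_closedBall]
  · simp
  · simpa [realBump, Real.dist_eq] using h

lemma contDiff_bump : ContDiff ℝ ((⊤ : ℕ∞) : WithTop ℕ∞) bump :=
  Complex.ofRealCLM.contDiff.comp realBump.contDiff

lemma hasCompactSupport_bump : HasCompactSupport bump :=
  realBump.hasCompactSupport.comp_left (g := fun x : ℝ => (x : ℂ)) (by simp)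

lemma integrable_bump : Integrable bump :=
  contDiff_bump.continuous.integrable_of_hasCompactSupport hasCompactSupport_bump

/-- The kernel of `bump`, as a Schwartz function. -/
noncomputable def bumpKernel : 𝓢(ℝ, ℂ) :=
  𝓕⁻ (hasCompactSupport_bump.toSchwartzMap contDiff_bump)

lemma coe_bumpKernel : (bumpKernel : ℝ → ℂ) = kernel bump := by
  rw [kernel_eq_fourierInv, bumpKernel, SchwartzMap.fourierInv_coe]; rfl

lemma fourier_bumpKernel : 𝓕 (bumpKernel : ℝ → ℂ) = bump := by
  rw [← SchwartzMap.fourier_coe, bumpKernel, FourierTransform.fourier_fourierInv_eq]; rfl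

lemma exists_bumpKernel_decay : ∃ D : ℝ, 0 < D ∧ ∀ y, ‖kernel bump y‖ ≤ D / (1 + y ^ 2) := by
  obtain ⟨C0, h0⟩ := bumpKernel.decay 0 0
  obtain ⟨C2, h2⟩ := bumpKernel.decay 2 0
  refine ⟨C0 + C2, by linarith [h0.1, h2.1], fun y => ?_⟩
  have a := h0.2 y
  have b := h2.2 y
  simp only [norm_iteratedFDeriv_zero, pow_zero, one_mul, Real.norm_eq_abs, sq_abs] at a b
  rw [← coe_bumpKernel, le_div_iff₀ (by positivity)]
  nlinarith

lemma integrable_kernel_bump : Integrable (kernel bump) := by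
  rw [← coe_bumpKernel]; exact bumpKernel.integrable

/-- Functions with frequencies in `[-1/2, 1/2]` are reproduced by convolution with the kernel of
`bump`. -/
lemma kernel_eq_convolution {h : ℝ → ℂ} (hh : Integrable h)
    (hs : Function.support h ⊆ Set.Icc (-(1 / 2)) (1 / 2)) (y : ℝ) :
    kernel h y = ∫ t, kernel h t * kernel bump (y - t) := by
  have hint : Integrable (kernel bump) := integrable_kernel_bump
  have inner (ξ : ℝ) : ∫ t, e (t * ξ) * kernel bump (y - t) = e (y * ξ) * bump ξ := by
    rw [← integral_sub_left_eq_self _ volume y, ← congrFun fourier_bumpKernel ξ, coe_bumpKernel,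
      Real.fourier_eq', ← integral_const_mul]
    refine integral_congr_ae (Eventually.of_forall fun t => ?_)
    simp only [smul_eq_mul, RCLike.inner_apply, conj_trivial, sub_sub_cancel]
    rw [sub_mul, sub_eq_add_neg, e_add, mul_assoc]
    congr 2
    simp only [e]; congr 1; push_cast; ring
  calc kernel h y = ∫ ξ, h ξ * ∫ t, e (t * ξ) * kernel bump (y - t) := by
        refine integral_congr_ae (Eventually.of_forall fun ξ => ?_)
        simp only [inner]
        by_cases hξ : h ξ = 0
        · simp [hξ]
        · have := hs hξ
          rw [bump_eq_one (abs_le.2 ⟨this.1, this.2⟩), mul_one]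
    _ = ∫ ξ, ∫ t, h ξ * (e (t * ξ) * kernel bump (y - t)) := by
        simp only [integral_const_mul]
    _ = ∫ t, ∫ ξ, h ξ * (e (t * ξ) * kernel bump (y - t)) := by
        refine integral_integral_swap ?_
        have h1 : Integrable (fun z : ℝ × ℝ => h z.1 * kernel bump (y - z.2)) :=
          hh.mul_prod (hint.comp_sub_left y)
        have := h1.mul_bdd (c := 1) (g := fun z : ℝ × ℝ => e (z.2 * z.1)) (by fun_prop)
          (Eventually.of_forall fun z => by simp)
        refine this.congr (Eventually.of_forall fun z => ?_)
        simp only [Function.uncurry]; ring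
    _ = _ := by
        refine integral_congr_ae (Eventually.of_forall fun t => ?_)
        simp only [kernel]
        rw [← integral_mul_const]
        refine integral_congr_ae (Eventually.of_forall fun ξ => ?_)
        simp only; ring

/-! ### Sums over arithmetic progressions -/

/-- Comparison of a sum over the lattice `δℤ` with the total variation of `arctan`. -/
lemma sum_lattice_le {δ : ℝ} (h0 : 0 < δ) (h1 : δ ≤ 1) (x : ℝ) (J : Finset ℤ) :
    ∑ j ∈ J, 1 / (1 + (δ * j + x) ^ 2) ≤ 10 / δ := by
  have key (j : ℤ) : δ / 3 * (1 / (1 + (δ * j + x) ^ 2)) ≤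
      Real.arctan (δ * (j + 1 : ℤ) + x) - Real.arctan (δ * j + x) := by
    have hlt : δ * j + x < δ * (j + 1 : ℤ) + x := by push_cast; nlinarith
    obtain ⟨c, hc, hc'⟩ := exists_hasDerivAt_eq_slope Real.arctan (fun x => 1 / (1 + x ^ 2)) hlt
      Real.continuous_arctan.continuousOn (fun t _ => Real.hasDerivAt_arctan t)
    have hd : δ * (j + 1 : ℤ) + x - (δ * j + x) = δ := by push_cast; ring
    rw [hd, eq_div_iff h0.ne'] at hc'
    rw [← hc', div_mul_eq_mul_div, div_le_iff₀ (by norm_num), mul_one_div, div_le_iff₀ (by positivity)]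
    have hc2 : c ^ 2 ≤ 2 * (δ * j + x) ^ 2 + 2 := by
      have h3 : |c - (δ * j + x)| ≤ 1 := by
        rw [abs_le]; push_cast at hc; constructor <;> nlinarith [hc.1, hc.2]
      nlinarith [sq_abs (c - (δ * j + x)), abs_nonneg (c - (δ * j + x)),
        sq_nonneg (c - 2 * (δ * j + x))]
    have hpos : 0 < 1 + c ^ 2 := by positivity
    rw [show 1 / (1 + c ^ 2) * δ * 3 * (1 + (δ * j + x) ^ 2) =
      δ * (3 * (1 + (δ * j + x) ^ 2) / (1 + c ^ 2)) by field_simp]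
    refine le_mul_of_one_le_right h0.le ?_
    rw [one_le_div hpos]; nlinarith
  have tel (N : ℕ) (a : ℤ) : ∑ i ∈ Finset.range N,
      (Real.arctan (δ * (a + i + 1 : ℤ) + x) - Real.arctan (δ * (a + i : ℤ) + x)) ≤ Real.pi := by
    have := Finset.sum_range_sub (fun i : ℕ => Real.arctan (δ * (a + i : ℤ) + x)) N
    calc _ = ∑ i ∈ Finset.range N, (Real.arctan (δ * (a + (i + 1 : ℕ) : ℤ) + x) -
          Real.arctan (δ * (a + i : ℤ) + x)) := by
            refine Finset.sum_congr rfl fun i _ => ?_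
            push_cast; ring_nf
      _ ≤ _ := by
            rw [this]
            exact (sub_le_sub (Real.arctan_lt_pi_div_two _).le
              (Real.neg_pi_div_two_lt_arctan _).le).trans (by linarith)
  obtain ⟨a, N, hJ⟩ : ∃ (a : ℤ) (N : ℕ), J ⊆ (Finset.range N).image fun i : ℕ => a + i := by
    obtain ⟨a, ha⟩ := J.bddBelow
    obtain ⟨b, hb⟩ := J.bddAbove
    refine ⟨a, (b - a + 1).toNat, fun j hj => ?_⟩
    have := ha hj; have := hb hj
    simp only [Finset.mem_image, Finset.mem_range]
    exact ⟨(j - a).toNat, by omega, by omega⟩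
  have hle : δ / 3 * ∑ j ∈ J, 1 / (1 + (δ * j + x) ^ 2) ≤ Real.pi := by
    rw [Finset.mul_sum]
    refine (Finset.sum_le_sum_of_subset_of_nonneg hJ fun _ _ _ => by positivity).trans ?_
    rw [Finset.sum_image (by intro i _ j _ h; simpa using h)]
    exact (Finset.sum_le_sum fun i _ => key _).trans (tel N a)
  rw [le_div_iff₀ h0]
  have := Real.pi_lt_d2
  nlinarith

lemma summable_lattice {δ : ℝ} (h0 : 0 < δ) (h1 : δ ≤ 1) (x : ℝ) :
    Summable fun j : ℤ => 1 / (1 + (δ * j + x) ^ 2) :=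
  summable_of_sum_le (fun _ => by positivity) (sum_lattice_le h0 h1 x)

lemma tsum_lattice_le {δ : ℝ} (h0 : 0 < δ) (h1 : δ ≤ 1) (x : ℝ) :
    ∑' j : ℤ, ENNReal.ofReal (1 / (1 + (δ * j + x) ^ 2)) ≤ ENNReal.ofReal (10 / δ) := by
  rw [← ENNReal.ofReal_tsum_of_nonneg (fun _ => by positivity) (summable_lattice h0 h1 x)]
  exact ENNReal.ofReal_le_ofReal
    ((summable_lattice h0 h1 x).tsum_le_of_sum_le (sum_lattice_le h0 h1 x))

/-! ### Sampling and transference from the line to the integers -/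

/-- Jensen's inequality for the weight `w`, with the total mass of `w` made explicit. -/
lemma lintegral_mul_pow_le {α : Type*} [MeasurableSpace α] {μ : Measure α} {f w : α → ℝ≥0∞}
    (hf : Measurable f) (hw : Measurable w) (p : ℕ) :
    (∫⁻ x, f x * w x ∂μ) ^ (p + 1) ≤ (∫⁻ x, w x ∂μ) ^ p * ∫⁻ x, f x ^ (p + 1) * w x ∂μ := by
  rcases Nat.eq_zero_or_pos p with rfl | hp
  · simp
  have hpq : (((p + 1 : ℕ) : ℝ)).HolderConjugate (((p + 1 : ℕ) : ℝ) / p) := by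
    rw [Real.holderConjugate_iff]
    have : (0 : ℝ) < p := by exact_mod_cast hp
    refine ⟨by push_cast; linarith, by push_cast; field_simp; ring⟩
  have h := ENNReal.lintegral_mul_le_Lp_mul_Lq (μ.withDensity w) hpq hf.aemeasurable
    (aemeasurable_const (b := (1 : ℝ≥0∞)))
  simp only [Pi.mul_apply, mul_one, ENNReal.one_rpow, lintegral_one, ENNReal.rpow_natCast] at h
  rw [lintegral_withDensity_eq_lintegral_mul _ hw hf,
    lintegral_withDensity_eq_lintegral_mul _ hw (hf.pow_const _), withDensity_apply _ .univ,
    setLIntegral_univ] at h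
  simp only [Pi.mul_apply] at h
  have h2 := pow_le_pow_left' h (p + 1)
  rw [mul_pow, ← ENNReal.rpow_natCast ((∫⁻ a, w a * f a ^ (p + 1) ∂μ) ^ _), ← ENNReal.rpow_mul,
    ← ENNReal.rpow_natCast ((∫⁻ x, w x ∂μ) ^ _), ← ENNReal.rpow_mul] at h2
  have hp0 : ((p : ℕ) : ℝ) ≠ 0 := by positivity
  have e1 : 1 / ((p + 1 : ℕ) : ℝ) * ((p + 1 : ℕ) : ℝ) = 1 := by field_simp
  have e2 : 1 / (((p + 1 : ℕ) : ℝ) / p) * ((p + 1 : ℕ) : ℝ) = p := by field_simp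
  rw [e1, e2, ENNReal.rpow_one, ENNReal.rpow_natCast] at h2
  simp only [mul_comm (w _)] at h2
  rw [mul_comm ((∫⁻ x, w x ∂μ) ^ p)]
  simpa using h2

/-- Band-limited functions are controlled on arithmetic progressions of step `δ ≤ 1`. -/
lemma exists_sampling_const (p : ℕ) : ∃ C : ℝ, 0 < C ∧ ∀ h : ℝ → ℂ, Integrable h →
    Function.support h ⊆ Set.Icc (-(1 / 2)) (1 / 2) → ∀ δ : ℝ, 0 < δ → δ ≤ 1 → ∀ x : ℝ,
    ∑' j : ℤ, ‖kernel h (δ * j + x)‖ₑ ^ (p + 1) ≤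
      ENNReal.ofReal (C / δ) * ∫⁻ y, ‖kernel h y‖ₑ ^ (p + 1) := by
  obtain ⟨D, hD, hdec⟩ := exists_bumpKernel_decay
  set I : ℝ := ∫ t, ‖kernel bump t‖ with hI
  have hI0 : 0 ≤ I := integral_nonneg fun _ => norm_nonneg _
  have hIe : ∫⁻ t, ‖kernel bump t‖ₑ = ENNReal.ofReal I :=
    (ofReal_integral_norm_eq_lintegral_enorm integrable_kernel_bump).symm
  refine ⟨(I + 1) ^ p * (D * 10), by positivity, fun h hh hs δ h0 h1 x => ?_⟩
  have hK := (continuous_kernel hh).measurable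
  have hψ := (continuous_kernel integrable_bump).measurable
  have pt (y : ℝ) : ‖kernel h y‖ₑ ^ (p + 1) ≤
      ENNReal.ofReal I ^ p * ∫⁻ t, ‖kernel h t‖ₑ ^ (p + 1) * ‖kernel bump (y - t)‖ₑ := by
    have h2 : ‖kernel h y‖ₑ ≤ ∫⁻ t, ‖kernel h t‖ₑ * ‖kernel bump (y - t)‖ₑ := by
      rw [kernel_eq_convolution hh hs y]
      refine (enorm_integral_le_lintegral_enorm _).trans_eq ?_
      simp only [enorm_mul]
    refine (pow_le_pow_left' h2 _).trans
      ((lintegral_mul_pow_le (by fun_prop) (by fun_prop) p).trans_eq ?_)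
    rw [lintegral_sub_left_eq_self (fun t => ‖kernel bump t‖ₑ) y, hIe]
  have hsum (t : ℝ) : ∑' j : ℤ, ‖kernel bump (δ * j + x - t)‖ₑ ≤ ENNReal.ofReal (D * (10 / δ)) := by
    rw [ENNReal.ofReal_mul hD.le]
    refine le_trans ?_ (mul_le_mul_right (tsum_lattice_le h0 h1 (x - t)) _)
    rw [← ENNReal.tsum_mul_left]
    refine ENNReal.tsum_le_tsum fun j => ?_
    rw [← ENNReal.ofReal_mul hD.le, ← ofReal_norm, mul_one_div, add_sub_assoc]
    exact ENNReal.ofReal_le_ofReal (hdec _)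
  calc _ ≤ ∑' j : ℤ, ENNReal.ofReal I ^ p *
        ∫⁻ t, ‖kernel h t‖ₑ ^ (p + 1) * ‖kernel bump (δ * j + x - t)‖ₑ :=
        ENNReal.tsum_le_tsum fun j => pt _
    _ = ENNReal.ofReal I ^ p * ∫⁻ t, ‖kernel h t‖ₑ ^ (p + 1) *
        ∑' j : ℤ, ‖kernel bump (δ * j + x - t)‖ₑ := by
        rw [ENNReal.tsum_mul_left, ← lintegral_tsum (fun j => by fun_prop)]
        simp only [ENNReal.tsum_mul_left]
    _ ≤ ENNReal.ofReal I ^ p * ∫⁻ t, ‖kernel h t‖ₑ ^ (p + 1) * ENNReal.ofReal (D * (10 / δ)) := by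
        gcongr with t; exact hsum t
    _ ≤ _ := by
        rw [lintegral_mul_const _ (by fun_prop), ← mul_assoc, mul_right_comm]
        gcongr
        rw [← ENNReal.ofReal_pow hI0, ← ENNReal.ofReal_mul (by positivity)]
        apply ENNReal.ofReal_le_ofReal
        rw [mul_div_assoc, mul_div_assoc]
        gcongr; linarith

/-- The operator with symbol `h(ξ/ε)` applied to the coefficients `c` on `s`, seen at the scale
`ε`: the integer `k` sits at the point `εk` of the line. -/
noncomputable def bandOp (h : ℝ → ℂ) (s : Finset ℤ) (ε : ℝ) (c : ℤ → ℂ) (y : ℝ) : ℂ :=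
  ε * ∑ k ∈ s, c k * kernel h (y - ε * k)

/-- The trigonometric polynomial `ε ∑ c(k) e(-εkξ)`. -/
noncomputable def trigPoly (s : Finset ℤ) (ε : ℝ) (c : ℤ → ℂ) (ξ : ℝ) : ℂ :=
  ε * ∑ k ∈ s, c k * e (-(ε * k * ξ))

lemma contDiff_trigPoly (s : Finset ℤ) (ε : ℝ) (c : ℤ → ℂ) :
    ContDiff ℝ ((⊤ : ℕ∞) : WithTop ℕ∞) (trigPoly s ε c) := by
  unfold trigPoly e
  refine contDiff_const.mul (ContDiff.sum fun k _ => contDiff_const.mul ?_)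
  refine ContDiff.cexp (contDiff_const.mul ?_)
  exact Complex.ofRealCLM.contDiff.comp (contDiff_const.mul contDiff_id).neg

lemma bandOp_eq_kernel {h : ℝ → ℂ} (hh : Integrable h) (s : Finset ℤ) (ε : ℝ) (c : ℤ → ℂ) :
    bandOp h s ε c = kernel fun ξ => h ξ * trigPoly s ε c ξ := by
  ext y
  simp only [bandOp, kernel, trigPoly]
  have : ∀ ξ, h ξ * (ε * ∑ k ∈ s, c k * e (-(ε * k * ξ))) * e (y * ξ) =
      ∑ k ∈ s, ε * c k * (h ξ * e ((y - ε * k) * ξ)) := by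
    intro ξ
    rw [Finset.mul_sum, Finset.mul_sum, Finset.sum_mul]
    refine Finset.sum_congr rfl fun k _ => ?_
    rw [show (y - ε * k) * ξ = -(ε * k * ξ) + y * ξ by ring, e_add]; ring
  simp only [this]
  rw [integral_finsetSum _ fun k _ => (integrable_mul_e hh _).const_mul _, Finset.mul_sum]
  refine Finset.sum_congr rfl fun k _ => ?_
  rw [integral_const_mul, mul_assoc]

lemma continuous_bandOp {h : ℝ → ℂ} (hh : Integrable h) (s : Finset ℤ) (ε : ℝ) (c : ℤ → ℂ) :
    Continuous (bandOp h s ε c) := by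
  have := continuous_kernel hh
  unfold bandOp; fun_prop

lemma bandOp_sum {ι : Type*} (h : ℝ → ℂ) (s : Finset ℤ) (ε : ℝ) (U : Finset ι) (a : ι → ℂ)
    (c : ι → ℤ → ℂ) (y : ℝ) :
    bandOp h s ε (fun k => ∑ u ∈ U, a u * c u k) y = ∑ u ∈ U, a u * bandOp h s ε (c u) y := by
  simp only [bandOp, Finset.mul_sum, Finset.sum_mul]
  rw [Finset.sum_comm]
  refine Finset.sum_congr rfl fun u _ => Finset.sum_congr rfl fun k _ => by ring

lemma eLpNorm_natCast_pow {f : ℝ → ℂ} {p : ℕ} (hp : p ≠ 0) :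
    eLpNorm f (p : ℝ≥0∞) volume ^ p = ∫⁻ y, ‖f y‖ₑ ^ p := by
  rw [eLpNorm_eq_lintegral_rpow_enorm_toReal (by simpa) (by simp), ENNReal.toReal_natCast,
    ← ENNReal.rpow_natCast, ← ENNReal.rpow_mul, one_div_mul_cancel (by simpa), ENNReal.rpow_one]
  simp

lemma integrable_of_multiplier {m : ℝ → ℂ} {p : ℝ≥0∞} {B : ℝ≥0} (hm : IsLpMultiplier m p B)
    (hs : Function.support m ⊆ Set.Ioc (-(1 / 2) : ℝ) (1 / 2)) : Integrable m := by
  obtain ⟨M, hM⟩ := hm.bounded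
  rw [← integrableOn_iff_integrable_of_support_subset hs]
  exact Measure.integrableOn_of_bounded (M := M) (by simp) hm.measurable.aestronglyMeasurable
    (Eventually.of_forall hM)

/-- The multiplier inequality on the line, for the function with Fourier transform
`bump · trigPoly`. -/
lemma lintegral_bandOp_multiplier_le {m : ℝ → ℂ} {p : ℕ} (hp : p ≠ 0) {B : ℝ≥0}
    (hm : IsLpMultiplier m (p : ℝ≥0∞) B)
    (hs : Function.support m ⊆ Set.Ioc (-(1 / 2) : ℝ) (1 / 2)) (s : Finset ℤ) (ε : ℝ)
    (c : ℤ → ℂ) :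
    ∫⁻ y, ‖bandOp m s ε c y‖ₑ ^ p ≤ (B : ℝ≥0∞) ^ p * ∫⁻ y, ‖bandOp bump s ε c y‖ₑ ^ p := by
  have hsupp : HasCompactSupport fun ξ => bump ξ * trigPoly s ε c ξ :=
    hasCompactSupport_bump.mul_right
  set g : 𝓢(ℝ, ℂ) := hsupp.toSchwartzMap (contDiff_bump.mul (contDiff_trigPoly s ε c)) with hg
  have hgc : (g : ℝ → ℂ) = fun ξ => bump ξ * trigPoly s ε c ξ := rfl
  have h1 : ((𝓕⁻ g : 𝓢(ℝ, ℂ)) : ℝ → ℂ) = bandOp bump s ε c := by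
    rw [SchwartzMap.fourierInv_coe, hgc, ← kernel_eq_fourierInv, bandOp_eq_kernel integrable_bump]
  have h2 : 𝓕 ((𝓕⁻ g : 𝓢(ℝ, ℂ)) : ℝ → ℂ) = fun ξ => bump ξ * trigPoly s ε c ξ := by
    rw [← SchwartzMap.fourier_coe, FourierTransform.fourier_fourierInv_eq, hgc]
  have h3 := hm.bound (𝓕⁻ g)
  have h4 : (fun ξ : ℝ => m ξ * (bump ξ * trigPoly s ε c ξ)) =
      fun ξ => m ξ * trigPoly s ε c ξ := by
    ext ξ
    by_cases hξ : m ξ = 0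
    · simp [hξ]
    · have := hs hξ
      rw [bump_eq_one (abs_le.2 ⟨this.1.le, this.2⟩), one_mul]
  simp only [h2] at h3
  rw [h4, ← kernel_eq_fourierInv, ← bandOp_eq_kernel (integrable_of_multiplier hm hs), h1] at h3
  rw [← eLpNorm_natCast_pow hp, ← eLpNorm_natCast_pow hp, ← mul_pow]
  exact pow_le_pow_left' h3 p

/-- Transference: the operator with symbol `m`, sampled along an arithmetic progression, is
dominated by the one with symbol `bump` on the line. -/
theorem exists_transference_const (p : ℕ) (B : ℝ≥0) : ∃ C : ℝ, 0 < C ∧ ∀ m : ℝ → ℂ,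
    IsLpMultiplier m ((p + 1 : ℕ) : ℝ≥0∞) B → Function.support m ⊆ Set.Ioc (-(1 / 2) : ℝ) (1 / 2) →
    ∀ (s : Finset ℤ) (ε : ℝ) (c : ℤ → ℂ) (δ : ℝ), 0 < δ → δ ≤ 1 → ∀ x : ℝ,
    ∑' j : ℤ, ‖bandOp m s ε c (δ * j + x)‖ₑ ^ (p + 1) ≤
      ENNReal.ofReal (C / δ) * ∫⁻ y, ‖bandOp bump s ε c y‖ₑ ^ (p + 1) := by
  obtain ⟨C, hC, H⟩ := exists_sampling_const p
  refine ⟨C * ((B : ℝ) ^ (p + 1) + 1), by positivity, fun m hm hs s ε c δ h0 h1 x => ?_⟩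
  have hmi := integrable_of_multiplier hm hs
  have hi : Integrable fun ξ => m ξ * trigPoly s ε c ξ := by
    have hsub : Function.support (fun ξ => m ξ * trigPoly s ε c ξ) ⊆ Set.Icc (-(1 / 2)) (1 / 2) :=
      (Function.support_mul_subset_left _ _).trans (hs.trans Set.Ioc_subset_Icc_self)
    rw [← integrableOn_iff_integrable_of_support_subset hsub]
    exact hmi.integrableOn.mul_continuousOn (contDiff_trigPoly s ε c).continuous.continuousOn
      isCompact_Icc
  have := H _ hi ((Function.support_mul_subset_left _ _).trans
    (hs.trans Set.Ioc_subset_Icc_self)) δ h0 h1 x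
  rw [← bandOp_eq_kernel hmi] at this
  refine this.trans ?_
  calc _ ≤ ENNReal.ofReal (C / δ) * ((B : ℝ≥0∞) ^ (p + 1) *
        ∫⁻ y, ‖bandOp bump s ε c y‖ₑ ^ (p + 1)) := by
        gcongr; exact lintegral_bandOp_multiplier_le (by simp) hm hs s ε c
    _ ≤ _ := by
        rw [← mul_assoc]
        gcongr
        rw [← ENNReal.ofReal_coe_nnreal, ← ENNReal.ofReal_pow (by positivity),
          ← ENNReal.ofReal_mul (by positivity), div_mul_eq_mul_div]
        apply ENNReal.ofReal_le_ofReal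
        gcongr; linarith

/-! ### A localized large sieve inequality -/

lemma integral_e_int (n : ℤ) : ∫ t in (0 : ℝ)..2, e (n * t) = if n = 0 then 2 else 0 := by
  split_ifs with h
  · simp [h]
  · have hc : (2 * (Real.pi : ℂ) * Complex.I * n) ≠ 0 := by
      simp [Real.pi_ne_zero, h]
    have : ∀ t : ℝ, e (n * t) = Complex.exp (2 * (Real.pi : ℂ) * Complex.I * n * t) := by
      intro t; rw [e]; congr 1; push_cast; ring
    simp only [this]
    rw [integral_exp_mul_complex hc]
    have h2 := e_int (n * 2)
    rw [e] at h2
    rw [show 2 * (Real.pi : ℂ) * Complex.I * n * (2 : ℝ) =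
      2 * Real.pi * Complex.I * (((n * 2 : ℤ) : ℝ) : ℂ) by push_cast; ring, h2]
    simp

lemma integral_norm_sq_trig (s : Finset ℤ) (c : ℤ → ℂ) :
    ∫ t in (0 : ℝ)..2, ‖∑ k ∈ s, c k * e (-(t * k))‖ ^ 2 = 2 * ∑ k ∈ s, ‖c k‖ ^ 2 := by
  have h1 (t : ℝ) : ((‖∑ k ∈ s, c k * e (-(t * k))‖ ^ 2 : ℝ) : ℂ) =
      ∑ k ∈ s, ∑ l ∈ s, c k * (starRingEnd ℂ) (c l) * e ((l - k : ℤ) * t) := by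
    rw [Complex.ofReal_pow, ← Complex.mul_conj', map_sum, Finset.sum_mul_sum]
    refine Finset.sum_congr rfl fun k _ => Finset.sum_congr rfl fun l _ => ?_
    rw [map_mul, conj_e, mul_mul_mul_comm, ← e_add]
    congr 2; push_cast; ring
  have h2 : ((∫ t in (0 : ℝ)..2, ‖∑ k ∈ s, c k * e (-(t * k))‖ ^ 2 : ℝ) : ℂ) =
      ((2 * ∑ k ∈ s, ‖c k‖ ^ 2 : ℝ) : ℂ) := by
    rw [← intervalIntegral.integral_ofReal]
    simp only [h1]
    rw [intervalIntegral.integral_finsetSum fun k _ =>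
      (Continuous.intervalIntegrable (by fun_prop) _ _)]
    have h3 (k : ℤ) (hk : k ∈ s) : ∫ t in (0 : ℝ)..2,
        ∑ l ∈ s, c k * (starRingEnd ℂ) (c l) * e ((l - k : ℤ) * t) = 2 * (‖c k‖ : ℂ) ^ 2 := by
      rw [intervalIntegral.integral_finsetSum fun k _ =>
        (Continuous.intervalIntegrable (by fun_prop) _ _)]
      simp only [intervalIntegral.integral_const_mul, integral_e_int, sub_eq_zero]
      rw [Finset.sum_eq_single k]
      · simp only [if_true, Complex.mul_conj']; ring
      · intro l _ hl; simp [hl]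
      · exact fun h => absurd hk h
    rw [Finset.sum_congr rfl h3]
    push_cast; rw [Finset.mul_sum]
  exact_mod_cast h2

lemma sq_integral_le {g : ℝ → ℝ} (hg : Continuous g) :
    (∫ t in (0 : ℝ)..1, g t) ^ 2 ≤ ∫ t in (0 : ℝ)..1, g t ^ 2 := by
  set I := ∫ t in (0 : ℝ)..1, g t with hI
  have h1 : 0 ≤ ∫ t in (0 : ℝ)..1, (g t - I) ^ 2 :=
    intervalIntegral.integral_nonneg (by norm_num) fun _ _ => sq_nonneg _
  have h2 : ∫ t in (0 : ℝ)..1, (g t - I) ^ 2 = (∫ t in (0 : ℝ)..1, g t ^ 2) - 2 * I * I + I ^ 2 := by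
    have : ∀ t, (g t - I) ^ 2 = g t ^ 2 - 2 * I * g t + I ^ 2 := fun t => by ring
    simp only [this]
    rw [intervalIntegral.integral_add, intervalIntegral.integral_sub,
      intervalIntegral.integral_const_mul, ← hI]
    · simp
    all_goals exact Continuous.intervalIntegrable (by fun_prop) _ _
  nlinarith

/-- The Fourier transform of the truncated exponential `exp(-t)` on `[0, 1]`. Unlike that of a
smooth cutoff it has no zeros, and it decays only like `1/|z|`. -/
noncomputable def expWeight (z : ℝ) : ℂ := ∫ t in (0 : ℝ)..1, (Real.exp (-t) : ℂ) * e (z * t)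

lemma one_div_norm_expWeight_sq_le (z : ℝ) :
    expWeight z ≠ 0 ∧ 1 / ‖expWeight z‖ ^ 2 ≤ 160 * (1 + z ^ 2) := by
  set w : ℂ := -1 + 2 * Real.pi * Complex.I * z with hw
  have hw2 : ‖w‖ ^ 2 = 1 + (2 * Real.pi * z) ^ 2 := by
    rw [← Complex.normSq_eq_norm_sq, Complex.normSq_apply]; simp [hw]; ring
  have hw0 : w ≠ 0 := by
    intro h; rw [h] at hw2; simp at hw2; nlinarith [sq_nonneg (2 * Real.pi * z)]
  have h1 : expWeight z = (Complex.exp w - 1) / w := by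
    have : ∀ t : ℝ, (Real.exp (-t) : ℂ) * e (z * t) = Complex.exp (w * t) := by
      intro t
      rw [e]; push_cast; rw [← Complex.exp_add]; congr 1; rw [hw]; ring
    simp only [expWeight, this]
    rw [integral_exp_mul_complex hw0]; simp
  have h2 : 1 / 2 ≤ ‖Complex.exp w - 1‖ := by
    have h3 : ‖Complex.exp w‖ ≤ 1 / 2 := by
      rw [Complex.norm_exp]
      have : w.re = -1 := by simp [hw]
      rw [this, Real.exp_neg, one_div]
      exact inv_anti₀ (by norm_num) (by linarith [Real.add_one_le_exp (1 : ℝ)])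
    have := norm_sub_norm_le (1 : ℂ) (Complex.exp w)
    rw [norm_sub_rev, norm_one] at this; linarith
  have h4 : expWeight z ≠ 0 := by
    rw [h1]; refine div_ne_zero ?_ hw0
    intro h; rw [h] at h2; norm_num at h2
  refine ⟨h4, ?_⟩
  rw [h1, norm_div, div_pow, one_div_div, hw2, div_le_iff₀ (by positivity)]
  have hpi : Real.pi ^ 2 ≤ 10 := by nlinarith [Real.pi_lt_d2, Real.pi_pos]
  have h5 : 1 / 4 ≤ ‖Complex.exp w - 1‖ ^ 2 := by nlinarith
  have h6 : 1 + (2 * Real.pi * z) ^ 2 ≤ 40 * (1 + z ^ 2) := by nlinarith [sq_nonneg z]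
  nlinarith [sq_nonneg z]

/-- The large sieve inequality, localized near `y` at the scale `1/ε`. The smooth weights are
divided by `expWeight`, which exhibits each value at `v u` as an average over `[v u, v u + ε]`. -/
theorem exists_largeSieve_const : ∃ C : ℝ, 0 < C ∧ ∀ {ι : Type} (U : Finset ι) (v : ι → ℝ) (ε : ℝ),
    0 < ε → ε ≤ 1 → (∀ u ∈ U, 0 ≤ v u ∧ v u ≤ 1) →
    (∀ u ∈ U, ∀ u' ∈ U, u ≠ u' → ε ≤ |v u - v u'|) →
    ∀ (s : Finset ℤ) (f : ℤ → ℂ) (y : ℝ),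
    ∑ u ∈ U, ‖bandOp bump s ε (fun k => f k * e (-(v u * k))) y‖ ^ 2 ≤
      C * ε * ∑ k ∈ s, ‖f k‖ ^ 2 * (1 / (1 + (y - ε * k) ^ 2)) := by
  obtain ⟨D, hD, hdec⟩ := exists_bumpKernel_decay
  refine ⟨320 * D ^ 2, by positivity, fun {ι} U v ε h0 h1 hv hsep s f y => ?_⟩
  set z : ℤ → ℝ := fun k => y - ε * k with hz
  set c : ℤ → ℂ := fun k => ε * f k * kernel bump (z k) / expWeight (z k) with hc
  set S : ℝ → ℂ := fun t => ∑ k ∈ s, c k * e (-(t * k)) with hS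
  have hScont : Continuous S := by rw [hS]; fun_prop
  have rep (u : ι) : bandOp bump s ε (fun k => f k * e (-(v u * k))) y =
      ∫ t in (0 : ℝ)..1, (Real.exp (-t) : ℂ) * e (y * t) * S (v u + ε * t) := by
    have h2 (t : ℝ) : (Real.exp (-t) : ℂ) * e (y * t) * S (v u + ε * t) =
        ∑ k ∈ s, c k * e (-(v u * k)) * ((Real.exp (-t) : ℂ) * e (z k * t)) := by
      rw [hS]; simp only [Finset.mul_sum]
      refine Finset.sum_congr rfl fun k _ => ?_
      have : e (y * t) * e (-((v u + ε * t) * k)) = e (-(v u * k)) * e (z k * t) := by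
        rw [← e_add, ← e_add]; congr 1; simp only [hz]; ring
      linear_combination (Real.exp (-t) : ℂ) * c k * this
    simp only [h2]
    rw [intervalIntegral.integral_finsetSum fun k _ =>
      (Continuous.intervalIntegrable (by fun_prop) _ _), bandOp, Finset.mul_sum]
    refine Finset.sum_congr rfl fun k _ => ?_
    rw [intervalIntegral.integral_const_mul]
    have := (one_div_norm_expWeight_sq_le (z k)).1
    change _ = c k * e (-(v u * k)) * expWeight (z k)
    change ε * (f k * e (-(v u * k)) * kernel bump (z k)) = _
    simp only [hc]; field_simp
  have pt (u : ι) : ‖bandOp bump s ε (fun k => f k * e (-(v u * k))) y‖ ^ 2 ≤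
      ε⁻¹ * ∫ t in (v u)..(v u + ε), ‖S t‖ ^ 2 := by
    rw [rep u]
    have h3 : ‖∫ t in (0 : ℝ)..1, (Real.exp (-t) : ℂ) * e (y * t) * S (v u + ε * t)‖ ≤
        ∫ t in (0 : ℝ)..1, ‖S (v u + ε * t)‖ := by
      refine (intervalIntegral.norm_integral_le_integral_norm (by norm_num)).trans ?_
      refine intervalIntegral.integral_mono_on (by norm_num)
        (Continuous.intervalIntegrable (by fun_prop) _ _)
        (Continuous.intervalIntegrable (by fun_prop) _ _) fun t ht => ?_
      rw [norm_mul, norm_mul, norm_e, mul_one, Complex.norm_real, Real.norm_eq_abs,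
        abs_of_pos (Real.exp_pos _)]
      exact mul_le_of_le_one_left (norm_nonneg _) (Real.exp_le_one_iff.2 (by linarith [ht.1]))
    refine (pow_le_pow_left₀ (norm_nonneg _) h3 2).trans
      ((sq_integral_le (by fun_prop)).trans_eq ?_)
    rw [intervalIntegral.integral_comp_add_mul (fun t => ‖S t‖ ^ 2) h0.ne']
    simp
  have hint : IntervalIntegrable (fun t => ‖S t‖ ^ 2) volume 0 2 :=
    Continuous.intervalIntegrable (by fun_prop) _ _
  have hsum : ∑ u ∈ U, ∫ t in (v u)..(v u + ε), ‖S t‖ ^ 2 ≤ ∫ t in (0 : ℝ)..2, ‖S t‖ ^ 2 := by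
    have hle (a : ℝ) : a ≤ a + ε := by linarith
    rw [Finset.sum_congr rfl fun u _ => intervalIntegral.integral_of_le (hle (v u)),
      intervalIntegral.integral_of_le (by norm_num),
      ← integral_biUnion_finset _ (fun _ _ => measurableSet_Ioc)]
    · refine setIntegral_mono_set hint.1 (Eventually.of_forall fun _ => by positivity)
        (LE.le.eventuallyLE ?_)
      refine Set.iUnion₂_subset fun u hu t ht => ⟨?_, ?_⟩
      · linarith [ht.1, (hv u hu).1]
      · linarith [ht.2, (hv u hu).2]
    · intro u hu u' hu' hne
      refine Set.disjoint_left.2 fun t ht ht' => ?_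
      have := hsep u hu u' hu' hne
      rcases le_abs.1 this with h | h <;> linarith [ht.1, ht.2, ht'.1, ht'.2]
    · intro u _
      exact (Continuous.intervalIntegrable (by fun_prop) (v u) (v u + ε) :
        IntervalIntegrable (fun t => ‖S t‖ ^ 2) volume _ _).1
  calc _ ≤ ∑ u ∈ U, ε⁻¹ * ∫ t in (v u)..(v u + ε), ‖S t‖ ^ 2 := Finset.sum_le_sum fun u _ => pt u
    _ ≤ ε⁻¹ * (2 * ∑ k ∈ s, ‖c k‖ ^ 2) := by
        rw [← Finset.mul_sum, ← integral_norm_sq_trig]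
        exact mul_le_mul_of_nonneg_left hsum (by positivity)
    _ ≤ _ := by
        rw [Finset.mul_sum, Finset.mul_sum, Finset.mul_sum]
        refine Finset.sum_le_sum fun k _ => ?_
        have h5 := (one_div_norm_expWeight_sq_le (z k)).2
        have h6 := hdec (z k)
        have h7 : ‖kernel bump (z k)‖ ^ 2 ≤ (D / (1 + z k ^ 2)) ^ 2 :=
          pow_le_pow_left₀ (norm_nonneg _) h6 2
        have h8 : ‖c k‖ ^ 2 = ε ^ 2 * ‖f k‖ ^ 2 * (‖kernel bump (z k)‖ ^ 2 *
            (1 / ‖expWeight (z k)‖ ^ 2)) := by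
          simp only [hc, norm_div, norm_mul, Complex.norm_real, Real.norm_eq_abs, div_pow, mul_pow,
            sq_abs]; ring
        have h9 : ‖kernel bump (z k)‖ ^ 2 * (1 / ‖expWeight (z k)‖ ^ 2) ≤
            160 * D ^ 2 * (1 / (1 + z k ^ 2)) := by
          refine (mul_le_mul h7 h5 (by positivity) (by positivity)).trans_eq ?_
          have : (1 + z k ^ 2) ≠ 0 := by positivity
          field_simp
        rw [h8]
        calc _ ≤ ε⁻¹ * (2 * (ε ^ 2 * ‖f k‖ ^ 2 * (160 * D ^ 2 * (1 / (1 + z k ^ 2))))) := by gcongr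
          _ = _ := by field_simp; ring

/-! ### Superorthogonality and random signs -/

/-- A homogeneous form of Young's inequality. -/
lemma exists_young_const (A : ℝ) (hA : 0 ≤ A) (k : ℕ) : ∃ C : ℝ, 0 ≤ C ∧ ∀ x y : ℝ, 0 ≤ x → 0 ≤ y →
    A * (y * (x + y) ^ k) ≤ x ^ (k + 1) / 2 + C * y ^ (k + 1) := by
  set η : ℝ := 1 / (2 * A * 2 ^ k + 1) with hη
  have hη0 : 0 < η := by positivity
  have hη1 : η ≤ 1 := by
    rw [hη, div_le_one (by positivity)]; linarith [show 0 ≤ 2 * A * 2 ^ k by positivity]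
  have hη2 : A * η * 2 ^ k ≤ 1 / 2 := by
    rw [hη, mul_one_div, div_mul_eq_mul_div, div_le_iff₀ (by positivity)]; linarith
  refine ⟨A * (1 / η + 1) ^ k, by positivity, fun x y hx hy => ?_⟩
  rcases le_total y (η * x) with h | h
  · have h1 : x + y ≤ 2 * x := by nlinarith
    calc A * (y * (x + y) ^ k) ≤ A * (η * x * (2 * x) ^ k) := by gcongr
      _ = A * η * 2 ^ k * x ^ (k + 1) := by rw [mul_pow]; ring
      _ ≤ 1 / 2 * x ^ (k + 1) := by gcongr
      _ ≤ _ := by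
        have : 0 ≤ A * (1 / η + 1) ^ k * y ^ (k + 1) := by positivity
        linarith
  · have h1 : x + y ≤ (1 / η + 1) * y := by
      have : x ≤ 1 / η * y := by rw [div_mul_eq_mul_div, le_div_iff₀ hη0]; linarith
      linarith
    calc A * (y * (x + y) ^ k) ≤ A * (y * ((1 / η + 1) * y) ^ k) := by gcongr
      _ = A * (1 / η + 1) ^ k * y ^ (k + 1) := by rw [mul_pow]; ring
      _ ≤ _ := by linarith [show 0 ≤ x ^ (k + 1) / 2 by positivity]

lemma norm_pow_sub_pow_le_of_le {a b : ℂ} {M : ℝ} (ha : ‖a‖ ≤ M) (hb : ‖b‖ ≤ M) (n : ℕ) :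
    ‖a ^ (n + 1) - b ^ (n + 1)‖ ≤ (n + 1) * ‖a - b‖ * M ^ n := by
  have hM := (norm_nonneg a).trans ha
  induction n with
  | zero => simp
  | succ n ih =>
    have : a ^ (n + 1 + 1) - b ^ (n + 1 + 1) =
        a * (a ^ (n + 1) - b ^ (n + 1)) + (a - b) * b ^ (n + 1) := by ring
    rw [this]
    refine (norm_add_le _ _).trans ?_
    rw [norm_mul, norm_mul, norm_pow]
    calc _ ≤ M * ((n + 1) * ‖a - b‖ * M ^ n) + ‖a - b‖ * M ^ (n + 1) := by gcongr
      _ = _ := by push_cast; ring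

lemma norm_pow_mul_conj_pow_sub_le {a b : ℂ} {M : ℝ} (ha : ‖a‖ ≤ M) (hb : ‖b‖ ≤ M) (n : ℕ) :
    ‖a ^ n * (starRingEnd ℂ a) ^ (n + 1) - b ^ n * (starRingEnd ℂ b) ^ (n + 1)‖ ≤
      (2 * n + 1) * ‖a - b‖ * M ^ (2 * n) := by
  have hM := (norm_nonneg a).trans ha
  have hconj : ‖(starRingEnd ℂ a) ^ (n + 1) - (starRingEnd ℂ b) ^ (n + 1)‖ ≤
      (n + 1) * ‖a - b‖ * M ^ n := by
    rw [← map_pow, ← map_pow, ← map_sub, RCLike.norm_conj]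
    exact norm_pow_sub_pow_le_of_le ha hb n
  have h1 : ‖a ^ n - b ^ n‖ * M ≤ n * ‖a - b‖ * M ^ n := by
    rcases n with _ | n
    · simp
    · have := mul_le_mul_of_nonneg_right (norm_pow_sub_pow_le_of_le ha hb n) hM
      refine this.trans_eq ?_
      push_cast; ring
  have : a ^ n * (starRingEnd ℂ a) ^ (n + 1) - b ^ n * (starRingEnd ℂ b) ^ (n + 1) =
      (a ^ n - b ^ n) * (starRingEnd ℂ a) ^ (n + 1) +
        b ^ n * ((starRingEnd ℂ a) ^ (n + 1) - (starRingEnd ℂ b) ^ (n + 1)) := by ring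
  rw [this]
  refine (norm_add_le _ _).trans ?_
  rw [norm_mul, norm_mul, norm_pow, norm_pow, RCLike.norm_conj]
  calc _ ≤ ‖a ^ n - b ^ n‖ * M ^ (n + 1) + M ^ n * ((n + 1) * ‖a - b‖ * M ^ n) := by gcongr
    _ = ‖a ^ n - b ^ n‖ * M * M ^ n + M ^ n * ((n + 1) * ‖a - b‖ * M ^ n) := by ring
    _ ≤ n * ‖a - b‖ * M ^ n * M ^ n + M ^ n * ((n + 1) * ‖a - b‖ * M ^ n) := by gcongr
    _ = _ := by ring

/-- If the mixed moments in which one index occurs exactly once vanish, then the `L^{2R+2}` norm of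
a sum is controlled by that of its square function. In `|S|^{2R+2} = ∑ F_q S^R conj(S)^{R+1}`,
removing `F_q` from `S` costs a factor `F_q`, and the error is absorbed by Young's inequality. -/
theorem exists_superorthogonality_const (R : ℕ) : ∃ C : ℝ, 0 ≤ C ∧ ∀ {Ω κ : Type} [DecidableEq κ]
    [MeasurableSpace Ω] (μ : Measure Ω) (Z : Finset κ) (F : κ → Ω → ℂ), (∀ q, Measurable (F q)) →
    (∀ q ∈ Z, Integrable (fun x => ‖F q x‖ ^ (2 * R + 2)) μ) →
    (∀ q ∈ Z, ∫ x, F q x * ((∑ q' ∈ Z.erase q, F q' x) ^ R *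
      (starRingEnd ℂ (∑ q' ∈ Z.erase q, F q' x)) ^ (R + 1)) ∂μ = 0) →
    ∫ x, ‖∑ q ∈ Z, F q x‖ ^ (2 * R + 2) ∂μ ≤ C * ∫ x, (∑ q ∈ Z, ‖F q x‖ ^ 2) ^ (R + 1) ∂μ := by
  obtain ⟨C, hC, young⟩ := exists_young_const (2 * R + 1) (by positivity) (2 * R + 1)
  refine ⟨2 * C, by positivity, fun {Ω κ} _ _ μ Z F hmeas hF hvan => ?_⟩
  set τ : Ω → ℝ := fun x => ∑ q ∈ Z, ‖F q x‖ with hτ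
  have hτ0 (x) : 0 ≤ τ x := Finset.sum_nonneg fun _ _ => norm_nonneg _
  have hle (q) (hq : q ∈ Z) (x) : ‖F q x‖ ≤ τ x :=
    Finset.single_le_sum (f := fun q => ‖F q x‖) (fun _ _ => norm_nonneg _) hq
  have hτint : Integrable (fun x => τ x ^ (2 * R + 2)) μ := by
    have h1 : Integrable (fun x => (Z.card : ℝ) ^ (2 * R + 1) * ∑ q ∈ Z, ‖F q x‖ ^ (2 * R + 2)) μ :=
      (integrable_finsetSum _ hF).const_mul _
    refine h1.mono' (by fun_prop) (Eventually.of_forall fun x => ?_)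
    rw [Real.norm_of_nonneg (pow_nonneg (hτ0 x) _)]
    exact pow_sum_le_card_mul_sum_pow (fun _ _ => norm_nonneg _) _
  have bdd {E : Type} [NormedAddCommGroup E] [MeasurableSpace E] [BorelSpace E]
      [SecondCountableTopology E] (g : Ω → E) (hg : Measurable g) (K : ℝ)
      (h : ∀ x, ‖g x‖ ≤ K * τ x ^ (2 * R + 2)) : Integrable g μ :=
    (hτint.const_mul K).mono' hg.aestronglyMeasurable (Eventually.of_forall h)
  set S : Ω → ℂ := fun x => ∑ q ∈ Z, F q x with hS
  set V : ℂ → ℂ := fun z => z ^ R * (starRingEnd ℂ z) ^ (R + 1) with hV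
  have hSm : Measurable S := by fun_prop
  have hVm : Measurable V := by
    have : Continuous V := by fun_prop
    exact this.measurable
  have hVn (z : ℂ) : ‖V z‖ = ‖z‖ ^ (2 * R + 1) := by
    simp only [hV, norm_mul, norm_pow, RCLike.norm_conj]; ring
  set T : κ → Ω → ℂ := fun q x => ∑ q' ∈ Z.erase q, F q' x with hT
  have hTm (q) : Measurable (T q) := by fun_prop
  have hSτ (x) : ‖S x‖ ≤ τ x := norm_sum_le _ _
  have hTτ (q x) : ‖T q x‖ ≤ τ x := (norm_sum_le _ _).trans
    (Finset.sum_le_sum_of_subset_of_nonneg (Finset.erase_subset _ _) fun _ _ _ => norm_nonneg _)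
  have hST (q) (hq : q ∈ Z) (x) : S x - T q x = F q x := by
    simp only [hS, hT, ← Finset.add_sum_erase Z (fun q => F q x) hq, add_sub_cancel_right]
  have i1 (q) (hq : q ∈ Z) (G : Ω → ℂ) (hG : Measurable G) (hGτ : ∀ x, ‖G x‖ ≤ τ x) :
      Integrable (fun x => F q x * V (G x)) μ := by
    refine bdd _ ((hmeas q).mul (hVm.comp hG)) 1 fun x => ?_
    rw [norm_mul, hVn, one_mul]
    calc _ ≤ τ x * τ x ^ (2 * R + 1) := by
          gcongr
          · exact hle q hq x
          · exact hGτ x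
      _ = _ := by ring
  have i2 : Integrable (fun x => ‖S x‖ ^ (2 * R + 2)) μ := by
    refine bdd _ (by fun_prop) 1 fun x => ?_
    rw [Real.norm_of_nonneg (by positivity), one_mul]
    exact pow_le_pow_left₀ (norm_nonneg _) (hSτ x) _
  set σ : Ω → ℝ := fun x => √(∑ q ∈ Z, ‖F q x‖ ^ 2) with hσ
  have hσ2 (x) : σ x ^ 2 = ∑ q ∈ Z, ‖F q x‖ ^ 2 :=
    Real.sq_sqrt (Finset.sum_nonneg fun _ _ => by positivity)
  have hσ0 (x) : 0 ≤ σ x := Real.sqrt_nonneg _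
  have hFσ (q) (hq : q ∈ Z) (x) : ‖F q x‖ ≤ σ x :=
    Real.le_sqrt_of_sq_le
      (Finset.single_le_sum (f := fun q => ‖F q x‖ ^ 2) (fun _ _ => by positivity) hq)
  have hστ (x) : σ x ≤ τ x := by
    refine Real.sqrt_le_iff.2 ⟨hτ0 x, ?_⟩
    rw [sq (τ x)]
    simp only [hτ, Finset.sum_mul]
    refine Finset.sum_le_sum fun q hq => ?_
    rw [sq]; exact mul_le_mul_of_nonneg_left (hle q hq x) (norm_nonneg _)
  have i3 : Integrable (fun x => σ x ^ (2 * R + 2)) μ := by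
    refine bdd _ (by fun_prop) 1 fun x => ?_
    rw [Real.norm_of_nonneg (pow_nonneg (hσ0 x) _), one_mul]
    exact pow_le_pow_left₀ (hσ0 x) (hστ x) _
  have eqS : ((∫ x, ‖S x‖ ^ (2 * R + 2) ∂μ : ℝ) : ℂ) =
      ∫ x, ∑ q ∈ Z, F q x * (V (S x) - V (T q x)) ∂μ := by
    have i4 (q) (hq : q ∈ Z) : Integrable (fun x => F q x * (V (S x) - V (T q x))) μ := by
      simp only [mul_sub]
      exact (i1 q hq S hSm hSτ).sub (i1 q hq (T q) (hTm q) (hTτ q))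
    rw [integral_finsetSum _ i4]
    have : ∀ q ∈ Z, ∫ x, F q x * (V (S x) - V (T q x)) ∂μ = ∫ x, F q x * V (S x) ∂μ := by
      intro q hq
      simp only [mul_sub]
      rw [integral_sub (i1 q hq S hSm hSτ) (i1 q hq (T q) (hTm q) (hTτ q))]
      rw [show ∫ x, F q x * V (T q x) ∂μ = 0 from hvan q hq, sub_zero]
    rw [Finset.sum_congr rfl this, ← integral_finsetSum _ fun q hq => i1 q hq S hSm hSτ,
      ← integral_complex_ofReal]
    refine integral_congr_ae (Eventually.of_forall fun x => ?_)
    simp only [← Finset.sum_mul]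
    change ((‖S x‖ ^ (2 * R + 2) : ℝ) : ℂ) = S x * V (S x)
    rw [Complex.ofReal_pow, show 2 * R + 2 = 2 * (R + 1) by ring, pow_mul, ← Complex.mul_conj']
    simp only [hV]; ring
  have pt (x) : ‖∑ q ∈ Z, F q x * (V (S x) - V (T q x))‖ ≤
      ‖S x‖ ^ (2 * R + 2) / 2 + C * σ x ^ (2 * R + 2) := by
    refine (norm_sum_le _ _).trans (le_trans ?_ (young _ _ (norm_nonneg (S x)) (hσ0 x)))
    calc _ ≤ ∑ q ∈ Z, (2 * R + 1) * (‖F q x‖ ^ 2 * (‖S x‖ + σ x) ^ (2 * R)) := by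
          refine Finset.sum_le_sum fun q hq => ?_
          have hM : ‖S x‖ ≤ ‖S x‖ + σ x := by linarith [hσ0 x]
          have hM' : ‖T q x‖ ≤ ‖S x‖ + σ x := by
            have : T q x = S x - F q x := by rw [← hST q hq x]; ring
            rw [this]
            exact (norm_sub_le _ _).trans (by linarith [hFσ q hq x])
          have := norm_pow_mul_conj_pow_sub_le hM hM' R
          rw [hST q hq x] at this
          rw [norm_mul]
          calc _ ≤ ‖F q x‖ * ((2 * R + 1) * ‖F q x‖ * (‖S x‖ + σ x) ^ (2 * R)) := by gcongr
            _ = _ := by ring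
      _ = (2 * R + 1) * (σ x * (σ x * (‖S x‖ + σ x) ^ (2 * R))) := by
          rw [← Finset.mul_sum, ← Finset.sum_mul, ← hσ2]; ring
      _ ≤ (2 * R + 1) * (σ x * ((‖S x‖ + σ x) * (‖S x‖ + σ x) ^ (2 * R))) := by
          have := hσ0 x
          gcongr; linarith [norm_nonneg (S x)]
      _ = _ := by ring
  have fin : ∫ x, ‖S x‖ ^ (2 * R + 2) ∂μ ≤
      (∫ x, ‖S x‖ ^ (2 * R + 2) ∂μ) / 2 + C * ∫ x, σ x ^ (2 * R + 2) ∂μ := by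
    calc _ ≤ ‖((∫ x, ‖S x‖ ^ (2 * R + 2) ∂μ : ℝ) : ℂ)‖ := by
          rw [Complex.norm_real]; exact Real.le_norm_self _
      _ ≤ ∫ x, (‖S x‖ ^ (2 * R + 2) / 2 + C * σ x ^ (2 * R + 2)) ∂μ := by
          rw [eqS]
          exact norm_integral_le_of_norm_le ((i2.div_const 2).add (i3.const_mul C))
            (Eventually.of_forall pt)
      _ = _ := by
          rw [integral_add (i2.div_const 2) (i3.const_mul C), integral_div, integral_const_mul]
  have hσr (x) : σ x ^ (2 * R + 2) = (∑ q ∈ Z, ‖F q x‖ ^ 2) ^ (R + 1) := by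
    rw [← hσ2, ← pow_mul]; ring
  simp only [hσr] at fin
  linarith

/-- A sign `±1` encoded by a Boolean. -/
def sgn (b : Bool) : ℂ := if b then 1 else -1

lemma sgn_not (b : Bool) : sgn (!b) = -sgn b := by cases b <;> simp [sgn]

@[simp] lemma norm_sgn (b : Bool) : ‖sgn b‖ = 1 := by cases b <;> simp [sgn]

/-- Flipping the sign at one index. -/
def flipAt {ι : Type} [DecidableEq ι] (i : ι) : (ι → Bool) ≃ (ι → Bool) where
  toFun θ := Function.update θ i (!θ i)
  invFun θ := Function.update θ i (!θ i)
  left_inv θ := by simp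
  right_inv θ := by simp

lemma sum_eq_zero_of_flip {ι : Type} [DecidableEq ι] [Fintype ι] (i : ι) (g : (ι → Bool) → ℂ)
    (h : ∀ θ, g (flipAt i θ) = -g θ) : ∑ θ, g θ = 0 := by
  have h1 := Equiv.sum_comp (flipAt i) g
  simp only [h, Finset.sum_neg_distrib] at h1
  exact self_eq_neg.1 h1.symm

/-- Khinchine's inequality. For random signs, the superorthogonality condition holds because flipping
the sign at the index that occurs once changes the sign of the moment. -/
lemma exists_khinchine_const (R : ℕ) : ∃ C : ℝ, 0 ≤ C ∧ ∀ {ι : Type} [Fintype ι] [DecidableEq ι]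
    (a : ι → ℂ), ∑ θ : ι → Bool, ‖∑ i, sgn (θ i) * a i‖ ^ (2 * R + 2) ≤
      C * (2 ^ Fintype.card ι * (∑ i, ‖a i‖ ^ 2) ^ (R + 1)) := by
  obtain ⟨C, hC, H⟩ := exists_superorthogonality_const R
  refine ⟨C, hC, fun {ι} _ _ a => ?_⟩
  let _ : MeasurableSpace (ι → Bool) := ⊤
  have : MeasurableSingletonClass (ι → Bool) := ⟨fun _ => trivial⟩
  have key := H (Measure.count : Measure (ι → Bool)) Finset.univ (fun i θ => sgn (θ i) * a i)
    (fun i => measurable_from_top) (fun _ _ => Integrable.of_finite) (fun i _ => ?_)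
  · simpa [norm_mul] using key
  · rw [integral_count]
    refine sum_eq_zero_of_flip i _ fun θ => ?_
    have h1 : ∑ j ∈ Finset.univ.erase i, sgn (flipAt i θ j) * a j =
        ∑ j ∈ Finset.univ.erase i, sgn (θ j) * a j := by
      refine Finset.sum_congr rfl fun j hj => ?_
      simp [flipAt, Finset.ne_of_mem_erase hj]
    rw [h1]
    simp [flipAt, sgn_not]

/-- The lower bound in Khinchine's inequality, from the second moment and Jensen's inequality. -/
lemma pow_sum_sq_le_sum_signs (R : ℕ) {ι : Type} [Fintype ι] [DecidableEq ι] (a : ι → ℂ) :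
    2 ^ Fintype.card ι * (∑ i, ‖a i‖ ^ 2) ^ (R + 1) ≤
      ∑ θ : ι → Bool, ‖∑ i, sgn (θ i) * a i‖ ^ (2 * R + 2) := by
  have h2 : ∑ θ : ι → Bool, ‖∑ i, sgn (θ i) * a i‖ ^ 2 = 2 ^ Fintype.card ι * ∑ i, ‖a i‖ ^ 2 := by
    have hc : ∑ θ : ι → Bool, ((‖∑ i, sgn (θ i) * a i‖ ^ 2 : ℝ) : ℂ) =
        ((2 ^ Fintype.card ι * ∑ i, ‖a i‖ ^ 2 : ℝ) : ℂ) := by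
      have h3 (θ : ι → Bool) : ((‖∑ i, sgn (θ i) * a i‖ ^ 2 : ℝ) : ℂ) =
          ∑ i, ∑ j, sgn (θ i) * a i * (sgn (θ j) * starRingEnd ℂ (a j)) := by
        rw [Complex.ofReal_pow, ← Complex.mul_conj', map_sum, Finset.sum_mul_sum]
        refine Finset.sum_congr rfl fun i _ => Finset.sum_congr rfl fun j _ => ?_
        rw [map_mul]; congr 2; cases θ j <;> simp [sgn]
      simp only [h3]
      rw [Finset.sum_comm]
      push_cast
      rw [Finset.mul_sum]
      refine Finset.sum_congr rfl fun i _ => ?_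
      rw [Finset.sum_comm, Finset.sum_eq_single i]
      · have : ∀ θ : ι → Bool, sgn (θ i) * a i * (sgn (θ i) * starRingEnd ℂ (a i)) =
            (‖a i‖ : ℂ) ^ 2 := by
          intro θ; rw [← Complex.mul_conj']; cases θ i <;> simp [sgn]
        simp [this]
      · intro j _ hj
        refine sum_eq_zero_of_flip j _ fun θ => ?_
        simp [flipAt, sgn_not, Function.update_of_ne hj.symm]
      · simp
    exact_mod_cast hc
  have h4 := pow_sum_le_card_mul_sum_pow (s := (Finset.univ : Finset (ι → Bool)))
    (f := fun θ => ‖∑ i, sgn (θ i) * a i‖ ^ 2) (fun _ _ => by positivity) R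
  rw [h2] at h4
  simp only [Finset.card_univ, Fintype.card_fun, Fintype.card_bool, ← pow_mul] at h4
  rw [show 2 * (R + 1) = 2 * R + 2 by ring] at h4
  push_cast at h4
  rw [mul_pow, pow_succ ((2 : ℝ) ^ _), mul_assoc] at h4
  exact le_of_mul_le_mul_left h4 (by positivity)

/-! ### The square function over separated frequencies -/

lemma sum_enorm_pow {ι : Type*} (U : Finset ι) (a : ι → ℂ) (k : ℕ) :
    ∑ i ∈ U, ‖a i‖ₑ ^ k = ENNReal.ofReal (∑ i ∈ U, ‖a i‖ ^ k) := by
  rw [ENNReal.ofReal_sum_of_nonneg fun _ _ => by positivity]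
  refine Finset.sum_congr rfl fun i _ => ?_
  rw [ENNReal.ofReal_pow (norm_nonneg _), ofReal_norm]

/-- Jensen's inequality for finite weighted sums. -/
lemma sum_mul_pow_le {ι : Type*} (s : Finset ι) (f w : ι → ℝ) (hf : ∀ i, 0 ≤ f i)
    (hw : ∀ i, 0 ≤ w i) (p : ℕ) :
    (∑ i ∈ s, f i * w i) ^ (p + 1) ≤ (∑ i ∈ s, w i) ^ p * ∑ i ∈ s, f i ^ (p + 1) * w i := by
  rcases (Finset.sum_nonneg fun i (_ : i ∈ s) => hw i).eq_or_lt with h | h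
  · have h0 : ∀ i ∈ s, w i = 0 := (Finset.sum_eq_zero_iff_of_nonneg fun i _ => hw i).1 h.symm
    rw [Finset.sum_congr rfl fun i hi => by rw [h0 i hi, mul_zero]]
    simp only [Finset.sum_const_zero, ne_eq, Nat.succ_ne_zero, not_false_eq_true, zero_pow]
    exact mul_nonneg (pow_nonneg (h ▸ le_rfl) _)
      (Finset.sum_nonneg fun i _ => mul_nonneg (pow_nonneg (hf i) _) (hw i))
  · set W := ∑ i ∈ s, w i
    have := Real.pow_arith_mean_le_arith_mean_pow s (fun i => w i / W) f
      (fun i _ => div_nonneg (hw i) h.le) (by rw [← Finset.sum_div]; exact div_self h.ne')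
      (fun i _ => hf i) (p + 1)
    simp only [div_mul_eq_mul_div, ← Finset.sum_div, div_pow] at this
    rw [div_le_div_iff₀ (by positivity) h, pow_succ W p, ← mul_assoc] at this
    have := le_of_mul_le_mul_right this h
    simp only [mul_comm (w _)] at this
    rw [mul_comm (W ^ p)]; exact this

lemma lintegral_cauchy_kernel (a : ℝ) :
    ∫⁻ y, ENNReal.ofReal (1 / (1 + (y - a) ^ 2)) = ENNReal.ofReal Real.pi := by
  rw [lintegral_sub_right_eq_self (fun y : ℝ => ENNReal.ofReal (1 / (1 + y ^ 2))) a,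
    ← ofReal_integral_eq_lintegral_ofReal]
  · simp
  · simpa using integrable_inv_one_add_sq
  · exact Eventually.of_forall fun _ => by positivity

/-- The square function with symbol `bump` over `ε`-separated frequencies is bounded on the line. -/
lemma exists_line_squareFunction_const (R : ℕ) : ∃ C : ℝ, 0 < C ∧ ∀ {ι : Type} (U : Finset ι)
    (v : ι → ℝ) (ε : ℝ), 0 < ε → ε ≤ 1 → (∀ u ∈ U, 0 ≤ v u ∧ v u ≤ 1) →
    (∀ u ∈ U, ∀ u' ∈ U, u ≠ u' → ε ≤ |v u - v u'|) → ∀ (s : Finset ℤ) (f : ℤ → ℂ),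
    ∫⁻ y, (∑ u ∈ U, ‖bandOp bump s ε (fun k => f k * e (-(v u * k))) y‖ₑ ^ 2) ^ (R + 1) ≤
      ENNReal.ofReal (C * ε) * ∑ k ∈ s, ‖f k‖ₑ ^ (2 * R + 2) := by
  obtain ⟨C, hC, H⟩ := exists_largeSieve_const
  refine ⟨C ^ (R + 1) * 10 ^ R * Real.pi, by positivity, fun U v ε h0 h1 hv hsep s f => ?_⟩
  have pt (y : ℝ) : (∑ u ∈ U, ‖bandOp bump s ε (fun k => f k * e (-(v u * k))) y‖ₑ ^ 2) ^ (R + 1) ≤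
      ∑ k ∈ s, ENNReal.ofReal (C ^ (R + 1) * 10 ^ R * ε * ‖f k‖ ^ (2 * R + 2)) *
        ENNReal.ofReal (1 / (1 + (y - ε * k) ^ 2)) := by
    rw [sum_enorm_pow, ← ENNReal.ofReal_pow (Finset.sum_nonneg fun _ _ => by positivity)]
    simp only [← ENNReal.ofReal_mul (show 0 ≤ C ^ (R + 1) * 10 ^ R * ε * ‖f _‖ ^ (2 * R + 2) by
      positivity)]
    rw [← ENNReal.ofReal_sum_of_nonneg fun _ _ => by positivity]
    apply ENNReal.ofReal_le_ofReal
    have hW : ∑ k ∈ s, 1 / (1 + (y - ε * k) ^ 2) ≤ 10 / ε := by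
      have := sum_lattice_le h0 h1 (-y) s
      refine (Finset.sum_congr rfl fun k _ => ?_).trans_le this
      ring
    calc _ ≤ (C * ε * ∑ k ∈ s, ‖f k‖ ^ 2 * (1 / (1 + (y - ε * k) ^ 2))) ^ (R + 1) :=
          pow_le_pow_left₀ (Finset.sum_nonneg fun _ _ => by positivity) (H U v ε h0 h1 hv hsep s f y) _
      _ ≤ (C * ε) ^ (R + 1) * ((10 / ε) ^ R *
            ∑ k ∈ s, (‖f k‖ ^ 2) ^ (R + 1) * (1 / (1 + (y - ε * k) ^ 2))) := by
          rw [mul_pow]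
          gcongr
          refine (sum_mul_pow_le s _ _ (fun _ => by positivity) (fun _ => by positivity) R).trans ?_
          gcongr
      _ = _ := by
          rw [← mul_assoc, Finset.mul_sum]
          refine Finset.sum_congr rfl fun k _ => ?_
          rw [← pow_mul, show 2 * (R + 1) = 2 * R + 2 by ring]
          have : (C * ε) ^ (R + 1) * (10 / ε) ^ R = C ^ (R + 1) * 10 ^ R * ε := by
            rw [mul_pow, div_pow, pow_succ ε]; field_simp
          rw [this]; ring
  refine (lintegral_mono pt).trans_eq ?_
  rw [lintegral_finsetSum _ fun k _ => by fun_prop, Finset.mul_sum]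
  refine Finset.sum_congr rfl fun k _ => ?_
  rw [lintegral_const_mul _ (by fun_prop), lintegral_cauchy_kernel, ← ofReal_norm,
    ← ENNReal.ofReal_pow (norm_nonneg _), ← ENNReal.ofReal_mul (by positivity),
    ← ENNReal.ofReal_mul (by positivity)]
  congr 1; ring

/-- The square function of the operators with a multiplier symbol. Random signs reduce it to the
scalar transference bound, and Khinchine's inequality returns to the square function with symbol
`bump`. -/
theorem exists_squareFunction_const (R : ℕ) (B : ℝ≥0) : ∃ C : ℝ, 0 < C ∧ ∀ m : ℝ → ℂ,
    IsLpMultiplier m ((2 * R + 2 : ℕ) : ℝ≥0∞) B →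
    Function.support m ⊆ Set.Ioc (-(1 / 2) : ℝ) (1 / 2) → ∀ {ι : Type} (U : Finset ι)
    (v : ι → ℝ) (ε : ℝ), 0 < ε → ε ≤ 1 → (∀ u ∈ U, 0 ≤ v u ∧ v u ≤ 1) →
    (∀ u ∈ U, ∀ u' ∈ U, u ≠ u' → ε ≤ |v u - v u'|) → ∀ (s : Finset ℤ) (f : ℤ → ℂ),
    ∑' n : ℤ, (∑ u ∈ U, ‖bandOp m s ε (fun k => f k * e (-(v u * k))) (ε * n)‖ₑ ^ 2) ^ (R + 1) ≤
      ENNReal.ofReal C * ∑ k ∈ s, ‖f k‖ₑ ^ (2 * R + 2) := by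
  classical
  obtain ⟨C1, hC1, H1⟩ := exists_transference_const (2 * R + 1) B
  obtain ⟨C2, hC2, H2⟩ := exists_khinchine_const R
  obtain ⟨C3, hC3, H3⟩ := exists_line_squareFunction_const R
  refine ⟨C1 * (C2 + 1) * C3, by positivity, fun m hm hs ι U v ε h0 h1 hv hsep s f => ?_⟩
  set c : U → ℤ → ℂ := fun u k => f k * e (-(v u * k)) with hc
  set N := Fintype.card U with hN
  have toSub (h : ℝ → ℂ) (y : ℝ) :
      ∑ u ∈ U, ‖bandOp h s ε (fun k => f k * e (-(v u * k))) y‖ₑ ^ 2 =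
        ∑ u : U, ‖bandOp h s ε (c u) y‖ₑ ^ 2 :=
    (Finset.sum_coe_sort U fun u => ‖bandOp h s ε (fun k => f k * e (-(v u * k))) y‖ₑ ^ 2).symm
  have lower (a : U → ℂ) : 2 ^ N * (∑ u, ‖a u‖ₑ ^ 2) ^ (R + 1) ≤
      ∑ θ : U → Bool, ‖∑ u, sgn (θ u) * a u‖ₑ ^ (2 * R + 2) := by
    rw [sum_enorm_pow, sum_enorm_pow, ← ENNReal.ofReal_pow (Finset.sum_nonneg fun _ _ => by positivity),
      show (2 : ℝ≥0∞) ^ N = ENNReal.ofReal (2 ^ N) by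
        rw [ENNReal.ofReal_pow (by norm_num)]; simp, ← ENNReal.ofReal_mul (by positivity)]
    exact ENNReal.ofReal_le_ofReal (pow_sum_sq_le_sum_signs R a)
  have upper (a : U → ℂ) : ∑ θ : U → Bool, ‖∑ u, sgn (θ u) * a u‖ₑ ^ (2 * R + 2) ≤
      ENNReal.ofReal (C2 + 1) * (2 ^ N * (∑ u, ‖a u‖ₑ ^ 2) ^ (R + 1)) := by
    rw [sum_enorm_pow, sum_enorm_pow, ← ENNReal.ofReal_pow (Finset.sum_nonneg fun _ _ => by positivity),
      show (2 : ℝ≥0∞) ^ N = ENNReal.ofReal (2 ^ N) by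
        rw [ENNReal.ofReal_pow (by norm_num)]; simp, ← ENNReal.ofReal_mul (by positivity),
      ← ENNReal.ofReal_mul (by positivity)]
    refine ENNReal.ofReal_le_ofReal ((H2 a).trans ?_)
    gcongr; linarith
  have h2N : (2 : ℝ≥0∞) ^ N ≠ 0 := by simp
  have h2N' : (2 : ℝ≥0∞) ^ N ≠ ⊤ := by simp
  rw [← ENNReal.mul_le_mul_iff_right h2N h2N', ← ENNReal.tsum_mul_left]
  simp only [toSub]
  calc _ ≤ ∑' n : ℤ, ∑ θ : U → Bool, ‖∑ u, sgn (θ u) * bandOp m s ε (c u) (ε * n)‖ₑ ^ (2 * R + 2) :=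
        ENNReal.tsum_le_tsum fun n => lower _
    _ = ∑ θ : U → Bool, ∑' n : ℤ,
        ‖bandOp m s ε (fun k => ∑ u, sgn (θ u) * c u k) (ε * n)‖ₑ ^ (2 * R + 2) := by
        simp only [bandOp_sum]
        exact Summable.tsum_finsetSum fun _ _ => ENNReal.summable
    _ ≤ ∑ θ : U → Bool, ENNReal.ofReal (C1 / ε) *
        ∫⁻ y, ‖bandOp bump s ε (fun k => ∑ u, sgn (θ u) * c u k) y‖ₑ ^ (2 * R + 2) := by
        refine Finset.sum_le_sum fun θ _ => ?_
        have := H1 m hm hs s ε (fun k => ∑ u, sgn (θ u) * c u k) ε h0 h1 0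
        simpa only [add_zero] using this
    _ = ENNReal.ofReal (C1 / ε) * ∫⁻ y, ∑ θ : U → Bool,
        ‖∑ u, sgn (θ u) * bandOp bump s ε (c u) y‖ₑ ^ (2 * R + 2) := by
        have hcont (u) := continuous_bandOp integrable_bump s ε (c u)
        rw [← Finset.mul_sum, lintegral_finsetSum _ fun θ _ => by fun_prop]
        simp only [bandOp_sum]
    _ ≤ ENNReal.ofReal (C1 / ε) * ∫⁻ y, ENNReal.ofReal (C2 + 1) *
        (2 ^ N * (∑ u, ‖bandOp bump s ε (c u) y‖ₑ ^ 2) ^ (R + 1)) := by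
        gcongr with y; exact upper _
    _ = 2 ^ N * (ENNReal.ofReal (C1 / ε) * ENNReal.ofReal (C2 + 1) *
        ∫⁻ y, (∑ u, ‖bandOp bump s ε (c u) y‖ₑ ^ 2) ^ (R + 1)) := by
        rw [lintegral_const_mul' _ _ ENNReal.ofReal_ne_top, lintegral_const_mul' _ _ h2N']
        ring
    _ ≤ _ := by
        refine mul_le_mul_right ?_ _
        have := H3 U v ε h0 h1 hv hsep s f
        simp only [toSub] at this
        refine (mul_le_mul_right this _).trans_eq ?_
        rw [← mul_assoc, ← ENNReal.ofReal_mul (by positivity), ← ENNReal.ofReal_mul (by positivity)]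
        congr 2; field_simp

/-! ### Ramanujan sums -/

/-- The integers in `[1, q]` that are coprime to `q`. -/
def residues (q : ℕ) : Finset ℕ := (Finset.Icc 1 q).filter fun a => Nat.Coprime a q

/-- The Ramanujan sum `c_q(j)`. -/
noncomputable def ramanujanSum (q : ℕ) (j : ℤ) : ℂ := ∑ a ∈ residues q, e (a * j / q)

lemma sum_range_e {q : ℕ} (hq : 0 < q) (j : ℤ) :
    ∑ b ∈ Finset.range q, e (b * j / q) = if (q : ℤ) ∣ j then (q : ℂ) else 0 := by
  have hq' : (q : ℝ) ≠ 0 := by positivity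
  have hpow (b : ℕ) : e (b * j / q) = e (j / q) ^ b := by
    simp only [e]; rw [← Complex.exp_nat_mul]; congr 1; push_cast; ring
  simp only [hpow]
  split_ifs with h
  · obtain ⟨l, rfl⟩ := h
    have : e (((q * l : ℤ) : ℝ) / q) = 1 := by
      rw [e_eq_one_iff]; exact ⟨l, by push_cast; field_simp⟩
    simp only [this, one_pow, Finset.sum_const, Finset.card_range, nsmul_eq_mul, mul_one]
  · have h1 : e (j / q) ≠ 1 := by
      rw [Ne, e_eq_one_iff]
      rintro ⟨l, hl⟩
      rw [div_eq_iff hq'] at hl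
      exact h ⟨l, by rw [mul_comm]; exact_mod_cast hl⟩
    rw [geom_sum_eq h1, ← hpow, show (q : ℝ) * j / q = (j : ℤ) by field_simp, e_int]
    simp

lemma sum_Icc_e {q : ℕ} (hq : 0 < q) (j : ℤ) :
    ∑ b ∈ Finset.Icc 1 q, e (b * j / q) = if (q : ℤ) ∣ j then (q : ℂ) else 0 := by
  have hI : Finset.Icc 1 q = Finset.Ico 1 (q + 1) := by ext; simp
  have h1 := Finset.sum_range_succ (fun b : ℕ => e (b * j / q)) q
  rw [Finset.sum_range_succ'] at h1
  have h2 : e ((q : ℕ) * j / q) = e ((0 : ℕ) * j / q) := by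
    have hq' : (q : ℝ) ≠ 0 := by positivity
    rw [show ((q : ℕ) : ℝ) * j / q = (j : ℤ) by field_simp, e_int]; simp
  rw [h2] at h1
  rw [← sum_range_e hq j, hI, Finset.sum_Ico_eq_sum_range, Nat.add_sub_cancel, ← add_right_cancel h1]
  simp only [add_comm 1]

lemma sum_abs_moebius_divisors {q : ℕ} (hq : q ≠ 0) :
    ∑ d ∈ q.divisors, |(ArithmeticFunction.moebius d : ℝ)| =
      2 ^ ArithmeticFunction.cardDistinctFactors q := by
  have h1 (d : ℕ) : |(ArithmeticFunction.moebius d : ℝ)| = if Squarefree d then 1 else 0 := by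
    rw [← Int.cast_abs, ArithmeticFunction.abs_moebius]; split_ifs <;> simp
  simp only [h1]
  rw [← Finset.sum_filter, Nat.sum_divisors_filter_squarefree hq]
  simp only [Finset.sum_const, Finset.card_powerset, nsmul_eq_mul, mul_one]
  push_cast
  rw [ArithmeticFunction.cardDistinctFactors_apply, Nat.factors_eq]
  congr 1

/-- The divisor formula `c_q(j) = ∑_{d ∣ q, q/d ∣ j} μ(d) q/d`. -/
lemma ramanujanSum_eq {q : ℕ} (hq : 0 < q) (j : ℤ) :
    ramanujanSum q j = ∑ d ∈ q.divisors, (ArithmeticFunction.moebius d : ℂ) *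
      (if ((q / d : ℕ) : ℤ) ∣ j then ((q / d : ℕ) : ℂ) else 0) := by
  have h1 (a : ℕ) : (if Nat.Coprime a q then e (a * j / q) else 0) =
      ∑ d ∈ q.divisors, if d ∣ a then (ArithmeticFunction.moebius d : ℂ) * e (a * j / q) else 0 := by
    have h2 : ∑ d ∈ (Nat.gcd a q).divisors, (ArithmeticFunction.moebius d : ℂ) =
        if Nat.Coprime a q then 1 else 0 := by
      have := congrArg (fun f : ArithmeticFunction ℤ => f (Nat.gcd a q))
        ArithmeticFunction.coe_zeta_mul_moebius
      simp only [ArithmeticFunction.coe_zeta_mul_apply, ArithmeticFunction.one_apply] at this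
      rw [← Int.cast_sum, this]
      simp [Nat.Coprime]
    have h3 : (Nat.gcd a q).divisors = q.divisors.filter (· ∣ a) := by
      ext d
      simp only [Nat.mem_divisors, Finset.mem_filter, Nat.dvd_gcd_iff]
      constructor
      · rintro ⟨⟨ha, hd⟩, -⟩; exact ⟨⟨hd, hq.ne'⟩, ha⟩
      · rintro ⟨⟨hd, -⟩, ha⟩; exact ⟨⟨ha, hd⟩, (Nat.gcd_pos_of_pos_right _ hq).ne'⟩
    rw [← Finset.sum_filter, ← h3, ← Finset.sum_mul, h2]
    split_ifs <;> simp
  rw [ramanujanSum, residues, Finset.sum_filter]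
  simp only [h1]
  rw [Finset.sum_comm]
  refine Finset.sum_congr rfl fun d hd => ?_
  obtain ⟨g, rfl⟩ := Nat.dvd_of_mem_divisors hd
  have hd0 : 0 < d := Nat.pos_of_ne_zero (by rintro rfl; simp at hq)
  have hg0 : 0 < g := Nat.pos_of_ne_zero (by rintro rfl; simp at hq)
  rw [Nat.mul_div_cancel_left _ hd0, ← sum_Icc_e hg0, ← Finset.sum_filter, Finset.mul_sum]
  have himg : (Finset.Icc 1 (d * g)).filter (d ∣ ·) = (Finset.Icc 1 g).image (d * ·) := by
    ext a
    simp only [Finset.mem_filter, Finset.mem_Icc, Finset.mem_image]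
    constructor
    · rintro ⟨⟨h1, h2⟩, b, rfl⟩
      exact ⟨b, ⟨Nat.pos_of_ne_zero (by rintro rfl; simp at h1), Nat.le_of_mul_le_mul_left h2 hd0⟩, rfl⟩
    · rintro ⟨b, ⟨h1, h2⟩, rfl⟩
      exact ⟨⟨Nat.mul_pos hd0 h1, Nat.mul_le_mul_left _ h2⟩, dvd_mul_right _ _⟩
  rw [himg, Finset.sum_image fun a _ b _ h => Nat.eq_of_mul_eq_mul_left hd0 h]
  refine Finset.sum_congr rfl fun b _ => ?_
  congr 2
  have : (d : ℝ) ≠ 0 := by positivity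
  push_cast; field_simp

lemma norm_ramanujanSum_le {q : ℕ} (hq : 0 < q) (j : ℤ) :
    ‖ramanujanSum q j‖ ≤ ∑ d ∈ q.divisors, |(ArithmeticFunction.moebius d : ℝ)| *
      (if ((q / d : ℕ) : ℤ) ∣ j then ((q / d : ℕ) : ℝ) else 0) := by
  rw [ramanujanSum_eq hq]
  refine (norm_sum_le _ _).trans (Finset.sum_le_sum fun d _ => ?_)
  rw [norm_mul, Complex.norm_intCast]
  gcongr
  split_ifs <;> simp

/-- The kernel of the projection to the reduced fractions with denominator `q` has `ℓ¹` norm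
`O(2^{ω(q)})`. -/
lemma exists_ramanujan_kernel_const : ∃ C : ℝ, 0 < C ∧ ∀ (q : ℕ), 0 < q → ∀ ε : ℝ, 0 < ε →
    ε * q ≤ 1 → ∀ (s : Finset ℤ) (b : ℤ) (y : ℝ),
    ∑ k ∈ s, ε * ‖ramanujanSum q (b - k) * kernel bump (y - ε * k)‖ ≤
      C * 2 ^ ArithmeticFunction.cardDistinctFactors q := by
  obtain ⟨D, hD, hdec⟩ := exists_bumpKernel_decay
  refine ⟨D * 10, by positivity, fun q hq ε h0 h1 s b y => ?_⟩
  have inner (g : ℕ) (hg : 0 < g) (hgq : g ≤ q) :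
      ∑ k ∈ s, (if (g : ℤ) ∣ b - k then (g : ℝ) else 0) * (1 / (1 + (y - ε * k) ^ 2)) ≤ 10 / ε := by
    have hg' : (0 : ℝ) < g := by exact_mod_cast hg
    simp only [ite_mul, zero_mul]
    rw [← Finset.sum_filter, ← Finset.mul_sum]
    set t := s.filter fun k => (g : ℤ) ∣ b - k
    have hinj : Set.InjOn (fun k : ℤ => (b - k) / (g : ℤ)) t := by
      intro k hk l hl h
      have hk' := Int.ediv_mul_cancel (Finset.mem_filter.1 hk).2
      have hl' := Int.ediv_mul_cancel (Finset.mem_filter.1 hl).2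
      simp only at h; rw [h, hl'] at hk'; linarith
    have h3 := sum_lattice_le (δ := ε * g) (by positivity)
      (le_trans (mul_le_mul_of_nonneg_left (by exact_mod_cast hgq) h0.le) h1) (y - ε * b)
      (t.image fun k : ℤ => (b - k) / (g : ℤ))
    rw [Finset.sum_image hinj] at h3
    have h4 : ∑ k ∈ t, 1 / (1 + (y - ε * k) ^ 2) ≤ 10 / (ε * g) := by
      refine (Finset.sum_congr rfl fun k hk => ?_).trans_le h3
      have hk' := Int.ediv_mul_cancel (Finset.mem_filter.1 hk).2
      have hk2 : (((b - k) / (g : ℤ) : ℤ) : ℝ) * g = b - k := by exact_mod_cast hk'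
      congr 3
      linear_combination (-ε) * hk2
    calc _ ≤ (g : ℝ) * (10 / (ε * g)) := by gcongr
      _ = _ := by field_simp
  calc _ ≤ ∑ k ∈ s, ε * ((∑ d ∈ q.divisors, |(ArithmeticFunction.moebius d : ℝ)| *
        (if ((q / d : ℕ) : ℤ) ∣ b - k then ((q / d : ℕ) : ℝ) else 0)) *
          (D / (1 + (y - ε * k) ^ 2))) := by
        refine Finset.sum_le_sum fun k _ => ?_
        rw [norm_mul]
        gcongr
        · exact norm_ramanujanSum_le hq _
        · exact hdec _
    _ = ε * D * ∑ d ∈ q.divisors, |(ArithmeticFunction.moebius d : ℝ)| *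
        ∑ k ∈ s, (if ((q / d : ℕ) : ℤ) ∣ b - k then ((q / d : ℕ) : ℝ) else 0) *
          (1 / (1 + (y - ε * k) ^ 2)) := by
        simp only [Finset.mul_sum, Finset.sum_mul]
        rw [Finset.sum_comm]
        refine Finset.sum_congr rfl fun d _ => Finset.sum_congr rfl fun k _ => ?_
        ring
    _ ≤ ε * D * ∑ d ∈ q.divisors, |(ArithmeticFunction.moebius d : ℝ)| * (10 / ε) := by
        gcongr with d hd
        exact inner _ (Nat.div_pos (Nat.divisor_le hd) (Nat.pos_of_mem_divisors hd))
          (Nat.div_le_self _ _)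
    _ = _ := by
        rw [← Finset.sum_mul, sum_abs_moebius_divisors hq.ne']; field_simp

/-! ### Real interpolation -/

lemma lintegral_Ioo_pow {x : ℝ} (hx : 0 ≤ x) (n : ℕ) :
    ∫⁻ t in Set.Ioo 0 x, ENNReal.ofReal ((n + 1) * t ^ n) = ENNReal.ofReal (x ^ (n + 1)) := by
  have hc : Continuous fun t : ℝ => ((n : ℝ) + 1) * t ^ n := by fun_prop
  rw [restrict_Ioo_eq_restrict_Ioc, ← ofReal_integral_eq_lintegral_ofReal (hc.integrableOn_Ioc)]
  · rw [← intervalIntegral.integral_of_le hx, intervalIntegral.integral_const_mul, integral_pow]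
    congr 1; field_simp; simp
  · refine (ae_restrict_iff' measurableSet_Ioc).2 (Eventually.of_forall fun t ht => ?_)
    have := ht.1.le
    simp only [Pi.zero_apply]; positivity

/-- Interpolation between an `L²` bound `K` and an `L^∞` bound `A`, by truncating the input at a
height proportional to the value of the output. -/
theorem lintegral_pow_le_of_two_of_infty {ι : Type} (I : Finset ι) (w : ι → ℝ≥0∞) (s : Finset ℤ)
    (κ : ι → ℤ → ℝ → ℂ) (hκ : ∀ i k, Measurable (κ i k)) {A : ℝ} (hA : 0 < A)
    (hsup : ∀ i ∈ I, ∀ y, ∑ k ∈ s, ‖κ i k y‖ ≤ A) {K : ℝ≥0∞}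
    (htwo : ∀ f : ℤ → ℂ, ∑ i ∈ I, w i * ∫⁻ y, ‖∑ k ∈ s, f k * κ i k y‖ₑ ^ 2 ≤
      K * ∑ k ∈ s, ‖f k‖ₑ ^ 2) (R : ℕ) (f : ℤ → ℂ) :
    ∑ i ∈ I, w i * ∫⁻ y, ‖∑ k ∈ s, f k * κ i k y‖ₑ ^ (2 * R + 2) ≤
      4 * K * ENNReal.ofReal ((2 * A) ^ (2 * R)) * ∑ k ∈ s, ‖f k‖ₑ ^ (2 * R + 2) := by
  rcases R with _ | R
  · simp only [mul_zero, zero_add, pow_zero, ENNReal.ofReal_one, mul_one]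
    refine (htwo f).trans ?_
    gcongr
    exact le_mul_of_one_le_left' (by norm_num)
  set n := 2 * R + 1 with hn
  set φ : ℝ → ℝ≥0∞ := fun t => ENNReal.ofReal ((n + 1) * t ^ n) with hφ
  have hφm : Measurable φ := by fun_prop
  -- the part of `f` above the height `t / (2A)`
  set g : ℝ → ℤ → ℂ := fun t k => if t < 2 * A * ‖f k‖ then f k else 0 with hg
  have hgm (k) : Measurable fun t => g t k :=
    Measurable.ite (measurableSet_lt measurable_id measurable_const) measurable_const
      measurable_const
  set T : ι → (ℤ → ℂ) → ℝ → ℂ := fun i c y => ∑ k ∈ s, c k * κ i k y with hT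
  have hTm (i c) : Measurable (T i c) := by fun_prop
  have hTgm (i) : Measurable (fun z : ℝ × ℝ => T i (g z.1) z.2) := by
    simp only [hT]
    exact Finset.measurable_fun_sum _ fun k _ =>
      ((hgm k).comp measurable_fst).mul ((hκ i k).comp measurable_snd)
  have pt (i) (hi : i ∈ I) (y : ℝ) : ‖T i f y‖ₑ ^ (2 * (R + 1) + 2) ≤
      ∫⁻ t in Set.Ioi 0, φ t * (4 * ‖T i (g t) y‖ₑ ^ 2) := by
    have h1 : ‖T i f y‖ₑ ^ (n + 1) = ∫⁻ t in Set.Ioo 0 ‖T i f y‖, φ t := by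
      rw [hφ, lintegral_Ioo_pow (norm_nonneg _), ENNReal.ofReal_pow (norm_nonneg _), ofReal_norm]
    rw [show 2 * (R + 1) + 2 = (n + 1) + 2 by omega, pow_add, h1,
      ← lintegral_mul_const _ hφm]
    refine (setLIntegral_mono' measurableSet_Ioo fun t ht => ?_).trans
      (lintegral_mono_set Set.Ioo_subset_Ioi_self)
    gcongr
    have h2 : ‖T i f y - T i (g t) y‖ ≤ t / 2 := by
      simp only [hT]
      rw [← Finset.sum_sub_distrib]
      refine (norm_sum_le _ _).trans ?_
      calc _ ≤ ∑ k ∈ s, t / (2 * A) * ‖κ i k y‖ := by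
            refine Finset.sum_le_sum fun k _ => ?_
            rw [← sub_mul, norm_mul]
            gcongr
            simp only [hg]
            split_ifs with h
            · simp only [sub_self, norm_zero]
              exact div_nonneg ht.1.le (by positivity)
            · rw [sub_zero, le_div_iff₀ (by positivity)]; linarith
        _ ≤ t / (2 * A) * A := by
            rw [← Finset.mul_sum]
            exact mul_le_mul_of_nonneg_left (hsup i hi y) (div_nonneg ht.1.le (by positivity))
        _ = _ := by field_simp
    have h3 : ‖T i f y‖ ≤ 2 * ‖T i (g t) y‖ := by
      have := norm_sub_norm_le (T i f y) (T i (g t) y)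
      linarith [ht.2]
    calc ‖T i f y‖ₑ ^ 2 ≤ (2 * ‖T i (g t) y‖ₑ) ^ 2 := by
          gcongr
          rw [← ofReal_norm, ← ofReal_norm, show (2 : ℝ≥0∞) = ENNReal.ofReal 2 by simp,
            ← ENNReal.ofReal_mul (by norm_num)]
          exact ENNReal.ofReal_le_ofReal h3
      _ = _ := by rw [mul_pow]; norm_num
  calc _ ≤ ∑ i ∈ I, w i * ∫⁻ y, ∫⁻ t in Set.Ioi 0, φ t * (4 * ‖T i (g t) y‖ₑ ^ 2) := by
        gcongr with i hi y; exact pt i hi y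
    _ = ∑ i ∈ I, w i * ∫⁻ t in Set.Ioi 0, ∫⁻ y, φ t * (4 * ‖T i (g t) y‖ₑ ^ 2) := by
        refine Finset.sum_congr rfl fun i _ => ?_
        rw [lintegral_lintegral_swap]
        have := hTgm i
        exact Measurable.aemeasurable ((hφm.comp measurable_snd).mul
          (measurable_const.mul ((this.comp measurable_swap).enorm.pow_const 2)))
    _ ≤ ∫⁻ t in Set.Ioi 0, ∑ i ∈ I, w i * ∫⁻ y, φ t * (4 * ‖T i (g t) y‖ₑ ^ 2) := by
        have hm (i) : Measurable fun t => ∫⁻ y, φ t * (4 * ‖T i (g t) y‖ₑ ^ 2) := by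
          have := hTgm i
          exact Measurable.lintegral_prod_right' (f := fun z : ℝ × ℝ => φ z.1 * (4 * ‖T i (g z.1) z.2‖ₑ ^ 2))
            ((hφm.comp measurable_fst).mul (measurable_const.mul (this.enorm.pow_const 2)))
        rw [lintegral_finsetSum _ fun i _ => (hm i).const_mul _]
        exact Finset.sum_le_sum fun i _ => (lintegral_const_mul _ (hm i)).ge
    _ = ∫⁻ t in Set.Ioi 0, φ t * (4 * ∑ i ∈ I, w i * ∫⁻ y, ‖T i (g t) y‖ₑ ^ 2) := by
        refine lintegral_congr fun t => ?_
        rw [Finset.mul_sum, Finset.mul_sum]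
        refine Finset.sum_congr rfl fun i _ => ?_
        rw [lintegral_const_mul _ (((hTm i _).enorm.pow_const 2).const_mul _),
          lintegral_const_mul _ ((hTm i _).enorm.pow_const 2)]
        ring
    _ ≤ ∫⁻ t in Set.Ioi 0, φ t * (4 * (K * ∑ k ∈ s, ‖g t k‖ₑ ^ 2)) := by
        gcongr with t; exact htwo _
    _ = ∫⁻ t in Set.Ioi 0, 4 * K * ∑ k ∈ s, ‖f k‖ₑ ^ 2 * (Set.Iio (2 * A * ‖f k‖)).indicator φ t := by
        refine lintegral_congr fun t => ?_
        have : ∀ k, ‖f k‖ₑ ^ 2 * (Set.Iio (2 * A * ‖f k‖)).indicator φ t = φ t * ‖g t k‖ₑ ^ 2 := by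
          intro k
          by_cases h : t < 2 * A * ‖f k‖ <;> simp only [hg, h, if_true, if_false,
            Set.indicator, Set.mem_Iio] <;> simp [mul_comm]
        simp only [this]
        rw [← Finset.mul_sum]; ring
    _ = 4 * K * ∑ k ∈ s, ‖f k‖ₑ ^ 2 * ENNReal.ofReal ((2 * A * ‖f k‖) ^ (n + 1)) := by
        have hm (k) : Measurable ((Set.Iio (2 * A * ‖f k‖)).indicator φ) :=
          hφm.indicator measurableSet_Iio
        rw [lintegral_const_mul _ (Finset.measurable_fun_sum _ fun k _ => (hm k).const_mul _),
          lintegral_finsetSum _ fun k _ => (hm k).const_mul _]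
        congr 1
        refine Finset.sum_congr rfl fun k _ => ?_
        rw [lintegral_const_mul _ (hm k), lintegral_indicator measurableSet_Iio,
          Measure.restrict_restrict measurableSet_Iio, Set.inter_comm, Set.Ioi_inter_Iio,
          lintegral_Ioo_pow (by positivity)]
    _ = _ := by
        rw [mul_assoc (4 * K)]
        congr 1
        rw [Finset.mul_sum]
        refine Finset.sum_congr rfl fun k _ => ?_
        rw [mul_pow, ENNReal.ofReal_mul (by positivity), ENNReal.ofReal_pow (norm_nonneg _), ofReal_norm,
          show n + 1 = 2 * (R + 1) by omega]
        ring

/-! ### The blocks with a single denominator -/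

/-- Parseval's identity on `ℤ/qℤ`, for coefficients supported on the reduced residues. -/
lemma sum_range_norm_sq_e {q : ℕ} (hq : 0 < q) (X : ℕ → ℂ) :
    ∑ b ∈ Finset.range q, ‖∑ a ∈ residues q, e (a * b / q) * X a‖ ^ 2 =
      q * ∑ a ∈ residues q, ‖X a‖ ^ 2 := by
  have h1 (b : ℕ) : ((‖∑ a ∈ residues q, e (a * b / q) * X a‖ ^ 2 : ℝ) : ℂ) =
      ∑ a ∈ residues q, ∑ a' ∈ residues q,
        X a * starRingEnd ℂ (X a') * e (b * ((a : ℤ) - a' : ℤ) / q) := by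
    rw [Complex.ofReal_pow, ← Complex.mul_conj', map_sum, Finset.sum_mul_sum]
    refine Finset.sum_congr rfl fun a _ => Finset.sum_congr rfl fun a' _ => ?_
    rw [map_mul, conj_e, mul_mul_mul_comm, ← e_add, mul_comm]
    congr 2; push_cast; ring
  have h2 : ((∑ b ∈ Finset.range q, ‖∑ a ∈ residues q, e (a * b / q) * X a‖ ^ 2 : ℝ) : ℂ) =
      ((q * ∑ a ∈ residues q, ‖X a‖ ^ 2 : ℝ) : ℂ) := by
    rw [Complex.ofReal_sum, Finset.sum_congr rfl fun b _ => h1 b, Finset.sum_comm]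
    simp only [Complex.ofReal_mul, Complex.ofReal_sum, Complex.ofReal_pow, Complex.ofReal_natCast]
    rw [Finset.mul_sum]
    refine Finset.sum_congr rfl fun a ha => ?_
    rw [Finset.sum_comm, Finset.sum_eq_single a]
    · simp [Complex.mul_conj', mul_comm]
    · intro a' ha' hne
      rw [← Finset.mul_sum, sum_range_e hq, if_neg, mul_zero]
      intro hd
      simp only [residues, Finset.mem_filter, Finset.mem_Icc] at ha ha'
      have h3 : ((a : ℤ) - a') = 0 := by
        apply Int.eq_zero_of_abs_lt_dvd hd
        rw [abs_lt]; omega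
      omega
    · exact fun h => absurd ha h
  exact_mod_cast h2

/-- On a residue class modulo `q`, the sum over the reduced fractions with denominator `q` is a
single operator whose input is multiplied by a Ramanujan sum. -/
lemma bandOp_residues (q : ℕ) (h : ℝ → ℂ) (s : Finset ℤ) (ε : ℝ) (f : ℤ → ℂ)
    (b : ℤ) (y : ℝ) :
    bandOp h s ε (fun k => f k * ramanujanSum q (b - k)) y =
      ∑ a ∈ residues q, e (a * b / q) * bandOp h s ε (fun k => f k * e (-(a / q * k))) y := by
  rw [← bandOp_sum]
  congr 1; ext k
  rw [ramanujanSum, Finset.mul_sum]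
  refine Finset.sum_congr rfl fun a _ => ?_
  rw [mul_left_comm, ← e_add]
  congr 2; push_cast; ring

/-- Summing over the integers one residue class modulo `q` at a time. -/
lemma tsum_int_eq_sum_range {q : ℕ} (hq : 0 < q) (F : ℤ → ℝ≥0∞) :
    ∑' n : ℤ, F n = ∑ b ∈ Finset.range q, ∑' j : ℤ, F (j * q + b) := by
  have : NeZero q := ⟨hq.ne'⟩
  rw [← (Int.divModEquiv q).symm.tsum_eq, ENNReal.tsum_prod', ENNReal.tsum_comm, tsum_fintype,
    Finset.sum_range]
  rfl

/-- The `ℓ^{2R+2}` norms of the blocks `∑_{(a,q)=1} f_{a/q}`, summed over `q`. Splitting into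
residue classes modulo `q` turns a block into a single operator with coefficients
`f(k) c_q(b - k)`, for which the large sieve gives the `L²` bound and the size of the Ramanujan
sums the `L^∞` bound. -/
theorem exists_block_const (R : ℕ) (B : ℝ≥0) : ∃ C : ℝ, 0 < C ∧ ∀ m : ℝ → ℂ,
    IsLpMultiplier m ((2 * R + 2 : ℕ) : ℝ≥0∞) B →
    Function.support m ⊆ Set.Ioc (-(1 / 2) : ℝ) (1 / 2) → ∀ (Z : Finset ℕ) (ε : ℝ), 0 < ε →
    ε ≤ 1 → (∀ q ∈ Z, 0 < q ∧ ε * q ≤ 1) →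
    (∀ q ∈ Z, ∀ q' ∈ Z, ∀ a ∈ residues q, ∀ a' ∈ residues q', ¬(q = q' ∧ a = a') →
      ε ≤ |(a / q : ℝ) - a' / q'|) → ∀ (s : Finset ℤ) (f : ℤ → ℂ),
    ∑ q ∈ Z, ∑' n : ℤ, ‖∑ a ∈ residues q, e (a / q * n) *
        bandOp m s ε (fun k => f k * e (-(a / q * k))) (ε * n)‖ₑ ^ (2 * R + 2) ≤
      ENNReal.ofReal (C * (2 ^ maxOmega Z) ^ (2 * R)) * ∑ k ∈ s, ‖f k‖ₑ ^ (2 * R + 2) := by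
  obtain ⟨C1, hC1, H1⟩ := exists_transference_const (2 * R + 1) B
  obtain ⟨C2, hC2, H2⟩ := exists_ramanujan_kernel_const
  obtain ⟨C3, hC3, H3⟩ := exists_line_squareFunction_const 0
  refine ⟨C1 * (4 * C3 * (2 * C2) ^ (2 * R)), by positivity,
    fun m hm hs Z ε h0 h1 hZ hsep s f => ?_⟩
  set A : ℝ := C2 * 2 ^ maxOmega Z with hA
  set I : Finset (Σ _ : ℕ, ℕ) := Z.sigma fun q => Finset.range q with hI
  set w : (Σ _ : ℕ, ℕ) → ℝ≥0∞ := fun i => ENNReal.ofReal (1 / (ε * i.1)) with hw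
  set κ : (Σ _ : ℕ, ℕ) → ℤ → ℝ → ℂ := fun i k y =>
    ε * (ramanujanSum i.1 ((i.2 : ℤ) - k) * kernel bump (y - ε * k)) with hκ
  have hker := continuous_kernel integrable_bump
  have hband (i : Σ _ : ℕ, ℕ) (g : ℤ → ℂ) (y : ℝ) : ∑ k ∈ s, g k * κ i k y =
      bandOp bump s ε (fun k => g k * ramanujanSum i.1 ((i.2 : ℤ) - k)) y := by
    rw [bandOp, Finset.mul_sum]
    refine Finset.sum_congr rfl fun k _ => ?_
    simp only [hκ]; ring
  have hsup : ∀ i ∈ I, ∀ y, ∑ k ∈ s, ‖κ i k y‖ ≤ A := by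
    rintro ⟨q, b⟩ hi y
    have hq := (Finset.mem_sigma.1 hi).1
    have h4 := H2 q (hZ q hq).1 ε h0 (hZ q hq).2 s b y
    refine (Finset.sum_congr rfl fun k _ => ?_).trans_le (h4.trans ?_)
    · simp only [hκ, norm_mul, Complex.norm_real, Real.norm_eq_abs, abs_of_pos h0]
    · rw [hA]
      gcongr
      · norm_num
      · exact Finset.le_sup (f := fun q => ArithmeticFunction.cardDistinctFactors q) hq
  have htwo : ∀ g : ℤ → ℂ, ∑ i ∈ I, w i * ∫⁻ y, ‖∑ k ∈ s, g k * κ i k y‖ₑ ^ 2 ≤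
      ENNReal.ofReal C3 * ∑ k ∈ s, ‖g k‖ₑ ^ 2 := by
    intro g
    set P : ℕ → ℕ → ℝ → ℂ := fun q a => bandOp bump s ε (fun k => g k * e (-(a / q * k))) with hP
    have hPc (q a) : Continuous (P q a) := continuous_bandOp integrable_bump _ _ _
    have h5 (q : ℕ) (hq : q ∈ Z) : ∑ b ∈ Finset.range q, ENNReal.ofReal (1 / (ε * q)) *
        ∫⁻ y, ‖∑ k ∈ s, g k * κ ⟨q, b⟩ k y‖ₑ ^ 2 =
        ENNReal.ofReal (1 / ε) * ∫⁻ y, ∑ a ∈ residues q, ‖P q a y‖ₑ ^ 2 := by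
      have hq0 := (hZ q hq).1
      have hq1 : (0 : ℝ) < q := by exact_mod_cast hq0
      simp only [hband, bandOp_residues]
      rw [← Finset.mul_sum, ← lintegral_finsetSum _ fun b _ => by
        exact Measurable.pow_const (Measurable.enorm (Finset.measurable_fun_sum _ fun a _ =>
          ((hPc q a).measurable.const_mul _))) _]
      have h6 (y : ℝ) : ∑ b ∈ Finset.range q, ‖∑ a ∈ residues q, e (a * (b : ℤ) / q) * P q a y‖ₑ ^ 2 =
          ENNReal.ofReal q * ∑ a ∈ residues q, ‖P q a y‖ₑ ^ 2 := by
        rw [sum_enorm_pow, sum_enorm_pow, ← ENNReal.ofReal_mul hq1.le]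
        congr 1
        simp only [Int.cast_natCast]
        exact sum_range_norm_sq_e hq0 fun a => P q a y
      rw [lintegral_congr h6, lintegral_const_mul' _ _ ENNReal.ofReal_ne_top, ← mul_assoc,
        ← ENNReal.ofReal_mul (by positivity)]
      congr 2; field_simp
    have h7 := H3 (Z.sigma residues) (fun u => (u.2 / u.1 : ℝ)) ε h0 h1 (by
      rintro ⟨q, a⟩ hu
      simp only [Finset.mem_sigma, residues, Finset.mem_filter, Finset.mem_Icc] at hu
      have : (0 : ℝ) < q := by exact_mod_cast (hZ q hu.1).1
      exact ⟨by positivity, by rw [div_le_one this]; exact_mod_cast hu.2.1.2⟩) (by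
      rintro ⟨q, a⟩ hu ⟨q', a'⟩ hu' hne
      rw [Finset.mem_sigma] at hu hu'
      refine hsep q hu.1 q' hu'.1 a hu.2 a' hu'.2 ?_
      rintro ⟨rfl, rfl⟩; exact hne rfl) s g
    simp only [zero_add, pow_one, mul_zero] at h7
    rw [hI, Finset.sum_sigma, Finset.sum_congr rfl h5, ← Finset.mul_sum,
      ← lintegral_finsetSum _ fun q _ => by
        exact Finset.measurable_fun_sum _ fun a _ => (hPc q a).measurable.enorm.pow_const _]
    simp only [Finset.sum_sigma] at h7
    refine (mul_le_mul_right h7 _).trans_eq ?_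
    rw [← mul_assoc, ← ENNReal.ofReal_mul (by positivity)]
    congr 2; field_simp
  have interp := lintegral_pow_le_of_two_of_infty I w s κ
    (fun i k => by simp only [hκ]; fun_prop) (by positivity) hsup htwo R f
  have hblock (q : ℕ) (hq : q ∈ Z) : ∑' n : ℤ, ‖∑ a ∈ residues q, e (a / q * n) *
        bandOp m s ε (fun k => f k * e (-(a / q * k))) (ε * n)‖ₑ ^ (2 * R + 2) ≤
      ENNReal.ofReal C1 * ∑ b ∈ Finset.range q, ENNReal.ofReal (1 / (ε * q)) *
        ∫⁻ y, ‖∑ k ∈ s, f k * κ ⟨q, b⟩ k y‖ₑ ^ (2 * R + 2) := by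
    have hq0 := (hZ q hq).1
    have hq1 : (0 : ℝ) < q := by exact_mod_cast hq0
    rw [tsum_int_eq_sum_range hq0, Finset.mul_sum]
    refine Finset.sum_le_sum fun b _ => ?_
    have h8 := H1 m hm hs s ε (fun k => f k * ramanujanSum q ((b : ℤ) - k)) (ε * q)
      (by positivity) (hZ q hq).2 (ε * b)
    simp only [hband]
    rw [← mul_assoc, ← ENNReal.ofReal_mul hC1.le, mul_one_div]
    refine le_of_eq_of_le ?_ h8
    refine tsum_congr fun j => ?_
    rw [bandOp_residues]
    congr 2
    refine Finset.sum_congr rfl fun a _ => ?_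
    congr 1
    · rw [show (a / q * ((j * q + b : ℤ) : ℝ) : ℝ) = a * (b : ℤ) / q + (a * j : ℤ) by
        push_cast; field_simp; ring, e_add, e_int, mul_one]
    · congr 1; push_cast; ring
  calc _ ≤ ∑ q ∈ Z, ENNReal.ofReal C1 * ∑ b ∈ Finset.range q, ENNReal.ofReal (1 / (ε * q)) *
        ∫⁻ y, ‖∑ k ∈ s, f k * κ ⟨q, b⟩ k y‖ₑ ^ (2 * R + 2) := Finset.sum_le_sum hblock
    _ = ENNReal.ofReal C1 * ∑ i ∈ I, w i *
        ∫⁻ y, ‖∑ k ∈ s, f k * κ i k y‖ₑ ^ (2 * R + 2) := by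
        rw [← Finset.mul_sum, hI, Finset.sum_sigma]
    _ ≤ _ := mul_le_mul_right interp _
    _ = _ := by
        rw [← mul_assoc, show (4 : ℝ≥0∞) = ENNReal.ofReal 4 by simp,
          ← ENNReal.ofReal_mul (by positivity), ← ENNReal.ofReal_mul (by positivity),
          ← ENNReal.ofReal_mul (by positivity)]
        congr 2
        rw [hA, ← mul_assoc 2 C2, mul_pow _ ((2 : ℝ) ^ maxOmega Z)]; ring

/-! ### Band-limited sequences -/

open scoped Convolution

/-- The sequence `X` has frequencies in `[v - ρ, v + ρ]`: it is the sequence of Fourier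
coefficients `X(n) = ∫ G(t) e(nt) dt` of an integrable `G` supported there. -/
def BandLimited (v ρ : ℝ) (X : ℤ → ℂ) : Prop :=
  ∃ G : ℝ → ℂ, Integrable G ∧ (∀ t, ρ < |t - v| → G t = 0) ∧ ∀ n : ℤ, X n = kernel G n

lemma BandLimited.mul {v w ρ σ : ℝ} {X Y : ℤ → ℂ} (hX : BandLimited v ρ X)
    (hY : BandLimited w σ Y) : BandLimited (v + w) (ρ + σ) fun n => X n * Y n := by
  obtain ⟨G, hG, hGs, hGX⟩ := hX
  obtain ⟨H, hH, hHs, hHY⟩ := hY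
  refine ⟨G ⋆[ContinuousLinearMap.mul ℂ ℂ] H, hG.integrable_convolution _ hH, fun t ht => ?_,
    fun n => ?_⟩
  · rw [convolution_def]
    refine integral_eq_zero_of_ae (Eventually.of_forall fun x => ?_)
    simp only [ContinuousLinearMap.mul_apply', Pi.zero_apply, mul_eq_zero]
    by_contra! hne
    have h1 := not_lt.1 fun h => hne.1 (hGs x h)
    have h2 := not_lt.1 fun h => hne.2 (hHs (t - x) h)
    have := abs_add_le (x - v) (t - x - w)
    rw [show x - v + (t - x - w) = t - (v + w) by ring] at this
    linarith
  · change X n * Y n = _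
    rw [hGX, hHY]
    have := integral_convolution (ContinuousLinearMap.mul ℂ ℂ) (integrable_mul_e hG n)
      (integrable_mul_e hH n)
    rw [ContinuousLinearMap.mul_apply'] at this
    rw [kernel, kernel, ← this, kernel]
    refine integral_congr_ae (Eventually.of_forall fun t => ?_)
    simp only [convolution_def, ContinuousLinearMap.mul_apply']
    rw [← integral_mul_const]
    refine integral_congr_ae (Eventually.of_forall fun x => ?_)
    have : e (n * t) = e (n * x) * e (n * (t - x)) := by rw [← e_add]; congr 1; ring
    simp only [this]; ring

lemma BandLimited.conj {v ρ : ℝ} {X : ℤ → ℂ} (hX : BandLimited v ρ X) :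
    BandLimited (-v) ρ fun n => starRingEnd ℂ (X n) := by
  obtain ⟨G, hG, hGs, hGX⟩ := hX
  have hi : Integrable fun t => starRingEnd ℂ (G (-t)) :=
    (LinearIsometryEquiv.integrable_comp_iff Complex.conjLIE).2 hG.comp_neg
  refine ⟨fun t => starRingEnd ℂ (G (-t)), hi, fun t ht => ?_, fun n => ?_⟩
  · simp only
    rw [hGs, map_zero]
    rw [← abs_neg]; convert ht using 2; ring
  · simp only
    rw [hGX, kernel, kernel, ← integral_conj, ← integral_neg_eq_self]
    refine integral_congr_ae (Eventually.of_forall fun t => ?_)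
    simp only [map_mul, conj_e]
    congr 2; ring

/-- Partial sums of a band-limited sequence tend to `0` if the band contains no integer: such a
sequence is a difference `Y(n + 1) - Y(n)` where `Y` tends to `0` by the Riemann-Lebesgue lemma. -/
lemma BandLimited.tendsto_sum {v ρ : ℝ} {X : ℤ → ℂ} (hX : BandLimited v ρ X)
    (hv : ∀ l : ℤ, ρ < |v - l|) :
    Tendsto (fun N : ℕ => ∑ n ∈ Finset.Ico (-(N : ℤ)) N, X n) atTop (𝓝 0) := by
  obtain ⟨G, hG, hGs, hGX⟩ := hX
  have hne : ∀ t ∈ Set.Icc (v - ρ) (v + ρ), e t - 1 ≠ 0 := by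
    intro t ht h
    obtain ⟨l, hl⟩ := (e_eq_one_iff t).1 (sub_eq_zero.1 h)
    have h1 := hv l
    rw [← hl] at h1
    exact absurd h1 (not_lt.2 (by rw [abs_le]; constructor <;> linarith [ht.1, ht.2]))
  have hsupp : Function.support G ⊆ Set.Icc (v - ρ) (v + ρ) := by
    intro t ht
    have h1 := not_lt.1 fun h => ht (hGs t h)
    rw [abs_le] at h1
    exact ⟨by linarith, by linarith⟩
  set H : ℝ → ℂ := fun t => G t * (e t - 1)⁻¹ with hH
  have hHi : Integrable H := by
    have hs : Function.support H ⊆ Set.Icc (v - ρ) (v + ρ) :=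
      (Function.support_mul_subset_left _ _).trans hsupp
    rw [← integrableOn_iff_integrable_of_support_subset hs]
    refine hG.integrableOn.mul_continuousOn (ContinuousOn.inv₀ ?_ hne) isCompact_Icc
    exact (continuous_e.sub continuous_const).continuousOn
  have hXY (n : ℤ) : X n = kernel H (n + 1 : ℤ) - kernel H n := by
    rw [hGX, kernel, kernel, kernel, ← integral_sub (integrable_mul_e hHi _) (integrable_mul_e hHi _)]
    refine integral_congr_ae (Eventually.of_forall fun t => ?_)
    simp only
    rw [show ((n + 1 : ℤ) : ℝ) * t = n * t + t by push_cast; ring, e_add]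
    by_cases ht : G t = 0
    · simp [hH, ht]
    · have := hne t (hsupp ht)
      simp only [hH]; field_simp
  have hlim : Tendsto (kernel H) (cocompact ℝ) (𝓝 0) := by
    have h1 : kernel H = fun z => 𝓕 H (-z) := by
      rw [kernel_eq_fourierInv]; ext z; rw [Real.fourierInv_eq_fourier_neg]
    rw [h1]
    exact (Real.zero_at_infty_fourier H).comp (Homeomorph.neg ℝ).isClosedEmbedding.tendsto_cocompact
  have hc1 : Tendsto (fun N : ℕ => ((N : ℤ) : ℝ)) atTop (cocompact ℝ) := by
    refine tendsto_natCast_atTop_atTop.mono_right ?_ |>.congr fun N => by simp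
    exact atTop_le_cocompact
  have hc2 : Tendsto (fun N : ℕ => ((-(N : ℤ) : ℤ) : ℝ)) atTop (cocompact ℝ) := by
    have : Tendsto (fun N : ℕ => -(N : ℝ)) atTop (cocompact ℝ) :=
      (tendsto_neg_atTop_atBot.comp tendsto_natCast_atTop_atTop).mono_right atBot_le_cocompact
    exact this.congr fun N => by simp
  have hsum (N : ℕ) : ∑ n ∈ Finset.Ico (-(N : ℤ)) N, X n =
      kernel H ((N : ℤ) : ℝ) - kernel H ((-(N : ℤ) : ℤ) : ℝ) := by
    simp only [hXY]
    induction N with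
    | zero => simp
    | succ N ih =>
      have h1 : Finset.Ico (-((N + 1 : ℕ) : ℤ)) ((N + 1 : ℕ) : ℤ) =
          insert (-(N : ℤ) - 1) (insert (N : ℤ) (Finset.Ico (-(N : ℤ)) N)) := by
        ext j; simp only [Finset.mem_Ico, Finset.mem_insert]; omega
      rw [h1, Finset.sum_insert (by simp), Finset.sum_insert (by simp), ih,
        show (-(N : ℤ) - 1 + 1) = -(N : ℤ) by ring,
        show (-((N + 1 : ℕ) : ℤ)) = -(N : ℤ) - 1 by push_cast; ring]
      push_cast; ring
  simp only [hsum]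
  simpa using (hlim.comp hc1).sub (hlim.comp hc2)

/-- A sampled, modulated band-limited function. -/
lemma bandLimited_kernel {h : ℝ → ℂ} (hh : Integrable h)
    (hs : Function.support h ⊆ Set.Icc (-(1 / 2)) (1 / 2)) (v : ℝ) {ε : ℝ} (h0 : 0 < ε) :
    BandLimited v (ε / 2) fun n => e (v * n) * kernel h (ε * n) := by
  refine ⟨fun t => (ε⁻¹ : ℝ) * h (ε⁻¹ * (t - v)), ?_, fun t ht => ?_, fun n => ?_⟩
  · exact ((hh.comp_mul_left' (inv_ne_zero h0.ne')).comp_sub_right v).const_mul _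
  · by_contra hne
    have h1 := hs (right_ne_zero_of_mul hne)
    have h2 : |ε⁻¹ * (t - v)| ≤ 1 / 2 := abs_le.2 ⟨h1.1, h1.2⟩
    rw [abs_mul, abs_of_pos (inv_pos.2 h0), inv_mul_le_iff₀ h0] at h2
    linarith
  · set g : ℝ → ℂ := fun ξ => h ξ * e (n * (v + ε * ξ)) with hg
    have h1 : kernel (fun t => (ε⁻¹ : ℝ) * h (ε⁻¹ * (t - v))) n =
        ∫ t, (ε⁻¹ : ℝ) * g (ε⁻¹ * (t - v)) := by
      refine integral_congr_ae (Eventually.of_forall fun t => ?_)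
      simp only [hg]
      rw [show v + ε * (ε⁻¹ * (t - v)) = t by field_simp; ring]; ring
    change e (v * n) * kernel h (ε * n) = _
    rw [h1, integral_sub_right_eq_self (fun t => (ε⁻¹ : ℝ) * g (ε⁻¹ * t)) v, integral_const_mul,
      Measure.integral_comp_mul_left g, inv_inv, abs_of_pos h0, Complex.real_smul, ← mul_assoc,
      ← Complex.ofReal_mul, inv_mul_cancel₀ h0.ne', Complex.ofReal_one, one_mul, kernel,
      ← integral_const_mul]
    refine integral_congr_ae (Eventually.of_forall fun ξ => ?_)
    simp only [hg]
    rw [show n * (v + ε * ξ) = v * n + ε * n * ξ by ring, e_add]; ring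

/-- Finite sums of sequences whose frequencies lie within `ρ` of a point of `E`. -/
def Spectral (E : Set ℝ) (ρ : ℝ) (X : ℤ → ℂ) : Prop :=
  X ∈ AddSubmonoid.closure {X | ∃ v ∈ E, BandLimited v ρ X}

lemma Spectral.of_bandLimited {E : Set ℝ} {ρ v : ℝ} {X : ℤ → ℂ} (hv : v ∈ E)
    (hX : BandLimited v ρ X) : Spectral E ρ X := AddSubmonoid.subset_closure ⟨v, hv, hX⟩

lemma Spectral.sum {E : Set ℝ} {ρ : ℝ} {ι : Type*} (s : Finset ι) {X : ι → ℤ → ℂ}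
    (hX : ∀ i ∈ s, Spectral E ρ (X i)) : Spectral E ρ fun n => ∑ i ∈ s, X i n := by
  have h : (fun n => ∑ i ∈ s, X i n) = ∑ i ∈ s, X i := by ext n; simp
  rw [h]
  exact AddSubmonoid.sum_mem (AddSubmonoid.closure {X | ∃ v ∈ E, BandLimited v ρ X}) hX

lemma Spectral.mul {E E' E'' : Set ℝ} (hE : ∀ v ∈ E, ∀ w ∈ E', v + w ∈ E'') {ρ σ : ℝ}
    {X Y : ℤ → ℂ} (hX : Spectral E ρ X) (hY : Spectral E' σ Y) :
    Spectral E'' (ρ + σ) (X * Y) := by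
  unfold Spectral at hX hY
  induction hX using AddSubmonoid.closure_induction with
  | mem X hX =>
    obtain ⟨v, hv, hX⟩ := hX
    induction hY using AddSubmonoid.closure_induction with
    | mem Y hY =>
      obtain ⟨w, hw, hY⟩ := hY
      exact Spectral.of_bandLimited (hE v hv w hw) (hX.mul hY)
    | zero => rw [mul_zero]; exact AddSubmonoid.zero_mem _
    | add Y Y' _ _ h h' => rw [mul_add]; exact AddSubmonoid.add_mem _ h h'
  | zero => rw [zero_mul]; exact AddSubmonoid.zero_mem _
  | add X X' _ _ h h' => rw [add_mul]; exact AddSubmonoid.add_mem _ h h'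

lemma Spectral.conj {E E' : Set ℝ} (hE : ∀ v ∈ E, -v ∈ E') {ρ : ℝ} {X : ℤ → ℂ}
    (hX : Spectral E ρ X) : Spectral E' ρ fun n => starRingEnd ℂ (X n) := by
  unfold Spectral at hX
  induction hX using AddSubmonoid.closure_induction with
  | mem X hX =>
    obtain ⟨v, hv, hX⟩ := hX
    exact Spectral.of_bandLimited (hE v hv) hX.conj
  | zero =>
    simp only [Pi.zero_apply, map_zero]; exact AddSubmonoid.zero_mem _
  | add X Y _ _ h h' =>
    simp only [Pi.add_apply, map_add]; exact AddSubmonoid.add_mem _ h h'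

lemma Spectral.tsum_eq_zero {E : Set ℝ} {ρ : ℝ} (hE : ∀ v ∈ E, ∀ l : ℤ, ρ < |v - l|) {X : ℤ → ℂ}
    (hX : Spectral E ρ X) (hs : Summable X) : ∑' n, X n = 0 := by
  have h1 : Tendsto (fun N : ℕ => ∑ n ∈ Finset.Ico (-(N : ℤ)) N, X n) atTop (𝓝 0) := by
    clear hs
    unfold Spectral at hX
    induction hX using AddSubmonoid.closure_induction with
    | mem X hX =>
      obtain ⟨v, hv, hX⟩ := hX
      exact hX.tendsto_sum (hE v hv)
    | zero => simp
    | add X Y _ _ h h' => simpa [Finset.sum_add_distrib] using h.add h'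
  have h2 : Tendsto (fun N : ℕ => Finset.Ico (-(N : ℤ)) N) atTop atTop :=
    Finset.tendsto_Ico_neg_atTop_atTop.comp tendsto_natCast_atTop_atTop
  exact tendsto_nhds_unique (hs.hasSum.comp h2) h1

/-! ### Frequencies with coprime denominators -/

/-- Rationals that have a denominator coprime to `q` and at most `Q ^ k`. -/
def coprimeFreq (q Q k : ℕ) : Set ℝ :=
  {v | ∃ d : ℕ, 0 < d ∧ d ≤ Q ^ k ∧ d.Coprime q ∧ ∃ b : ℤ, v * d = b}

/-- Sums of a nonintegral element of `q⁻¹ℤ` and an element of `coprimeFreq q Q k`. -/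
def mixedFreq (q Q k : ℕ) : Set ℝ :=
  {v | ∃ v₀ w : ℝ, v = v₀ + w ∧ (∃ b : ℤ, v₀ * q = b) ∧ (∀ l : ℤ, v₀ ≠ l) ∧ w ∈ coprimeFreq q Q k}

lemma coprimeFreq_add {q Q k l : ℕ} {v w : ℝ} (hv : v ∈ coprimeFreq q Q k)
    (hw : w ∈ coprimeFreq q Q l) : v + w ∈ coprimeFreq q Q (k + l) := by
  obtain ⟨d, hd, hdQ, hdq, b, hb⟩ := hv
  obtain ⟨d', hd', hdQ', hdq', b', hb'⟩ := hw
  refine ⟨d * d', Nat.mul_pos hd hd', by rw [pow_add]; exact Nat.mul_le_mul hdQ hdQ',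
    Nat.Coprime.mul_left hdq hdq', b * d' + b' * d, ?_⟩
  push_cast
  rw [← hb, ← hb']; ring

lemma coprimeFreq_neg {q Q k : ℕ} {v : ℝ} (hv : v ∈ coprimeFreq q Q k) :
    -v ∈ coprimeFreq q Q k := by
  obtain ⟨d, hd, hdQ, hdq, b, hb⟩ := hv
  exact ⟨d, hd, hdQ, hdq, -b, by push_cast; rw [← hb]; ring⟩

lemma mixedFreq_add {q Q k l : ℕ} {v w : ℝ} (hv : v ∈ mixedFreq q Q k)
    (hw : w ∈ coprimeFreq q Q l) : v + w ∈ mixedFreq q Q (k + l) := by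
  obtain ⟨v₀, x, rfl, hb, hl, hx⟩ := hv
  exact ⟨v₀, x + w, by ring, hb, hl, coprimeFreq_add hx hw⟩

/-- A mixed frequency is not an integer, and its distance from the integers is bounded below by
the reciprocal of a common denominator. -/
lemma one_le_mul_abs_sub_of_mixedFreq {q Q k : ℕ} (hq : 0 < q) (hqQ : q ≤ Q) {v : ℝ}
    (hv : v ∈ mixedFreq q Q k) (l : ℤ) : 1 ≤ (Q : ℝ) ^ (k + 1) * |v - l| := by
  obtain ⟨v₀, w, rfl, ⟨b, hb⟩, hl, d, hd, hdQ, hdq, b', hb'⟩ := hv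
  have hd1 : (0 : ℝ) < d := by exact_mod_cast hd
  have hq1 : (0 : ℝ) < q := by exact_mod_cast hq
  set M : ℤ := b * d + b' * q - l * (q * d) with hM
  have hMe : (M : ℝ) = (q * d) * (v₀ + w - l) := by
    rw [hM]; push_cast; rw [← hb, ← hb']; ring
  have hM0 : M ≠ 0 := by
    intro h0
    have h1 : (q : ℤ) ∣ b * d := ⟨l * d - b', by rw [hM] at h0; linear_combination h0⟩
    have h2 : (q : ℤ) ∣ b := (Nat.isCoprime_iff_coprime.2 hdq.symm).dvd_of_dvd_mul_right h1
    obtain ⟨c, hc⟩ := h2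
    refine hl c (mul_right_cancel₀ hq1.ne' ?_)
    rw [hb, hc]; push_cast; ring
  have h3 : (1 : ℝ) ≤ |(M : ℝ)| := by exact_mod_cast Int.one_le_abs hM0
  rw [hMe, abs_mul, abs_of_pos (by positivity)] at h3
  refine h3.trans ?_
  gcongr
  rw [pow_succ']
  exact mul_le_mul (by exact_mod_cast hqQ) (by exact_mod_cast hdQ) hd1.le (by positivity)

lemma Spectral.mul_pow {q Q k l : ℕ} {ρ σ : ℝ} {X Y : ℤ → ℂ}
    (hX : Spectral (mixedFreq q Q k) ρ X) (hY : Spectral (coprimeFreq q Q l) σ Y) (N : ℕ) :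
    Spectral (mixedFreq q Q (k + N * l)) (ρ + N * σ) (X * Y ^ N) := by
  induction N with
  | zero => simpa using hX
  | succ N ih =>
    have := ih.mul (fun v hv w hw => mixedFreq_add hv hw) hY
    rw [pow_succ, ← mul_assoc, show k + (N + 1) * l = k + N * l + l by ring,
      show ρ + ((N + 1 : ℕ) : ℝ) * σ = ρ + N * σ + σ by push_cast; ring]
    exact this

lemma Spectral.tsum_eq_zero_of_mixedFreq {q Q k : ℕ} (hq : 0 < q) (hqQ : q ≤ Q) {ρ : ℝ}
    (hρ : ρ * (Q : ℝ) ^ (k + 1) < 1) {X : ℤ → ℂ} (hX : Spectral (mixedFreq q Q k) ρ X)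
    (hs : Summable X) : ∑' n, X n = 0 := by
  refine hX.tsum_eq_zero (fun v hv l => ?_) hs
  have h1 := one_le_mul_abs_sub_of_mixedFreq hq hqQ hv l
  have hQ : (0 : ℝ) < (Q : ℝ) ^ (k + 1) := by
    have : (0 : ℝ) < Q := by exact_mod_cast hq.trans_le hqQ
    positivity
  by_contra! h
  nlinarith

/-! ### Decoupling a sum of squares -/

/-- If replacing one factor `x_q` of a moment of `∑ x_q` by `y_q` does not change the moment when
the other factors have indices different from `q`, then the moments of `∑ x_q` are controlled by
those of `∑ y_q`, up to the diagonal. -/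
theorem exists_decoupling_const (R : ℕ) : ∃ C : ℝ, 0 ≤ C ∧ ∀ {Ω κ : Type} [DecidableEq κ]
    [MeasurableSpace Ω] (μ : Measure Ω) (Z : Finset κ) (x y : κ → Ω → ℝ), (∀ q, Measurable (x q)) →
    (∀ q, Measurable (y q)) → (∀ q t, 0 ≤ x q t) → (∀ q t, 0 ≤ y q t) →
    (∀ q ∈ Z, Integrable (fun t => x q t ^ (R + 1)) μ) →
    (∀ q ∈ Z, Integrable (fun t => y q t ^ (R + 1)) μ) →
    (∀ q ∈ Z, ∫ t, (x q t - y q t) * (∑ q' ∈ Z.erase q, x q' t) ^ R ∂μ = 0) →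
    Integrable (fun t => (∑ q ∈ Z, y q t) ^ (R + 1) + ∑ q ∈ Z, x q t ^ (R + 1)) μ ∧
    ∫ t, (∑ q ∈ Z, x q t) ^ (R + 1) ∂μ ≤
      C * ∫ t, ((∑ q ∈ Z, y q t) ^ (R + 1) + ∑ q ∈ Z, x q t ^ (R + 1)) ∂μ := by
  obtain ⟨C, hC, young⟩ := exists_young_const (R + 1) (by positivity) R
  refine ⟨2 * C * 2 ^ R, by positivity, fun {Ω κ} _ _ μ Z x y hxm hym hx0 hy0 hx hy hvan => ?_⟩
  set X : Ω → ℝ := fun t => ∑ q ∈ Z, x q t with hX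
  set Y : Ω → ℝ := fun t => ∑ q ∈ Z, y q t with hY
  set W : Ω → ℝ := fun t => ∑ q ∈ Z, x q t ^ (R + 1) with hW
  -- an upper bound for all the `x q`, with the `(R + 1)`-st power equal to `W`
  set V : Ω → ℝ := fun t => W t ^ (((R + 1 : ℕ) : ℝ)⁻¹) with hV
  set T : κ → Ω → ℝ := fun q t => ∑ q' ∈ Z.erase q, x q' t with hT
  have hX0 (t) : 0 ≤ X t := Finset.sum_nonneg fun q _ => hx0 q t
  have hY0 (t) : 0 ≤ Y t := Finset.sum_nonneg fun q _ => hy0 q t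
  have hW0 (t) : 0 ≤ W t := Finset.sum_nonneg fun q _ => pow_nonneg (hx0 q t) _
  have hV0 (t) : 0 ≤ V t := Real.rpow_nonneg (hW0 t) _
  have hT0 (q t) : 0 ≤ T q t := Finset.sum_nonneg fun q _ => hx0 q t
  have hVW (t) : V t ^ (R + 1) = W t := Real.rpow_inv_natCast_pow (hW0 t) (by simp)
  have hxV (q) (hq : q ∈ Z) (t) : x q t ≤ V t := by
    refine le_of_pow_le_pow_left₀ (n := R + 1) (by simp) (hV0 t) ?_
    rw [hVW]
    exact Finset.single_le_sum (f := fun q => x q t ^ (R + 1)) (fun q _ => pow_nonneg (hx0 q t) _) hq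
  have hxX (q) (hq : q ∈ Z) (t) : x q t ≤ X t :=
    Finset.single_le_sum (f := fun q => x q t) (fun q _ => hx0 q t) hq
  have hyY (q) (hq : q ∈ Z) (t) : y q t ≤ Y t :=
    Finset.single_le_sum (f := fun q => y q t) (fun q _ => hy0 q t) hq
  have hTX (q t) : T q t ≤ X t :=
    Finset.sum_le_sum_of_subset_of_nonneg (Finset.erase_subset _ _) fun q _ _ => hx0 q t
  have hXT (q) (hq : q ∈ Z) (t) : X t = x q t + T q t := (Finset.add_sum_erase Z _ hq).symm
  have hXm : Measurable X := by fun_prop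
  have hYm : Measurable Y := by fun_prop
  have hTm (q) : Measurable (T q) := by fun_prop
  have iW : Integrable W μ := integrable_finsetSum _ hx
  have iX : Integrable (fun t => X t ^ (R + 1)) μ := by
    refine (iW.const_mul ((Z.card : ℝ) ^ R)).mono' (by fun_prop) (Eventually.of_forall fun t => ?_)
    rw [Real.norm_of_nonneg (pow_nonneg (hX0 t) _)]
    exact pow_sum_le_card_mul_sum_pow (fun q _ => hx0 q t) _
  have iY : Integrable (fun t => Y t ^ (R + 1)) μ := by
    refine ((integrable_finsetSum Z hy).const_mul ((Z.card : ℝ) ^ R)).mono' (by fun_prop)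
      (Eventually.of_forall fun t => ?_)
    rw [Real.norm_of_nonneg (pow_nonneg (hY0 t) _)]
    exact pow_sum_le_card_mul_sum_pow (fun q _ => hy0 q t) _
  have iYW : Integrable (fun t => Y t ^ (R + 1) + W t) μ := iY.add iW
  refine ⟨iYW, ?_⟩
  have hadd (a b : ℝ) (ha : 0 ≤ a) (hb : 0 ≤ b) :
      (a + b) ^ (R + 1) ≤ 2 ^ R * (a ^ (R + 1) + b ^ (R + 1)) := by
    simpa using add_pow_le ha hb (R + 1)
  have iXY : Integrable (fun t => (X t + Y t) ^ (R + 1)) μ := by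
    refine ((iX.add iY).const_mul (2 ^ R)).mono' (by fun_prop) (Eventually.of_forall fun t => ?_)
    rw [Real.norm_of_nonneg (pow_nonneg (add_nonneg (hX0 t) (hY0 t)) _)]
    exact hadd _ _ (hX0 t) (hY0 t)
  have prod (a b : Ω → ℝ) (ha : Measurable a) (hb : Measurable b) (ha0 : ∀ t, 0 ≤ a t)
      (hb0 : ∀ t, 0 ≤ b t) (ha1 : ∀ t, a t ≤ X t + Y t) (hb1 : ∀ t, b t ≤ X t + Y t) :
      Integrable (fun t => a t * b t ^ R) μ := by
    refine iXY.mono' (by fun_prop) (Eventually.of_forall fun t => ?_)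
    rw [Real.norm_of_nonneg (mul_nonneg (ha0 t) (pow_nonneg (hb0 t) _)), pow_succ']
    exact mul_le_mul (ha1 t) (pow_le_pow_left₀ (hb0 t) (hb1 t) _) (pow_nonneg (hb0 t) _)
      (add_nonneg (hX0 t) (hY0 t))
  have leX {a : ℝ} {t : Ω} (h : a ≤ X t) : a ≤ X t + Y t := h.trans (le_add_of_nonneg_right (hY0 t))
  have leY {a : ℝ} {t : Ω} (h : a ≤ Y t) : a ≤ X t + Y t := h.trans (le_add_of_nonneg_left (hX0 t))
  have i1 (q) (hq : q ∈ Z) : Integrable (fun t => x q t * X t ^ R) μ :=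
    prod _ _ (hxm q) hXm (hx0 q) hX0 (fun t => leX (hxX q hq t)) fun t => leX le_rfl
  have i2 (q) (hq : q ∈ Z) : Integrable (fun t => x q t * T q t ^ R) μ :=
    prod _ _ (hxm q) (hTm q) (hx0 q) (hT0 q) (fun t => leX (hxX q hq t)) fun t => leX (hTX q t)
  have i3 (q) (hq : q ∈ Z) : Integrable (fun t => y q t * T q t ^ R) μ :=
    prod _ _ (hym q) (hTm q) (hy0 q) (hT0 q) (fun t => leY (hyY q hq t)) fun t => leX (hTX q t)
  have hpow (q) (hq : q ∈ Z) (t) : (X t ^ R - T q t ^ R) * X t ≤ R * x q t * X t ^ R := by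
    rcases R with _ | R'
    · simp
    · have h1 : X t ^ (R' + 1) - T q t ^ (R' + 1) ≤ (R' + 1) * x q t * X t ^ R' := by
        have h2 : X t - T q t = x q t := by rw [hXT q hq t]; ring
        clear * - h2 hX0 hT0 hTX hx0
        rw [← h2]
        induction R' with
        | zero => simp
        | succ k ih =>
          have e1 : X t ^ (k + 1 + 1) - T q t ^ (k + 1 + 1) =
            X t * (X t ^ (k + 1) - T q t ^ (k + 1)) + (X t - T q t) * T q t ^ (k + 1) := by ring
          have e2 : T q t ^ (k + 1) ≤ X t ^ (k + 1) := pow_le_pow_left₀ (hT0 q t) (hTX q t) _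
          have e3 : 0 ≤ X t - T q t := sub_nonneg.2 (hTX q t)
          rw [e1]
          calc _ ≤ X t * ((k + 1) * (X t - T q t) * X t ^ k) + (X t - T q t) * X t ^ (k + 1) := by
                have := hX0 t
                gcongr
            _ = _ := by push_cast; ring
      refine (mul_le_mul_of_nonneg_right h1 (hX0 t)).trans_eq ?_
      push_cast; ring
  have eqX : ∫ t, X t ^ (R + 1) ∂μ =
      ∫ t, ∑ q ∈ Z, (x q t * (X t ^ R - T q t ^ R) + y q t * T q t ^ R) ∂μ := by
    have i4 (q) (hq : q ∈ Z) : Integrable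
        (fun t => x q t * (X t ^ R - T q t ^ R) + y q t * T q t ^ R) μ := by
      simp only [mul_sub]; exact ((i1 q hq).sub (i2 q hq)).add (i3 q hq)
    rw [integral_finsetSum _ i4]
    have : ∀ q ∈ Z, ∫ t, (x q t * (X t ^ R - T q t ^ R) + y q t * T q t ^ R) ∂μ =
        ∫ t, x q t * X t ^ R ∂μ := by
      intro q hq
      have h1 := hvan q hq
      simp only [sub_mul] at h1
      rw [integral_sub (i2 q hq) (i3 q hq)] at h1
      simp only [mul_sub]
      have i5 : Integrable (fun t => x q t * X t ^ R - x q t * T q t ^ R) μ :=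
        (i1 q hq).sub (i2 q hq)
      rw [integral_add i5 (i3 q hq), integral_sub (i1 q hq) (i2 q hq)]
      linarith
    rw [Finset.sum_congr rfl this, ← integral_finsetSum _ i1]
    refine integral_congr_ae (Eventually.of_forall fun t => ?_)
    simp only [← Finset.sum_mul]; rw [pow_succ']
  have pt (t) : ∑ q ∈ Z, (x q t * (X t ^ R - T q t ^ R) + y q t * T q t ^ R) ≤
      X t ^ (R + 1) / 2 + C * 2 ^ R * (Y t ^ (R + 1) + W t) := by
    have h1 : ∑ q ∈ Z, x q t * (X t ^ R - T q t ^ R) ≤ R * V t * X t ^ R := by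
      rcases (hX0 t).eq_or_lt with h | h
      · have : ∀ q ∈ Z, x q t = 0 := fun q hq => le_antisymm (h ▸ hxX q hq t) (hx0 q t)
        rw [Finset.sum_eq_zero fun q hq => by rw [this q hq, zero_mul]]
        have := hV0 t; have := hX0 t; positivity
      · refine le_of_mul_le_mul_right ?_ h
        rw [Finset.sum_mul]
        calc _ ≤ ∑ q ∈ Z, x q t * (R * V t * X t ^ R) := by
              refine Finset.sum_le_sum fun q hq => ?_
              rw [mul_assoc]
              refine mul_le_mul_of_nonneg_left ((hpow q hq t).trans ?_) (hx0 q t)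
              have := hxV q hq t
              gcongr
          _ = _ := by rw [← Finset.sum_mul]; ring
    have h2 : ∑ q ∈ Z, y q t * T q t ^ R ≤ Y t * X t ^ R := by
      rw [hY]; simp only [Finset.sum_mul]
      refine Finset.sum_le_sum fun q _ => ?_
      have := hy0 q t; have := hT0 q t; have := hTX q t
      gcongr
    rw [Finset.sum_add_distrib]
    have hVY : 0 ≤ V t + Y t := add_nonneg (hV0 t) (hY0 t)
    have h3 := young (X t) (V t + Y t) (hX0 t) hVY
    have h4 := hadd (V t) (Y t) (hV0 t) (hY0 t)
    rw [hVW] at h4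
    have h5 : X t ^ R ≤ (X t + (V t + Y t)) ^ R :=
      pow_le_pow_left₀ (hX0 t) (le_add_of_nonneg_right hVY) _
    have h6 : R * V t * X t ^ R + Y t * X t ^ R ≤ (R + 1) * ((V t + Y t) * X t ^ R) := by
      have h7 : 0 ≤ V t * X t ^ R := mul_nonneg (hV0 t) (pow_nonneg (hX0 t) _)
      have h8 : 0 ≤ R * (Y t * X t ^ R) :=
        mul_nonneg (Nat.cast_nonneg _) (mul_nonneg (hY0 t) (pow_nonneg (hX0 t) _))
      linarith
    calc _ ≤ (R + 1) * ((V t + Y t) * X t ^ R) := (add_le_add h1 h2).trans h6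
      _ ≤ (R + 1) * ((V t + Y t) * (X t + (V t + Y t)) ^ R) := by gcongr
      _ ≤ X t ^ (R + 1) / 2 + C * (2 ^ R * (W t + Y t ^ (R + 1))) := h3.trans (by gcongr)
      _ = _ := by ring
  have fin : ∫ t, X t ^ (R + 1) ∂μ ≤ (∫ t, X t ^ (R + 1) ∂μ) / 2 +
      C * 2 ^ R * ∫ t, (Y t ^ (R + 1) + W t) ∂μ := by
    nth_rewrite 1 [eqX]
    rw [← integral_div, ← integral_const_mul,
      ← integral_add (iX.div_const 2) (iYW.const_mul _)]
    refine integral_mono ?_ ((iX.div_const 2).add (iYW.const_mul _)) pt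
    refine integrable_finsetSum _ fun q hq => ?_
    simp only [mul_sub]; exact ((i1 q hq).sub (i2 q hq)).add (i3 q hq)
  linarith

/-! ### The pieces of a finitely supported sequence -/

lemma integrable_count_of_tsum_ne_top {g : ℤ → ℝ} (hg : ∑' n, ‖g n‖ₑ ≠ ⊤) :
    Integrable g Measure.count := by
  refine ⟨(Measurable.of_discrete).aestronglyMeasurable, ?_⟩
  rw [hasFiniteIntegral_iff_enorm, lintegral_count]; exact hg.lt_top

lemma ofReal_integral_count {g : ℤ → ℝ} (hg : Integrable g Measure.count) (h0 : ∀ n, 0 ≤ g n) :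
    ENNReal.ofReal (∫ n, g n ∂Measure.count) = ∑' n, ENNReal.ofReal (g n) := by
  rw [ofReal_integral_eq_lintegral_ofReal hg (Eventually.of_forall h0), lintegral_count]

/-- The sum of a sequence with mixed frequencies vanishes. If the sequence is not
summable, the integral is `0` by convention. -/
lemma Spectral.integral_eq_zero {q Q k : ℕ} (hq : 0 < q) (hqQ : q ≤ Q) {ρ : ℝ}
    (hρ : ρ * (Q : ℝ) ^ (k + 1) < 1) {X : ℤ → ℂ} (hX : Spectral (mixedFreq q Q k) ρ X) :
    ∫ n, X n ∂Measure.count = 0 := by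
  by_cases hi : Integrable X Measure.count
  · rw [integral_countable hi]
    simp only [measureReal_def, Measure.count_singleton, ENNReal.toReal_one, one_smul]
    exact hX.tsum_eq_zero_of_mixedFreq hq hqQ hρ (integrable_count_iff.1 hi).of_norm
  · exact integral_undef hi

/-- The piece of `f` at the frequency `v`: the operator with symbol `m`, conjugated by the
character of frequency `v`. -/
noncomputable def modPiece (m : ℝ → ℂ) (s : Finset ℤ) (ε : ℝ) (f : ℤ → ℂ) (v : ℝ) (n : ℤ) : ℂ :=
  e (v * n) * bandOp m s ε (fun k => f k * e (-(v * k))) (ε * n)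

lemma bandLimited_modPiece {m : ℝ → ℂ} (hm : Integrable m)
    (hs : Function.support m ⊆ Set.Ioc (-(1 / 2) : ℝ) (1 / 2)) (s : Finset ℤ) {ε : ℝ} (h0 : 0 < ε)
    (f : ℤ → ℂ) (v : ℝ) : BandLimited v (ε / 2) (modPiece m s ε f v) := by
  unfold modPiece
  rw [bandOp_eq_kernel hm]
  have hsub := (Function.support_mul_subset_left m
    (trigPoly s ε fun k => f k * e (-(v * k)))).trans (hs.trans Set.Ioc_subset_Icc_self)
  refine bandLimited_kernel ?_ hsub v h0
  rw [← integrableOn_iff_integrable_of_support_subset hsub]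
  exact hm.integrableOn.mul_continuousOn (contDiff_trigPoly _ _ _).continuous.continuousOn
    isCompact_Icc

/-! ### Vanishing of the mixed moments of the blocks -/

lemma residue_div_ne_int {q a : ℕ} (hq : 1 < q) (ha : a ∈ residues q) (l : ℤ) : (a / q : ℝ) ≠ l := by
  intro h
  have hq0 : (q : ℝ) ≠ 0 := by positivity
  rw [div_eq_iff hq0] at h
  have h1 : (a : ℤ) = l * q := by exact_mod_cast h
  have h2 : q ∣ a := by
    rw [← Int.natCast_dvd_natCast]; exact ⟨l, by rw [h1, mul_comm]⟩
  have h3 : Nat.gcd a q = 1 := (Finset.mem_filter.1 ha).2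
  rw [Nat.gcd_eq_right h2] at h3
  omega

/-- Distinct reduced fractions whose denominators are at most `Q` are `Q⁻²`-separated. -/
lemma one_le_sq_mul_abs_sub {Z : Finset ℕ} {Q : ℕ} (hZ : ∀ q ∈ Z, 1 < q ∧ q ≤ Q)
    (hco : (Z : Set ℕ).Pairwise Nat.Coprime) {q q' a a' : ℕ} (hq : q ∈ Z) (hq' : q' ∈ Z)
    (ha : a ∈ residues q) (hne : ¬(q = q' ∧ a = a')) :
    1 ≤ (Q : ℝ) ^ 2 * |(a / q : ℝ) - a' / q'| := by
  have hq0 : (0 : ℝ) < q := by exact_mod_cast (zero_lt_one.trans (hZ q hq).1)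
  have hq0' : (0 : ℝ) < q' := by exact_mod_cast (zero_lt_one.trans (hZ q' hq').1)
  set M : ℤ := a * q' - a' * q with hM
  have hMe : (M : ℝ) = q * q' * (a / q - a' / q') := by
    rw [hM]; push_cast; field_simp
  have hM0 : M ≠ 0 := by
    intro h
    have h1 : a * q' = a' * q := by
      have : (a * q' : ℤ) = a' * q := by linarith
      exact_mod_cast this
    by_cases hqq : q = q'
    · subst hqq
      exact hne ⟨rfl, Nat.eq_of_mul_eq_mul_right (zero_lt_one.trans (hZ q hq).1) h1⟩
    · have h2 : q ∣ a := (hco hq hq' hqq).dvd_of_dvd_mul_right ⟨a', by rw [h1, mul_comm]⟩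
      have h3 : Nat.gcd a q = 1 := (Finset.mem_filter.1 ha).2
      rw [Nat.gcd_eq_right h2] at h3
      exact absurd (hZ q hq).1 (by omega)
  have h3 : (1 : ℝ) ≤ |(M : ℝ)| := by exact_mod_cast Int.one_le_abs hM0
  rw [hMe, abs_mul, abs_of_pos (by positivity)] at h3
  refine h3.trans ?_
  rw [sq]
  have h4 : (q : ℝ) ≤ Q := by exact_mod_cast (hZ q hq).2
  have h5 : (q' : ℝ) ≤ Q := by exact_mod_cast (hZ q' hq').2
  gcongr

/-- The block with denominator `q` has nonintegral frequencies in `q⁻¹ℤ`. -/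
lemma spectral_block {Z : Finset ℕ} {Q : ℕ} (hZ : ∀ q ∈ Z, 1 < q ∧ q ≤ Q) {ρ : ℝ}
    {φ : ℕ → ℕ → ℤ → ℂ} (hφ : ∀ q ∈ Z, ∀ a ∈ residues q, BandLimited (a / q) ρ (φ q a))
    {q : ℕ} (hq : q ∈ Z) : Spectral (mixedFreq q Q 0) ρ fun n => ∑ a ∈ residues q, φ q a n := by
  refine Spectral.sum _ fun a ha => Spectral.of_bandLimited ?_ (hφ q hq a ha)
  have hq0 : (q : ℝ) ≠ 0 := by have := (hZ q hq).1; positivity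
  exact ⟨a / q, 0, by simp, ⟨a, by push_cast; field_simp⟩, residue_div_ne_int (hZ q hq).1 ha,
    1, one_pos, by simp, Nat.coprime_one_left q, 0, by simp⟩

lemma spectral_other_block {Z : Finset ℕ} {Q : ℕ} (hZ : ∀ q ∈ Z, 1 < q ∧ q ≤ Q)
    (hco : (Z : Set ℕ).Pairwise Nat.Coprime) {ρ : ℝ} {φ : ℕ → ℕ → ℤ → ℂ}
    (hφ : ∀ q ∈ Z, ∀ a ∈ residues q, BandLimited (a / q) ρ (φ q a))
    {q : ℕ} (hq : q ∈ Z) {q' : ℕ} (hq' : q' ∈ Z.erase q) :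
    Spectral (coprimeFreq q Q 1) ρ fun n => ∑ a ∈ residues q', φ q' a n := by
  have hq'Z := Finset.mem_of_mem_erase hq'
  refine Spectral.sum _ fun a ha => Spectral.of_bandLimited ?_ (hφ q' hq'Z a ha)
  have hq0 : 0 < q' := zero_lt_one.trans (hZ q' hq'Z).1
  have hq1 : (q' : ℝ) ≠ 0 := by positivity
  exact ⟨q', hq0, by simpa using (hZ q' hq'Z).2, hco hq'Z hq (Finset.ne_of_mem_erase hq'), a,
    by push_cast; field_simp⟩

/-- A moment of the blocks in which the block with denominator `q` occurs exactly once vanishes: the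
frequencies of the block are not integers, and the denominators of the other frequencies are prime
to `q`. -/
lemma integral_block_mul_eq_zero {Z : Finset ℕ} {Q R : ℕ} (hZ : ∀ q ∈ Z, 1 < q ∧ q ≤ Q)
    (hco : (Z : Set ℕ).Pairwise Nat.Coprime) {ε : ℝ} (hε : (R + 1) * ε * (Q : ℝ) ^ (2 * R + 2) < 1)
    {φ : ℕ → ℕ → ℤ → ℂ} (hφ : ∀ q ∈ Z, ∀ a ∈ residues q, BandLimited (a / q) (ε / 2) (φ q a))
    {q : ℕ} (hq : q ∈ Z) :
    ∫ n, (∑ a ∈ residues q, φ q a n) * ((∑ q' ∈ Z.erase q, ∑ a ∈ residues q', φ q' a n) ^ R *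
      (starRingEnd ℂ (∑ q' ∈ Z.erase q, ∑ a ∈ residues q', φ q' a n)) ^ (R + 1)) ∂Measure.count =
      0 := by
  have sS : Spectral (coprimeFreq q Q 1) (ε / 2)
      fun n => ∑ q' ∈ Z.erase q, ∑ a ∈ residues q', φ q' a n :=
    Spectral.sum _ fun q' hq' => spectral_other_block hZ hco hφ hq hq'
  have h2 := ((spectral_block hZ hφ hq).mul_pow sS R).mul_pow
    (sS.conj fun v hv => coprimeFreq_neg hv) (R + 1)
  have h3 := h2.integral_eq_zero (zero_lt_one.trans (hZ q hq).1) (hZ q hq).2 (by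
    refine lt_of_eq_of_lt ?_ hε
    push_cast; ring)
  refine Eq.trans (integral_congr_ae (Eventually.of_forall fun n => ?_)) h3
  simp only [Pi.mul_apply, Pi.pow_apply]; ring

/-- The off-diagonal part of `|F_q|²` has frequencies near the differences of two distinct residues,
divided by `q`. -/
lemma spectral_offDiagonal {Z : Finset ℕ} {Q : ℕ} (hZ : ∀ q ∈ Z, 1 < q ∧ q ≤ Q) {ρ : ℝ}
    {φ : ℕ → ℕ → ℤ → ℂ} (hφ : ∀ q ∈ Z, ∀ a ∈ residues q, BandLimited (a / q) ρ (φ q a))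
    {q : ℕ} (hq : q ∈ Z) : Spectral (mixedFreq q Q 0) (ρ + ρ) fun n =>
      ∑ a ∈ residues q, ∑ a' ∈ (residues q).erase a, φ q a n * starRingEnd ℂ (φ q a' n) := by
  have hq0 : (q : ℝ) ≠ 0 := by have := (hZ q hq).1; positivity
  refine Spectral.sum _ fun a ha => Spectral.sum _ fun a' ha' =>
    Spectral.of_bandLimited ?_
      ((hφ q hq a ha).mul (hφ q hq a' (Finset.mem_of_mem_erase ha')).conj)
  refine ⟨a / q + -(a' / q), 0, by simp, ⟨a - a', by push_cast; field_simp; ring⟩, fun l hl => ?_,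
    1, one_pos, by simp, Nat.coprime_one_left q, 0, by simp⟩
  have h2 := (Finset.mem_Icc.1 (Finset.mem_filter.1 ha).1)
  have h3 := (Finset.mem_Icc.1 (Finset.mem_filter.1 (Finset.mem_of_mem_erase ha')).1)
  have h4 : ((a : ℤ) - a') = l * q := by
    have : (a : ℝ) - a' = l * q := by rw [← hl]; field_simp; ring
    exact_mod_cast this
  have h5 : ((a : ℤ) - a') = 0 := by
    apply Int.eq_zero_of_abs_lt_dvd (m := q) ⟨l, by rw [h4, mul_comm]⟩
    rw [abs_lt]; omega
  exact Finset.ne_of_mem_erase ha' (by omega)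

/-- In a moment of the squares of the blocks, a factor `|F_q|²` whose denominator occurs only once may
be replaced by its diagonal part. -/
lemma integral_sub_mul_eq_zero {Z : Finset ℕ} {Q R : ℕ} (hZ : ∀ q ∈ Z, 1 < q ∧ q ≤ Q)
    (hco : (Z : Set ℕ).Pairwise Nat.Coprime) {ε : ℝ} (hε : (R + 1) * ε * (Q : ℝ) ^ (2 * R + 2) < 1)
    (h0 : 0 ≤ ε) {φ : ℕ → ℕ → ℤ → ℂ}
    (hφ : ∀ q ∈ Z, ∀ a ∈ residues q, BandLimited (a / q) (ε / 2) (φ q a)) {q : ℕ} (hq : q ∈ Z) :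
    ∫ n, (‖∑ a ∈ residues q, φ q a n‖ ^ 2 - ∑ a ∈ residues q, ‖φ q a n‖ ^ 2) *
      (∑ q' ∈ Z.erase q, ‖∑ a ∈ residues q', φ q' a n‖ ^ 2) ^ R ∂Measure.count = 0 := by
  have hQ1 : (1 : ℝ) ≤ Q := by exact_mod_cast (hZ q hq).1.le.trans (hZ q hq).2
  have sX : Spectral (coprimeFreq q Q (1 + 1)) (ε / 2 + ε / 2) fun n => ∑ q' ∈ Z.erase q,
      (∑ a ∈ residues q', φ q' a n) * starRingEnd ℂ (∑ a ∈ residues q', φ q' a n) := by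
    refine Spectral.sum _ fun q' hq' => ?_
    have h1 := spectral_other_block hZ hco hφ hq hq'
    exact h1.mul (fun v hv w hw => coprimeFreq_add hv hw) (h1.conj fun v hv => coprimeFreq_neg hv)
  have h2 := ((spectral_offDiagonal hZ hφ hq).mul_pow sX R).integral_eq_zero
    (zero_lt_one.trans (hZ q hq).1) (hZ q hq).2 (by
      have hle : (Q : ℝ) ^ (0 + R * (1 + 1) + 1) ≤ (Q : ℝ) ^ (2 * R + 2) :=
        pow_le_pow_right₀ hQ1 (by omega)
      refine lt_of_le_of_lt ?_ hε
      calc _ = (R + 1) * ε * (Q : ℝ) ^ (0 + R * (1 + 1) + 1) := by ring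
        _ ≤ _ := by gcongr)
  rw [← Complex.ofReal_eq_zero, ← integral_complex_ofReal, ← h2]
  refine integral_congr_ae (Eventually.of_forall fun n => ?_)
  have key (t : Finset ℕ) (g : ℕ → ℂ) : ((‖∑ a ∈ t, g a‖ ^ 2 - ∑ a ∈ t, ‖g a‖ ^ 2 : ℝ) : ℂ) =
      ∑ a ∈ t, ∑ a' ∈ t.erase a, g a * starRingEnd ℂ (g a') := by
    rw [Complex.ofReal_sub, Complex.ofReal_pow, ← Complex.mul_conj', Complex.ofReal_sum, map_sum,
      Finset.sum_mul_sum, ← Finset.sum_sub_distrib]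
    refine Finset.sum_congr rfl fun a ha => ?_
    rw [← Finset.add_sum_erase _ _ ha, Complex.ofReal_pow, ← Complex.mul_conj']
    ring
  simp only [Pi.mul_apply, Pi.pow_apply]
  rw [Complex.ofReal_mul, key, Complex.ofReal_pow, Complex.ofReal_sum]
  congr 2
  refine Finset.sum_congr rfl fun q' _ => ?_
  rw [Complex.ofReal_pow, ← Complex.mul_conj']

/-! ### The main estimate for finitely supported sequences -/

/-- A single piece is bounded on `ℓ^{2R+2}(ℤ)`. -/
lemma exists_modPiece_const (R : ℕ) (B : ℝ≥0) : ∃ C : ℝ, 0 < C ∧ ∀ m : ℝ → ℂ,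
    IsLpMultiplier m ((2 * R + 2 : ℕ) : ℝ≥0∞) B →
    Function.support m ⊆ Set.Ioc (-(1 / 2) : ℝ) (1 / 2) → ∀ (ε : ℝ), 0 < ε → ε ≤ 1 →
    ∀ (v : ℝ), 0 ≤ v → v ≤ 1 → ∀ (s : Finset ℤ) (f : ℤ → ℂ),
    ∑' n : ℤ, ‖modPiece m s ε f v n‖ₑ ^ (2 * R + 2) ≤
      ENNReal.ofReal C * ∑ k ∈ s, ‖f k‖ₑ ^ (2 * R + 2) := by
  obtain ⟨C, hC, H⟩ := exists_squareFunction_const R B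
  refine ⟨C, hC, fun m hm hs ε h0 h1 v hv0 hv1 s f => ?_⟩
  have := H m hm hs ({0} : Finset ℕ) (fun _ => v) ε h0 h1 (fun _ _ => ⟨hv0, hv1⟩)
    (fun u hu u' hu' hne => by simp_all) s f
  simp only [Finset.sum_singleton, ← pow_mul] at this
  refine le_of_eq_of_le (tsum_congr fun n => ?_) this
  rw [modPiece, enorm_mul, ← ofReal_norm (e _), norm_e, ENNReal.ofReal_one, one_mul]
  ring_nf

/-- The main estimate for sequences supported on a finite set `s`. -/
theorem exists_finite_support_const (R : ℕ) (B : ℝ≥0) : ∃ C : ℝ, 0 < C ∧ ∀ m : ℝ → ℂ,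
    IsLpMultiplier m ((2 * R + 2 : ℕ) : ℝ≥0∞) B →
    Function.support m ⊆ Set.Ioc (-(1 / 2) : ℝ) (1 / 2) → ∀ (Z : Finset ℕ) (Q : ℕ),
    (∀ q ∈ Z, 1 < q ∧ q ≤ Q) → (Z : Set ℕ).Pairwise Nat.Coprime → ∀ ε : ℝ, 0 < ε →
    (R + 1) * ε * (Q : ℝ) ^ (2 * R + 2) < 1 → ∀ (s : Finset ℤ) (f : ℤ → ℂ),
    ∑' n : ℤ, ‖∑ q ∈ Z, ∑ a ∈ residues q, modPiece m s ε f (a / q) n‖ₑ ^ (2 * R + 2) ≤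
      ENNReal.ofReal (C * (2 ^ maxOmega Z) ^ (2 * R)) * ∑ k ∈ s, ‖f k‖ₑ ^ (2 * R + 2) := by
  obtain ⟨C1, hC1, H1⟩ := exists_superorthogonality_const R
  obtain ⟨C2, hC2, H2⟩ := exists_decoupling_const R
  obtain ⟨C3, hC3, H3⟩ := exists_squareFunction_const R B
  obtain ⟨C4, hC4, H4⟩ := exists_block_const R B
  obtain ⟨C5, hC5, H5⟩ := exists_modPiece_const R B
  refine ⟨(C1 + 1) * (C2 + 1) * (C3 + C4), by positivity,
    fun m hm hs Z Q hZ hco ε h0 hε s f => ?_⟩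
  rcases Z.eq_empty_or_nonempty with rfl | ⟨q₀, hq₀⟩
  · simp
  have hQ1 : (1 : ℝ) ≤ Q := by exact_mod_cast (hZ q₀ hq₀).1.le.trans (hZ q₀ hq₀).2
  -- `ε` is smaller than the reciprocals of the common denominators that occur below
  have hεk {k : ℕ} (hk : k ≤ 2 * R + 2) : ε * (Q : ℝ) ^ k ≤ 1 := by
    have h1 : ε * (Q : ℝ) ^ k ≤ ε * (Q : ℝ) ^ (2 * R + 2) := by gcongr
    have h2 : ε * (Q : ℝ) ^ (2 * R + 2) ≤ (R + 1) * ε * (Q : ℝ) ^ (2 * R + 2) := by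
      rw [mul_assoc]; exact le_mul_of_one_le_left (by positivity) (by simp)
    linarith
  have h1 : ε ≤ 1 := by simpa using hεk (Nat.zero_le _)
  have hsep : ∀ q ∈ Z, ∀ q' ∈ Z, ∀ a ∈ residues q, ∀ a' ∈ residues q', ¬(q = q' ∧ a = a') →
      ε ≤ |(a / q : ℝ) - a' / q'| := by
    intro q hq q' hq' a ha a' _ hne
    have h2 := one_le_sq_mul_abs_sub hZ hco hq hq' ha hne
    have h3 := hεk (show 2 ≤ 2 * R + 2 by omega)
    have hQ2 : (0 : ℝ) < (Q : ℝ) ^ 2 := by positivity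
    nlinarith
  have hfrac (q a : ℕ) (ha : a ∈ residues q) : 0 ≤ (a / q : ℝ) ∧ (a / q : ℝ) ≤ 1 := by
    have h2 := (Finset.mem_Icc.1 (Finset.mem_filter.1 ha).1)
    refine ⟨by positivity, div_le_one_of_le₀ (by exact_mod_cast h2.2) (by positivity)⟩
  set φ : ℕ → ℕ → ℤ → ℂ := fun q a n => modPiece m s ε f (a / q) n with hφ
  set F : ℕ → ℤ → ℂ := fun q n => ∑ a ∈ residues q, φ q a n with hF
  have iφ (q a : ℕ) (ha : a ∈ residues q) :
      Integrable (fun n => ‖φ q a n‖ ^ (2 * R + 2)) Measure.count := by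
    refine integrable_count_of_tsum_ne_top (ne_top_of_le_ne_top ?_ (le_of_eq_of_le ?_
      (H5 m hm hs ε h0 h1 (a / q) (hfrac q a ha).1 (hfrac q a ha).2 s f)))
    · exact ENNReal.mul_ne_top ENNReal.ofReal_ne_top (by simp [ENNReal.sum_eq_top])
    · simp [hφ, enorm_pow]
  have iF (q : ℕ) : Integrable (fun n => ‖F q n‖ ^ (2 * R + 2)) Measure.count := by
    refine ((integrable_finsetSum (residues q) (iφ q)).const_mul
      (((residues q).card : ℝ) ^ (2 * R + 1))).mono' Measurable.of_discrete.aestronglyMeasurable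
      (Eventually.of_forall fun n => ?_)
    rw [Real.norm_of_nonneg (by positivity)]
    refine (pow_le_pow_left₀ (norm_nonneg _) (norm_sum_le _ _) _).trans ?_
    exact pow_sum_le_card_mul_sum_pow (fun a _ => norm_nonneg _) _
  have iy (q : ℕ) : Integrable (fun n => (∑ a ∈ residues q, ‖φ q a n‖ ^ 2) ^ (R + 1))
      Measure.count := by
    refine ((integrable_finsetSum (residues q) (iφ q)).const_mul
      (((residues q).card : ℝ) ^ R)).mono' Measurable.of_discrete.aestronglyMeasurable
      (Eventually.of_forall fun n => ?_)
    rw [Real.norm_of_nonneg (pow_nonneg (Finset.sum_nonneg fun _ _ => by positivity) _)]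
    refine (pow_sum_le_card_mul_sum_pow (fun a _ => by positivity) _).trans_eq ?_
    simp only [← pow_mul, mul_add, mul_one]
  have hband (q) (_ : q ∈ Z) (a) (_ : a ∈ residues q) : BandLimited (a / q) (ε / 2) (φ q a) :=
    bandLimited_modPiece (integrable_of_multiplier hm hs) hs s h0 f _
  have van1 := fun q hq => integral_block_mul_eq_zero hZ hco hε hband (q := q) hq
  have step1 := H1 Measure.count Z F (fun q => Measurable.of_discrete) (fun q _ => iF q) van1
  set x : ℕ → ℤ → ℝ := fun q n => ‖F q n‖ ^ 2 with hx
  set y : ℕ → ℤ → ℝ := fun q n => ∑ a ∈ residues q, ‖φ q a n‖ ^ 2 with hy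
  have van2 := fun q hq => integral_sub_mul_eq_zero hZ hco hε h0.le hband (q := q) hq
  have hy0 (q n) : 0 ≤ y q n := Finset.sum_nonneg fun _ _ => by positivity
  obtain ⟨iR, step2⟩ := H2 Measure.count Z x y (fun q => Measurable.of_discrete)
    (fun q => Measurable.of_discrete) (fun q n => by positivity) hy0
    (fun q _ => by simpa only [hx, ← pow_mul, mul_add, mul_one] using iF q) (fun q _ => iy q) van2
  have iS : Integrable (fun n => ‖∑ q ∈ Z, F q n‖ ^ (2 * R + 2)) Measure.count := by
    refine ((integrable_finsetSum Z fun q _ => iF q).const_mul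
      ((Z.card : ℝ) ^ (2 * R + 1))).mono' Measurable.of_discrete.aestronglyMeasurable
      (Eventually.of_forall fun n => ?_)
    rw [Real.norm_of_nonneg (by positivity)]
    refine (pow_le_pow_left₀ (norm_nonneg _) (norm_sum_le _ _) _).trans ?_
    exact pow_sum_le_card_mul_sum_pow (fun a _ => norm_nonneg _) _
  have hrhs : ENNReal.ofReal (∫ n, ((∑ q ∈ Z, y q n) ^ (R + 1) + ∑ q ∈ Z, x q n ^ (R + 1))
      ∂Measure.count) ≤ ENNReal.ofReal ((C3 + C4) * (2 ^ maxOmega Z) ^ (2 * R)) *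
        ∑ k ∈ s, ‖f k‖ₑ ^ (2 * R + 2) := by
    rw [ofReal_integral_count iR fun n => add_nonneg
      (pow_nonneg (Finset.sum_nonneg fun q _ => hy0 q n) _)
      (Finset.sum_nonneg fun q _ => by positivity)]
    have hsplit (n : ℤ) : ENNReal.ofReal ((∑ q ∈ Z, y q n) ^ (R + 1) + ∑ q ∈ Z, x q n ^ (R + 1)) =
        (∑ u ∈ Z.sigma residues,
          ‖bandOp m s ε (fun k => f k * e (-(u.2 / u.1 * k))) (ε * n)‖ₑ ^ 2) ^ (R + 1) +
        ∑ q ∈ Z, ‖F q n‖ₑ ^ (2 * R + 2) := by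
      rw [ENNReal.ofReal_add (pow_nonneg (Finset.sum_nonneg fun q _ => hy0 q n) _)
        (Finset.sum_nonneg fun q _ => by positivity),
        ENNReal.ofReal_pow (Finset.sum_nonneg fun q _ => hy0 q n), Finset.sum_sigma]
      refine congrArg₂ (· + ·) (congrArg (· ^ (R + 1)) ?_) ?_
      · rw [ENNReal.ofReal_sum_of_nonneg fun q _ => hy0 q n]
        refine Finset.sum_congr rfl fun q _ => ?_
        rw [sum_enorm_pow]
        simp only [hy, hφ, modPiece, norm_mul, norm_e, one_mul]
      · rw [sum_enorm_pow]
        simp only [hx, ← pow_mul, mul_add, mul_one]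
    simp only [hsplit]
    rw [ENNReal.tsum_add, Summable.tsum_finsetSum fun _ _ => ENNReal.summable]
    have hA := H3 m hm hs (Z.sigma residues) (fun u => (u.2 / u.1 : ℝ)) ε h0 h1
      (fun u hu => hfrac _ _ (Finset.mem_sigma.1 hu).2) (by
      rintro ⟨q, a⟩ hu ⟨q', a'⟩ hu' hne
      rw [Finset.mem_sigma] at hu hu'
      refine hsep q hu.1 q' hu'.1 a hu.2 a' hu'.2 ?_
      rintro ⟨rfl, rfl⟩; exact hne rfl) s f
    have hB := H4 m hm hs Z ε h0 h1 (fun q hq => ⟨zero_lt_one.trans (hZ q hq).1, by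
      have h2 := hεk (show 1 ≤ 2 * R + 2 by omega)
      have h3 : (q : ℝ) ≤ Q := by exact_mod_cast (hZ q hq).2
      rw [pow_one] at h2
      exact (mul_le_mul_of_nonneg_left h3 h0.le).trans h2⟩) hsep s f
    refine (add_le_add hA hB).trans ?_
    rw [← add_mul, ← ENNReal.ofReal_add hC3.le (by positivity), add_mul C3]
    gcongr
    refine le_mul_of_one_le_right hC3.le (one_le_pow₀ (one_le_pow₀ (by norm_num)))
  have hlhs : ∑' n : ℤ, ‖∑ q ∈ Z, ∑ a ∈ residues q, modPiece m s ε f (a / q) n‖ₑ ^ (2 * R + 2) =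
      ENNReal.ofReal (∫ n, ‖∑ q ∈ Z, F q n‖ ^ (2 * R + 2) ∂Measure.count) := by
    rw [ofReal_integral_count iS fun n => by positivity]
    refine tsum_congr fun n => ?_
    rw [ENNReal.ofReal_pow (norm_nonneg _), ofReal_norm]
  rw [hlhs]
  have hnn : 0 ≤ ∫ n, ((∑ q ∈ Z, y q n) ^ (R + 1) + ∑ q ∈ Z, x q n ^ (R + 1)) ∂Measure.count :=
    integral_nonneg fun n => add_nonneg
      (pow_nonneg (Finset.sum_nonneg fun q _ => hy0 q n) _)
      (Finset.sum_nonneg fun q _ => by positivity)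
  calc _ ≤ ENNReal.ofReal ((C1 + 1) * (C2 + 1) *
        ∫ n, ((∑ q ∈ Z, y q n) ^ (R + 1) + ∑ q ∈ Z, x q n ^ (R + 1)) ∂Measure.count) := by
        apply ENNReal.ofReal_le_ofReal
        refine step1.trans ((mul_le_mul_of_nonneg_left step2 hC1).trans ?_)
        rw [← mul_assoc]
        gcongr <;> linarith
    _ = ENNReal.ofReal ((C1 + 1) * (C2 + 1)) * ENNReal.ofReal
        (∫ n, ((∑ q ∈ Z, y q n) ^ (R + 1) + ∑ q ∈ Z, x q n ^ (R + 1)) ∂Measure.count) :=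
        ENNReal.ofReal_mul (by positivity)
    _ ≤ _ := mul_le_mul_right hrhs _
    _ = _ := by
        rw [← mul_assoc, ← ENNReal.ofReal_mul (by positivity), ← mul_assoc]

/-! ### The convolution kernel of a piece -/

/-- The value at `j` of the convolution kernel of the operator `f ↦ f_v`. -/
noncomputable def pieceKernel (m : ℝ → ℂ) (ε v : ℝ) (j : ℤ) : ℂ :=
  e (v * j) * (ε * kernel m (ε * j))

lemma modPiece_eq_sum (m : ℝ → ℂ) (s : Finset ℤ) (ε : ℝ) (f : ℤ → ℂ) (v : ℝ) (n : ℤ) :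
    modPiece m s ε f v n = ∑ k ∈ s, f k * pieceKernel m ε v (n - k) := by
  rw [modPiece, bandOp, Finset.mul_sum, Finset.mul_sum]
  refine Finset.sum_congr rfl fun k _ => ?_
  have h1 : e (v * ((n - k : ℤ) : ℝ)) = e (v * n) * e (-(v * k)) := by
    rw [← e_add]; push_cast; ring_nf
  have h2 : ε * ((n - k : ℤ) : ℝ) = ε * n - ε * k := by push_cast; ring
  rw [pieceKernel, h1, h2]; ring

lemma fourierZ_eq (f : ℤ → ℂ) (ξ : ℝ) : fourierZ f ξ = ∑' k : ℤ, f k * e (-(k * ξ)) := by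
  refine tsum_congr fun k => ?_
  rw [e]; push_cast; ring_nf

lemma e_add_int (t : ℝ) (l : ℤ) : e (t + l) = e t := by rw [e_add, e_int, mul_one]

lemma fourierZ_add_int (f : ℤ → ℂ) (ξ : ℝ) (l : ℤ) : fourierZ f (ξ + l) = fourierZ f ξ := by
  rw [fourierZ_eq, fourierZ_eq]
  refine tsum_congr fun k => ?_
  rw [show -((k : ℝ) * (ξ + l)) = -(k * ξ) + ((-(k * l) : ℤ) : ℝ) by push_cast; ring, e_add_int]

lemma continuous_fourierZ {f : ℤ → ℂ} (hf : Summable fun k => ‖f k‖) : Continuous (fourierZ f) := by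
  simp only [funext (fourierZ_eq f)]
  exact continuous_tsum (fun k => by fun_prop) hf fun k ξ => by simp

lemma norm_fourierZ_le {f : ℤ → ℂ} (hf : Summable fun k => ‖f k‖) (ξ : ℝ) :
    ‖fourierZ f ξ‖ ≤ ∑' k, ‖f k‖ := by
  rw [fourierZ_eq]
  refine (norm_tsum_le_tsum_norm (by simpa using hf)).trans_eq (by simp)

/-- Integrating the periodization of an integrable function over a period gives its integral. -/
lemma integral_periodization {g : ℝ → ℂ} (hg : Integrable g) :
    ∫ ξ in Set.Ioc (-(1 / 2) : ℝ) (1 / 2), ∑' l : ℤ, g (ξ - l) = ∫ ξ, g ξ := by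
  have key {E : Type} [NormedAddCommGroup E] [NormedSpace ℝ E] {G : ℝ → E} (hG : Integrable G) :
      HasSum (fun l : ℤ => ∫ ξ in Set.Ioc (-(1 / 2) : ℝ) (1 / 2), G (ξ - l)) (∫ ξ, G ξ) := by
    have h1 := hG.hasSum_intervalIntegral (-(1 / 2))
    rw [← (Equiv.neg ℤ).hasSum_iff] at h1
    refine Eq.mp (congrArg (HasSum · _) (funext fun l => ?_)) h1
    rw [← intervalIntegral.integral_of_le (by norm_num), intervalIntegral.integral_comp_sub_right,
      Function.comp_apply]
    congr 1
    · simp; ring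
    · simp; ring
  have h2 (l : ℤ) : Integrable (fun ξ => g (ξ - l))
      (volume.restrict (Set.Ioc (-(1 / 2) : ℝ) (1 / 2))) := (hg.comp_sub_right _).integrableOn
  rw [← integral_tsum_of_summable_integral_norm h2 (key hg.norm).summable]
  exact (key hg).tsum_eq

lemma integral_rescaled_mul_e (m : ℝ → ℂ) {ε : ℝ} (h0 : 0 < ε) (v : ℝ) (j : ℤ) :
    ∫ ξ, m (ε⁻¹ * (ξ - v)) * e (j * ξ) = pieceKernel m ε v j := by
  have h1 : ∀ ξ : ℝ, m (ε⁻¹ * (ξ - v)) * e (j * ξ) =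
      (fun t => e (v * j) * (m t * e (ε * j * t))) (ε⁻¹ * (ξ - v)) := by
    intro ξ
    have : (j : ℝ) * ξ = v * j + ε * j * (ε⁻¹ * (ξ - v)) := by field_simp; ring
    simp only []
    rw [this, e_add]; ring
  simp only [h1]
  rw [integral_sub_right_eq_self (fun ξ => (fun t => e (v * j) * (m t * e (ε * j * t))) (ε⁻¹ * ξ)),
    Measure.integral_comp_mul_left (fun t => e (v * j) * (m t * e (ε * j * t))), integral_const_mul, inv_inv, abs_of_pos h0, pieceKernel, kernel,
    Complex.real_smul]
  ring

/-- On `ℓ¹(ℤ)` the map `f ↦ f_u` is the convolution with `pieceKernel`. -/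
lemma hasSum_piece {m : ℝ → ℂ} (hm : Integrable m) {ε : ℝ} (h0 : 0 < ε) (u : ℚ) {f : ℤ → ℂ}
    (hf : Summable fun k => ‖f k‖) (n : ℤ) :
    HasSum (fun k => f k * pieceKernel m ε u (n - k)) (piece m ε u f n) := by
  have hm' : Integrable fun ξ : ℝ => m (ε⁻¹ * (ξ - u)) :=
    (hm.comp_mul_left' (inv_ne_zero h0.ne')).comp_sub_right _
  have hg : Integrable fun ξ : ℝ => m (ε⁻¹ * (ξ - u)) * (fourierZ f ξ * e (n * ξ)) := by
    refine hm'.mul_bdd (c := ∑' k, ‖f k‖) ?_ (Eventually.of_forall fun ξ => ?_)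
    · have := continuous_fourierZ hf
      exact (by fun_prop : Continuous fun ξ : ℝ => fourierZ f ξ * e (n * ξ)).aestronglyMeasurable
    · simpa using norm_fourierZ_le hf ξ
  have h1 : piece m ε u f n = ∫ ξ : ℝ, m (ε⁻¹ * (ξ - u)) * (fourierZ f ξ * e (n * ξ)) := by
    rw [← integral_periodization hg, piece, invFourierZ]
    refine integral_congr_ae (Eventually.of_forall fun ξ => ?_)
    simp only [shiftedMultiplier]
    rw [mul_assoc, ← tsum_mul_right]
    refine tsum_congr fun l => ?_
    have h2 := fourierZ_add_int f ξ (-l)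
    have h3 : e (n * (ξ - l)) = e (n * ξ) := by
      rw [show (n : ℝ) * (ξ - l) = n * ξ + ((-(n * l) : ℤ) : ℝ) by push_cast; ring, e_add_int]
    rw [Int.cast_neg, ← sub_eq_add_neg] at h2
    rw [h2, h3, e]; push_cast; ring_nf
  have h4 (k : ℤ) : Integrable fun ξ : ℝ => f k * (m (ε⁻¹ * (ξ - u)) * e ((n - k : ℤ) * ξ)) :=
    (integrable_mul_e hm' _).const_mul _
  have h5 : Summable fun k : ℤ => ∫ ξ : ℝ, ‖f k * (m (ε⁻¹ * (ξ - u)) * e ((n - k : ℤ) * ξ))‖ := by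
    simp only [norm_mul, norm_e, mul_one, integral_const_mul]
    exact hf.mul_right _
  have h6 := hasSum_integral_of_summable_integral_norm h4 h5
  simp only [integral_const_mul, integral_rescaled_mul_e m h0] at h6
  rw [h1]
  refine Eq.mp (congrArg (HasSum _) (integral_congr_ae (Eventually.of_forall fun ξ => ?_))) h6
  symm
  simp only []
  rw [fourierZ_eq, ← tsum_mul_right, ← tsum_mul_left]
  refine tsum_congr fun k => ?_
  rw [show ((n - k : ℤ) : ℝ) * ξ = -(k * ξ) + n * ξ by push_cast; ring, e_add]
  ring

/-! ### Extension to `ℓ^p(ℤ)` -/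

lemma ell_norm_pow {N : ℕ} (hN : N ≠ 0) (f : Ell (N : ℝ≥0∞)) :
    HasSum (fun n => ‖f n‖ ^ N) (‖f‖ ^ N) := by
  have h := lp.hasSum_norm (p := (N : ℝ≥0∞)) (by simpa using hN.bot_lt) f
  simpa only [ENNReal.toReal_natCast, Real.rpow_natCast] using h

lemma ell_norm_le {N : ℕ} (hN : N ≠ 0) (f : Ell (N : ℝ≥0∞)) {C : ℝ} (hC : 0 ≤ C)
    (h : ∑' n, ‖f n‖ₑ ^ N ≤ ENNReal.ofReal (C ^ N)) : ‖f‖ ≤ C := by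
  refine le_of_pow_le_pow_left₀ hN hC ?_
  rw [← ENNReal.ofReal_le_ofReal_iff (by positivity), ← (ell_norm_pow hN f).tsum_eq,
    ENNReal.ofReal_tsum_of_nonneg (fun n => by positivity) (ell_norm_pow hN f).summable]
  refine le_of_eq_of_le (tsum_congr fun n => ?_) h
  rw [ENNReal.ofReal_pow (norm_nonneg _), ofReal_norm]

lemma memℓp_of_tsum_ne_top {N : ℕ} {f : ℤ → ℂ} (h : ∑' n, ‖f n‖ₑ ^ N ≠ ⊤) :
    Memℓp f (N : ℝ≥0∞) := by
  refine memℓp_gen ?_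
  simp only [ENNReal.toReal_natCast, Real.rpow_natCast]
  have h1 := ENNReal.summable_toReal h
  simpa using h1

/-- The partial sums of the series of basis vectors representing `f` have norm at most `‖f‖`. -/
lemma sum_enorm_pow_le {N : ℕ} (hN : N ≠ 0) (f : Ell (N : ℝ≥0∞)) (s : Finset ℤ) :
    ∑ k ∈ s, ‖f k‖ₑ ^ N ≤ ENNReal.ofReal (‖f‖ ^ N) := by
  rw [sum_enorm_pow]
  exact ENNReal.ofReal_le_ofReal
    (sum_le_hasSum s (fun _ _ => by positivity) (ell_norm_pow hN f))

lemma summable_norm_single {N : ℕ} (k : ℤ) :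
    Summable fun n => ‖(lp.single (N : ℝ≥0∞) k (1 : ℂ) : Ell (N : ℝ≥0∞)) n‖ := by
  refine summable_of_ne_finset_zero (s := {k}) fun n hn => ?_
  rw [lp.single_apply_ne _ _ _ (by simpa using hn), norm_zero]

section

variable {N : ℕ} [Fact (1 ≤ (N : ℝ≥0∞))]

lemma ell_hasSum_single (f : Ell (N : ℝ≥0∞)) :
    HasSum (fun k => f k • (lp.single (N : ℝ≥0∞) k (1 : ℂ) : Ell (N : ℝ≥0∞))) f := by
  have h := lp.hasSum_single (p := (N : ℝ≥0∞)) (ENNReal.natCast_ne_top N) f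
  refine Eq.mp (congrArg (HasSum · _) (funext fun k => ?_)) h
  rw [← lp.single_smul, smul_eq_mul, mul_one]

/-- A bounded extension of `piece m ε u` is determined by its values on the basis vectors, where it
is given by `pieceKernel`. -/
lemma isBoundedExtension_iff {m : ℝ → ℂ} (hm : Integrable m) {ε : ℝ} (h0 : 0 < ε) (u : ℚ)
    (T : Ell (N : ℝ≥0∞) →ₗ[ℂ] Ell (N : ℝ≥0∞)) :
    IsBoundedExtension (N : ℝ≥0∞) (piece m ε u) T ↔
      (∃ A : ℝ, ∀ f, ‖T f‖ ≤ A * ‖f‖) ∧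
        ∀ k n : ℤ, T (lp.single (N : ℝ≥0∞) k (1 : ℂ)) n = pieceKernel m ε u (n - k) := by
  refine and_congr_right fun ⟨A, hA⟩ => ⟨fun h k n => ?_, fun h f hf n => ?_⟩
  · rw [h _ (summable_norm_single k) n]
    refine (hasSum_piece hm h0 u (summable_norm_single k) n).unique ?_
    convert hasSum_single (f := fun j => (lp.single (N : ℝ≥0∞) k (1 : ℂ) : Ell (N : ℝ≥0∞)) j *
      pieceKernel m ε u (n - j)) k fun j hj => ?_ using 1
    · simp
    · rw [lp.single_apply_ne _ _ _ hj, zero_mul]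
  · refine HasSum.unique ?_ (hasSum_piece hm h0 u hf n)
    have h1 := ((ell_hasSum_single f).mapL (T.mkContinuous A hA)).mapL
      (lp.evalCLM ℂ (fun _ : ℤ => ℂ) (N : ℝ≥0∞) n)
    refine Eq.mp (congrArg (HasSum · _) (funext fun k => ?_)) h1
    rw [map_smul, map_smul]
    exact congrArg (f k * ·) (h k n)

/-- If the convolution with `pieceKernel` is bounded on finitely supported sequences, then
`piece m ε u` has exactly one bounded extension to `ℓ^N(ℤ)`. -/
lemma existsUnique_isBoundedExtension (hN : N ≠ 0) {m : ℝ → ℂ} (hm : Integrable m) {ε : ℝ}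
    (h0 : 0 < ε) (u : ℚ) {C : ℝ} (hC : 0 ≤ C) (hbd : ∀ (s : Finset ℤ) (f : ℤ → ℂ),
      ∑' n : ℤ, ‖∑ k ∈ s, f k * pieceKernel m ε u (n - k)‖ₑ ^ N ≤
        ENNReal.ofReal (C ^ N) * ∑ k ∈ s, ‖f k‖ₑ ^ N) :
    ∃! T : Ell (N : ℝ≥0∞) →ₗ[ℂ] Ell (N : ℝ≥0∞),
      IsBoundedExtension (N : ℝ≥0∞) (piece m ε u) T := by
  refine existsUnique_of_exists_of_unique ?_ fun T T' hT hT' => ?_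
  · have hmem (k : ℤ) : Memℓp (fun n => pieceKernel m ε u (n - k)) (N : ℝ≥0∞) := by
      refine memℓp_of_tsum_ne_top (ne_top_of_le_ne_top ?_ (le_of_eq_of_le ?_ (hbd {k} 1)))
      · simp
      · simp
    -- the inclusion `δ` of the finitely supported sequences, and the convolution `S` on them
    let δ : (ℤ →₀ ℂ) →ₗ[ℂ] Ell (N : ℝ≥0∞) :=
      Finsupp.linearCombination ℂ fun k => lp.single (N : ℝ≥0∞) k (1 : ℂ)
    let S : (ℤ →₀ ℂ) →ₗ[ℂ] Ell (N : ℝ≥0∞) := Finsupp.linearCombination ℂ fun k => ⟨_, hmem k⟩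
    have hδ (f : ℤ →₀ ℂ) (n : ℤ) : δ f n = f n := by
      simp only [δ, Finsupp.linearCombination_apply, Finsupp.sum, lp.coeFn_sum, Finset.sum_apply,
        lp.coeFn_smul, Pi.smul_apply, lp.coeFn_single, smul_eq_mul, Pi.single_apply, mul_ite,
        mul_one, mul_zero, Finset.sum_ite_eq, Finsupp.mem_support_iff]
      split_ifs with h
      · rfl
      · exact (not_not.1 h).symm
    have hS (f : ℤ →₀ ℂ) (n : ℤ) : S f n = ∑ k ∈ f.support, f k * pieceKernel m ε u (n - k) := by
      simp only [S, Finsupp.linearCombination_apply, Finsupp.sum, lp.coeFn_sum, Finset.sum_apply,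
        lp.coeFn_smul, Pi.smul_apply, smul_eq_mul]
    have hdense : DenseRange δ := fun f => by
      refine mem_closure_of_tendsto (ell_hasSum_single f) (Eventually.of_forall fun s => ?_)
      refine ⟨∑ k ∈ s, Finsupp.single k (f k), ?_⟩
      simp [δ, Finsupp.linearCombination_single]
    have hnorm (f : ℤ →₀ ℂ) : ‖S f‖ ≤ C * ‖δ f‖ := by
      refine ell_norm_le hN _ (by positivity) ?_
      simp only [hS]
      refine (hbd f.support f).trans ?_
      rw [mul_pow, ENNReal.ofReal_mul (by positivity)]
      gcongr
      simpa only [hδ] using sum_enorm_pow_le hN (δ f) f.support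
    refine ⟨S.extendOfNorm δ, (isBoundedExtension_iff hm h0 u _).2
      ⟨⟨C, LinearMap.norm_extendOfNorm_apply_le hdense C hnorm⟩, fun k n => ?_⟩⟩
    have h1 : δ (Finsupp.single k 1) = lp.single (N : ℝ≥0∞) k (1 : ℂ) := by
      simp [δ, Finsupp.linearCombination_single]
    have h2 := LinearMap.extendOfNorm_eq hdense ⟨C, hnorm⟩ (Finsupp.single k 1)
    rw [h1] at h2
    rw [ContinuousLinearMap.coe_coe, h2]
    simp [S, Finsupp.linearCombination_single]
  · rw [isBoundedExtension_iff hm h0] at hT hT'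
    obtain ⟨⟨A, hA⟩, hT⟩ := hT
    obtain ⟨⟨A', hA'⟩, hT'⟩ := hT'
    ext1 f
    refine ((ell_hasSum_single f).mapL (T.mkContinuous A hA)).unique ?_
    refine Eq.mp (congrArg (HasSum · _) (funext fun k => ?_))
      ((ell_hasSum_single f).mapL (T'.mkContinuous A' hA'))
    rw [map_smul, map_smul]
    congr 1
    ext n
    exact (hT' k n).trans (hT k n).symm

/-- A bound for a sum of convolutions on finitely supported sequences passes to the sum of the
extensions. -/
lemma norm_sum_isBoundedExtension_le (hN : N ≠ 0) {m : ℝ → ℂ} (hm : Integrable m) {ε : ℝ}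
    (h0 : 0 < ε) (U : Finset ℚ) {C : ℝ} (hC : 0 ≤ C) (hbd : ∀ (s : Finset ℤ) (f : ℤ → ℂ),
      ∑' n : ℤ, ‖∑ u ∈ U, ∑ k ∈ s, f k * pieceKernel m ε u (n - k)‖ₑ ^ N ≤
        ENNReal.ofReal (C ^ N) * ∑ k ∈ s, ‖f k‖ₑ ^ N)
    (T : ℚ → (Ell (N : ℝ≥0∞) →ₗ[ℂ] Ell (N : ℝ≥0∞)))
    (hT : ∀ u ∈ U, IsBoundedExtension (N : ℝ≥0∞) (piece m ε u) (T u)) (f : Ell (N : ℝ≥0∞)) :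
    ‖∑ u ∈ U, T u f‖ ≤ C * ‖f‖ := by
  have hT1 : ∀ u ∈ U, ∃ A : ℝ, ∀ f, ‖T u f‖ ≤ A * ‖f‖ := fun u hu => (hT u hu).1
  have hT2 : ∀ u ∈ U, ∀ k n : ℤ, T u (lp.single (N : ℝ≥0∞) k (1 : ℂ)) n =
      pieceKernel m ε u (n - k) := fun u hu => ((isBoundedExtension_iff hm h0 u _).1 (hT u hu)).2
  choose! A hA using hT1
  have hlim : HasSum (fun k => f k • ∑ u ∈ U, T u (lp.single (N : ℝ≥0∞) k (1 : ℂ)))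
      (∑ u ∈ U, T u f) := by
    simp only [Finset.smul_sum]
    refine hasSum_sum fun u hu => ?_
    refine Eq.mp (congrArg (HasSum · _) (funext fun k => ?_))
      ((ell_hasSum_single f).mapL ((T u).mkContinuous (A u) (hA u hu)))
    rw [map_smul]; rfl
  refine le_of_tendsto hlim.norm (Eventually.of_forall fun s => ?_)
  refine ell_norm_le hN _ (by positivity) ?_
  rw [mul_pow, ENNReal.ofReal_mul (by positivity)]
  refine le_trans ?_ (mul_le_mul_right (sum_enorm_pow_le hN f s) _)
  refine le_of_eq_of_le (tsum_congr fun n => ?_) (hbd s f)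
  congr 2
  rw [Finset.sum_comm]
  simp only [lp.coeFn_sum, Finset.sum_apply, lp.coeFn_smul, Pi.smul_apply, smul_eq_mul,
    Finset.mul_sum]
  exact Finset.sum_congr rfl fun k _ => Finset.sum_congr rfl fun u hu => by rw [hT2 u hu]

end

/-- Since the denominators are pairwise coprime, every fraction has only one representation. -/
lemma sum_fractions {Z : Finset ℕ} {Q : ℕ} (hZ : ∀ q ∈ Z, 1 < q ∧ q ≤ Q)
    (hco : (Z : Set ℕ).Pairwise Nat.Coprime) (g : ℝ → ℂ) :
    ∑ u ∈ fractions Z, g u = ∑ q ∈ Z, ∑ a ∈ residues q, g (a / q) := by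
  have hinj : ∀ q ∈ Z, ∀ q' ∈ Z, ∀ a ∈ residues q, ∀ a' : ℕ, (a / q : ℚ) = a' / q' →
      q = q' ∧ a = a' := by
    intro q hq q' hq' a ha a' h
    by_contra hne
    have h1 := one_le_sq_mul_abs_sub hZ hco hq hq' (a' := a') ha hne
    have h2 : (a / q : ℝ) = a' / q' := by
      simpa using congrArg (fun x : ℚ => (x : ℝ)) h
    rw [h2, sub_self, abs_zero, mul_zero] at h1
    exact absurd h1 (by norm_num)
  rw [fractions, Finset.sum_biUnion]
  · refine Finset.sum_congr rfl fun q hq => ?_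
    refine (Finset.sum_image fun a ha a' _ h => (hinj q hq q hq a ha a' h).2).trans ?_
    exact Finset.sum_congr rfl fun a _ => by push_cast; rfl
  · intro q hq q' hq' hne
    rw [Function.onFun, Finset.disjoint_left]
    intro u hu hu'
    obtain ⟨a, ha, rfl⟩ := Finset.mem_image.1 hu
    obtain ⟨a', -, h⟩ := Finset.mem_image.1 hu'
    exact hne (hinj q hq q' hq' a ha a' h.symm).1

end IonescuWainger

theorem mainTheorem1 (r : ℕ) (hr : 1 ≤ r) (B : ℝ≥0) :
    ∃ C : ℝ, ∀ m : ℝ → ℂ,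
      IsLpMultiplier m ((2 * r : ℕ) : ℝ≥0∞) B →
      Function.support m ⊆ Set.Ioc (-(1 / 2) : ℝ) (1 / 2) →
      ∀ (Z : Finset ℕ) (Q : ℕ),
        (∀ q ∈ Z, 1 < q ∧ q ≤ Q) →
        (Z : Set ℕ).Pairwise Nat.Coprime →
        ∀ ε : ℝ, 0 < ε → ε < (r : ℝ)⁻¹ * ((Q : ℝ) ^ (2 * r))⁻¹ →
          (∀ u ∈ fractions Z, ∃! T : Ell ((2 * r : ℕ) : ℝ≥0∞) →ₗ[ℂ] Ell ((2 * r : ℕ) : ℝ≥0∞),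
            IsBoundedExtension ((2 * r : ℕ) : ℝ≥0∞) (piece m ε u) T) ∧
          ∀ T : ℚ → (Ell ((2 * r : ℕ) : ℝ≥0∞) →ₗ[ℂ] Ell ((2 * r : ℕ) : ℝ≥0∞)),
            (∀ u ∈ fractions Z,
              IsBoundedExtension ((2 * r : ℕ) : ℝ≥0∞) (piece m ε u) (T u)) →
            ∀ f : Ell ((2 * r : ℕ) : ℝ≥0∞),
              ‖∑ u ∈ fractions Z, T u f‖
                ≤ C * ((2 : ℝ) ^ maxOmega Z) ^ (1 - 1 / (r : ℝ)) * ‖f‖ := by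
  obtain ⟨R, rfl⟩ := Nat.exists_eq_add_of_le' hr
  rw [show 2 * (R + 1) = 2 * R + 2 by ring]
  have hN : 2 * R + 2 ≠ 0 := by omega
  have : Fact (1 ≤ ((2 * R + 2 : ℕ) : ℝ≥0∞)) := ⟨by exact_mod_cast (by omega : 1 ≤ 2 * R + 2)⟩
  obtain ⟨C1, hC1, H1⟩ := exists_modPiece_const R B
  obtain ⟨C2, hC2, H2⟩ := exists_finite_support_const R B
  -- the constants from the power estimates become constants for the norms after taking roots
  have root {x : ℝ} (hx : 0 ≤ x) : (x ^ (((2 * R + 2 : ℕ) : ℝ)⁻¹)) ^ (2 * R + 2) = x :=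
    Real.rpow_inv_natCast_pow hx hN
  refine ⟨C2 ^ (((2 * R + 2 : ℕ) : ℝ)⁻¹), fun m hm hs Z Q hZ hco ε h0 hε => ⟨fun u hu => ?_,
    fun T hT f => ?_⟩⟩
  · obtain ⟨q, hq, hu⟩ := Finset.mem_biUnion.1 hu
    obtain ⟨a, ha, rfl⟩ := Finset.mem_image.1 hu
    have h1 : ε ≤ 1 := by
      refine hε.le.trans (mul_le_one₀ (Nat.cast_inv_le_one _) (by positivity) (inv_le_one_of_one_le₀
        (one_le_pow₀ ?_)))
      exact_mod_cast (hZ q hq).1.le.trans (hZ q hq).2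
    have ha2 := (Finset.mem_Icc.1 (Finset.mem_filter.1 ha).1).2
    refine existsUnique_isBoundedExtension hN (integrable_of_multiplier hm hs) h0 _
      (C := C1 ^ (((2 * R + 2 : ℕ) : ℝ)⁻¹)) (by positivity) fun s f => ?_
    rw [root hC1.le]
    simp only [← modPiece_eq_sum]
    push_cast
    exact H1 m hm hs ε h0 h1 _ (by positivity)
      (div_le_one_of_le₀ (by exact_mod_cast ha2) (by positivity)) s f
  · rcases Z.eq_empty_or_nonempty with rfl | ⟨q₀, hq₀⟩
    · simp only [fractions, Finset.biUnion_empty, Finset.sum_empty, norm_zero]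
      positivity
    have hQ : (0 : ℝ) < Q := by
      exact_mod_cast (zero_lt_one.trans (hZ q₀ hq₀).1).trans_le (hZ q₀ hq₀).2
    refine norm_sum_isBoundedExtension_le hN (integrable_of_multiplier hm hs) h0 _ (by positivity)
      (fun s f => ?_) T hT f
    have hε' : (R + 1) * ε * (Q : ℝ) ^ (2 * R + 2) < 1 := by
      rw [← mul_inv, lt_inv_comm₀ h0 (by positivity), ← one_div, lt_div_iff₀ h0] at hε
      push_cast at hε
      linarith
    have hpow : (C2 ^ (((2 * R + 2 : ℕ) : ℝ)⁻¹) *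
        ((2 : ℝ) ^ maxOmega Z) ^ (1 - 1 / ((R + 1 : ℕ) : ℝ))) ^ (2 * R + 2) =
        C2 * (2 ^ maxOmega Z) ^ (2 * R) := by
      rw [mul_pow, root hC2.le, ← Real.rpow_mul_natCast (by positivity), ← Real.rpow_natCast _ (2 * R)]
      congr 2
      push_cast
      field_simp
      ring
    rw [hpow]
    refine le_of_eq_of_le (tsum_congr fun n => ?_) (H2 m hm hs Z Q hZ hco ε h0 hε' s f)
    simp only [← modPiece_eq_sum]
    rw [sum_fractions hZ hco fun v => modPiece m s ε f v n]
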